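/- **Conventions.** A QPT algorithm is a uniform family of quantum circuits (gates $X,H,T,T^\dagger$, CNOT, Toffoli; ancillas start in $|0\rangle$; unused wires are discarded at the end) whose descriptions are written by one program in time polynomial in $n$ from the integer parameters; an adversary is any (possibly non-uniform) family of quantum circuits of size polynomial in $n$. A function $\mu:\mathbb N\to[0,\infty)$ is negligible if for every $c\in\mathbb N$ one has $\mu(x)<x^{-c}$ for all large $x$; $\operatorname{negl}(\lambda)$ stands for $\mu(\lambda(n))$ with some negligible $\mu$. The key length (security parameter) $\lambda=\lambda(n)$ is bounded by a polynomial in $n$ and tends to infinity, and $\mathcal K=\{0,1\}^{\lambda}$. A family $\{U_k\}_{k\in\mathcal K}$ of $n$-qubit unitaries (for each $n$) is a *pseudorandom unitary* (PRU) if (i) some QPT algorithm maps $(k,|\psi\rangle)$ to $U_k|\psi\rangle$ for all $k$ and all states $|\psi\rangle$, and (ii) for every polynomial-size oracle circuit family $\mathcal A$, $$\Big|\Pr_{k\leftarrow\mathcal K}[\mathcal A^{U_k}=1]-\Pr_{U\leftarrow\text{Haar}}[\mathcal A^{U}=1]\Big|\le\operatorname{negl}(\lambda).$$ The generalized Hilbert–Schmidt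 ensemble $\eta_{n,m}$ is the law of $\operatorname{tr}_m|\psi\rangle\langle\psi|$ for a Haar random state $|\psi\rangle$ of $n+m$ qubits. A family of $n$-qubit density matrices $\{\rho_{k,m}\}_{k\in\mathcal K}$ is a *verifiable pseudorandom density matrix* (VPRDM) with mixedness parameter $m=m(n)$ if 1. (efficient preparation) a QPT algorithm with parameters $n,\lambda,m$ outputs exactly $\rho_{k,m}$ on input $k$; 2. (indistinguishability) for every polynomially bounded $t=t(n)$ and every polynomial-size circuit family $\mathcal A$, $$\Big|\Pr_{k\leftarrow\mathcal K}[\mathcal A(\rho_{k,m}^{\otimes t})=1]-\Pr_{\rho\leftarrow\eta_{n,m}}[\mathcal A(\rho^{\otimes t})=1]\Big|\le\operatorname{negl}(\lambda);$$ 3. (efficient verification) there is a QPT algorithm $\mathcal V$ with parameters $n,\lambda,m$ such that $\Pr[\mathcal V(\rho_{k,m},k)=1]=1$ for all $k$ (completeness), and $\Pr_{k'\leftarrow\mathcal K\setminus\{k\}}[\mathcal V(\rho_{k,m},k')=1]\le\operatorname{negl}(\lambda)$ with one negligible function for all $n$ and $k$ (soundness). **Lemma.** Let $\{U_k\}_{k\in\mathcal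 K}$ be a PRU, and let $m=m(n)\le n$ satisfy $n-m(n)=\omega(\log n)$ (for instance $m(n)<n-(\log n)^c$ for all large $n$, with a constant $c>1$). Let $\sigma_m=I/2^m$. Then $$\rho_{k,m}=U_k\big(|0\rangle\langle 0|^{\otimes(n-m)}\otimes\sigma_m\big)U_k^\dagger$$ is a VPRDM with mixedness parameter $m$. Moreover the verification algorithm $\mathcal V$ can be taken to accept every $n$-qubit state $\rho$ under every key $k$ with probability exactly $$\operatorname{tr}\!\Big(|0\rangle\langle0|^{\otimes(n-m)}\operatorname{tr}_m\big(U_k^\dagger\rho\,U_k\big)\Big),$$ where $\operatorname{tr}_m$ traces out the last $m$ qubits. -/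

import Mathlib

open scoped Matrix BigOperators ComplexOrder
open MeasureTheory

namespace QCrypto

/-! ## Registers of qubits, states, tensor products and partial traces -/

/-- Bit strings of length `n`: they label the computational basis of `n` qubits. -/
abbrev Bits (n : ℕ) : Type := Fin n → Bool

/-- Operators on `n` qubits, as matrices in the computational basis. -/
abbrev QMat (n : ℕ) : Type := Matrix (Bits n) (Bits n) ℂ

/-- `ρ` is a density matrix. -/
def IsDensity {n : ℕ} (ρ : QMat n) : Prop := ρ.PosSemidef ∧ ρ.trace = 1

/-- The operator `|ψ⟩⟨ψ|`. -/
def proj {n : ℕ} (ψ : Bits n → ℂ) : QMat n := Matrix.vecMulVec ψ (star ψ)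

/-- The basis state `|x⟩⟨x|`. -/
def ket {n : ℕ} (x : Bits n) : QMat n := Matrix.single x x 1

/-- The state `|0⟩⟨0|^{⊗ n}`. -/
def zeroState (n : ℕ) : QMat n := ket (fun _ => false)

/-- The maximally mixed state `σ_m = I / 2 ^ m` of `m` qubits. -/
noncomputable def mixedState (m : ℕ) : QMat m := ((2 : ℂ) ^ m)⁻¹ • (1 : QMat m)

/-- `A ⊗ B`, with `A` on the first `a` qubits and `B` on the last `b` qubits. -/
def tens {a b : ℕ} (A : QMat a) (B : QMat b) : QMat (a + b) := fun x y =>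
  A (fun i => x (Fin.castAdd b i)) (fun i => y (Fin.castAdd b i)) *
    B (fun j => x (Fin.natAdd a j)) (fun j => y (Fin.natAdd a j))

/-- `ρ^{⊗ t}` for an `n`-qubit operator `ρ`; copy `i` occupies the qubits `i * n + j`, `j < n`. -/
def tensPow {n : ℕ} (t : ℕ) (ρ : QMat n) : QMat (t * n) := fun x y =>
  ∏ i : Fin t, ρ (fun j => x (finProdFinEquiv (i, j))) (fun j => y (finProdFinEquiv (i, j)))

/-- Partial trace over the last `b` qubits. -/
def traceRight {a b : ℕ} (A : QMat (a + b)) : QMat a := fun x y =>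
  ∑ z : Bits b, A (Fin.append x z) (Fin.append y z)

/-- Partial trace over the first `a` qubits. -/
def traceLeft {a b : ℕ} (A : QMat (a + b)) : QMat b := fun x y =>
  ∑ z : Bits a, A (Fin.append z x) (Fin.append z y)

/-- Transport along an equality between numbers of qubits; the order of the qubits is kept. -/
def recast {a b : ℕ} (h : a = b) (A : QMat a) : QMat b := fun x y =>
  A (fun i => x (Fin.cast h i)) (fun i => y (Fin.cast h i))

/-! ## Haar measure -/

/-- The group of unitary operators on `n` qubits. -/
abbrev UGroup (n : ℕ) : Type := Matrix.unitaryGroup (Bits n) ℂ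

noncomputable instance instMeasurableSpaceUGroup (n : ℕ) : MeasurableSpace (UGroup n) := borel _

instance instBorelSpaceUGroup (n : ℕ) : BorelSpace (UGroup n) := ⟨rfl⟩

noncomputable instance instMeasurableSpaceQMat (n : ℕ) : MeasurableSpace (QMat n) := borel _

instance instBorelSpaceQMat (n : ℕ) : BorelSpace (QMat n) := ⟨rfl⟩

instance instCompactSpaceUGroup (n : ℕ) : CompactSpace (UGroup n) := by
  refine isCompact_iff_compactSpace.mp ?_
  have hK : IsCompact (Set.pi Set.univ fun _ : Bits n => Set.pi Set.univ fun _ : Bits n =>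
      Metric.closedBall (0 : ℂ) 1) :=
    isCompact_univ_pi fun _ => isCompact_univ_pi fun _ => isCompact_closedBall _ _
  refine IsCompact.of_isClosed_subset (s := (Set.pi Set.univ fun _ : Bits n =>
    Set.pi Set.univ fun _ : Bits n => Metric.closedBall (0 : ℂ) 1 : Set (QMat n))) hK ?_ ?_
  · have : (Matrix.unitaryGroup (Bits n) ℂ : Set (QMat n)) = {A | A * star A = 1} := by
      ext A
      exact Matrix.mem_unitaryGroup_iff
    change IsClosed (Matrix.unitaryGroup (Bits n) ℂ : Set (QMat n))
    rw [this]
    exact isClosed_eq (by fun_prop) continuous_const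
  · intro A hA i _ j _
    simpa using entry_norm_bound_of_unitary hA i j

/-- The Haar probability measure on the unitary group of `n` qubits. -/
noncomputable def haarU (n : ℕ) : Measure (UGroup n) := Measure.haarMeasure ⊤

/-- The `n`-qubit state `tr_m |ψ⟩⟨ψ|` for the `(n+m)`-qubit state `|ψ⟩ = V |0…0⟩`. -/
def reducedState (n m : ℕ) (V : UGroup (n + m)) : QMat n :=
  traceRight ((V : QMat (n + m)) * zeroState (n + m) * (V : QMat (n + m))ᴴ)

/-- The generalized Hilbert-Schmidt ensemble `η_{n,m}`: the law of `tr_m |ψ⟩⟨ψ|` for a Haar random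
state `|ψ⟩` of `n + m` qubits, i.e. `|ψ⟩ = V |0…0⟩` with `V` a Haar random unitary. -/
noncomputable def ghse (n m : ℕ) : Measure (QMat n) := (haarU (n + m)).map (reducedState n m)

theorem continuous_reducedState (n m : ℕ) : Continuous (reducedState n m) := by
  unfold reducedState traceRight
  refine continuous_pi fun x => continuous_pi fun y => continuous_finsetSum _ fun z _ => ?_
  have h : Continuous fun V : UGroup (n + m) =>
      (V : QMat (n + m)) * zeroState (n + m) * (V : QMat (n + m))ᴴ := by fun_prop
  exact h.matrix_elem _ _

instance instIsProbabilityMeasureHaarU (n : ℕ) : IsProbabilityMeasure (haarU n) :=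
  ⟨Measure.haarMeasure_self⟩

instance instIsProbabilityMeasureGhse (n m : ℕ) : IsProbabilityMeasure (ghse n m) :=
  Measure.isProbabilityMeasure_map (continuous_reducedState n m).measurable.aemeasurable

/-! ## Quantum circuits -/

/-- The elementary gates on `W` qubits: `X`, Hadamard, `T`, `T†`, controlled-`X` (control `i`,
target `j`) and Toffoli (controls `i`, `j`, target `k`). -/
inductive Gate (W : ℕ) : Type
  | x (i : Fin W)
  | had (i : Fin W)
  | t (i : Fin W)
  | tdg (i : Fin W)
  | cx (i j : Fin W) (hij : i ≠ j)
  | ccx (i j k : Fin W) (hij : i ≠ j) (hik : i ≠ k) (hjk : j ≠ k)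

/-- The matrix of the basis change `|b⟩ ↦ |f b⟩`. -/
def basisMap {W : ℕ} (f : Bits W → Bits W) : QMat W := fun a b => if a = f b then 1 else 0

/-- The unitary matrix of a gate. -/
noncomputable def Gate.mat {W : ℕ} : Gate W → QMat W
  | .x i => basisMap fun b => Function.update b i (!(b i))
  | .had i => fun a b =>
      if ∀ l, l ≠ i → a l = b l then
        ((Real.sqrt 2 : ℝ) : ℂ)⁻¹ * (if (a i && b i) = true then -1 else 1)
      else 0
  | .t i => Matrix.diagonal fun a =>
      if a i = true then Complex.exp (Complex.I * (Real.pi / 4)) else 1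
  | .tdg i => Matrix.diagonal fun a =>
      if a i = true then Complex.exp (-(Complex.I * (Real.pi / 4))) else 1
  | .cx i j _ => basisMap fun b => Function.update b j (xor (b j) (b i))
  | .ccx i j k _ _ _ => basisMap fun b => Function.update b k (xor (b k) (b i && b j))

/-- A quantum circuit with `L` input qubits (the wires `0, …, L - 1`), followed by `anc` ancilla
qubits that start in `|0⟩`, and a list of gates, the first of which is applied first. -/
structure Circuit (L : ℕ) : Type where
  anc : ℕ
  gates : List (Gate (L + anc))

namespace Circuit

/-- The unitary matrix of the circuit. -/
noncomputable def mat {L : ℕ} (C : Circuit L) : QMat (L + C.anc) :=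
  C.gates.foldl (fun M g => g.mat * M) 1

/-- The final state of all wires on the input state `ρ`. -/
noncomputable def run {L : ℕ} (C : Circuit L) (ρ : QMat L) : QMat (L + C.anc) :=
  C.mat * tens ρ (zeroState C.anc) * C.matᴴ

/-- The output state in the wires `l, …, l + n - 1` (the last `n` input wires); all the other wires
are discarded. -/
noncomputable def output {l n : ℕ} (C : Circuit (l + n)) (ρ : QMat (l + n)) : QMat n :=
  traceLeft (traceRight (C.run ρ))

/-- The number of ancilla qubits plus the number of gates. -/
def size {L : ℕ} (C : Circuit L) : ℕ := C.anc + C.gates.length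

end Circuit

/-- The probability that wire `0` is found to be `1` in a measurement of the state `ρ`. -/
noncomputable def probOne {W : ℕ} (ρ : QMat W) : ℝ :=
  ∑ a : Bits W, if ∃ i : Fin W, (i : ℕ) = 0 ∧ a i = true then (ρ a a).re else 0

/-- The probability that the circuit accepts (outputs `1`) on the input state `ρ`. -/
noncomputable def Circuit.acc {L : ℕ} (C : Circuit L) (ρ : QMat L) : ℝ := probOne (C.run ρ)

/-- A step of a circuit on `W` wires with an oracle for `n`-qubit unitaries: an elementary gate, or
a query that applies the oracle to the wires `e 0, …, e (n - 1)`. -/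
inductive OGate (n W : ℕ) : Type
  | gate (g : Gate W)
  | query (e : Fin n ↪ Fin W)

/-- The matrix of a step, when the oracle is the unitary `U`. -/
noncomputable def OGate.mat {n W : ℕ} (U : QMat n) : OGate n W → QMat W
  | .gate g => g.mat
  | .query e => fun a b =>
      if ∀ l, l ∉ Set.range e → a l = b l then U (fun i => a (e i)) (fun i => b (e i)) else 0

/-- A circuit with oracle access to an `n`-qubit unitary; its wires start in `|0⟩`. -/
structure OracleCircuit (n : ℕ) : Type where
  width : ℕ
  gates : List (OGate n width)

namespace OracleCircuit

/-- The number of wires plus the number of gates and queries. -/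
def size {n : ℕ} (A : OracleCircuit n) : ℕ := A.width + A.gates.length

/-- The matrix of the whole circuit, when the oracle is the unitary `U`. -/
noncomputable def mat {n : ℕ} (A : OracleCircuit n) (U : QMat n) : QMat A.width :=
  A.gates.foldl (fun M g => g.mat U * M) 1

/-- The probability that the circuit accepts (outputs `1`), when the oracle is `U`. -/
noncomputable def acc {n : ℕ} (A : OracleCircuit n) (U : QMat n) : ℝ :=
  probOne (A.mat U * zeroState A.width * (A.mat U)ᴴ)

end OracleCircuit

/-! ## Polynomial-time programs and uniform circuit families -/

/-- The memory of the machine: counters and stacks of natural numbers. -/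
structure Store : Type where
  reg : ℕ → ℕ
  stk : ℕ → List ℕ

/-- Assign `v` to the counter `r`. -/
def Store.setReg (s : Store) (r v : ℕ) : Store := ⟨Function.update s.reg r v, s.stk⟩

/-- Assign `l` to the stack `i`. -/
def Store.setStk (s : Store) (i : ℕ) (l : List ℕ) : Store := ⟨s.reg, Function.update s.stk i l⟩

/-- The initial memory: the inputs are in the first counters, everything else is empty. -/
def Store.init (inp : List ℕ) : Store := ⟨fun r => inp.getD r 0, fun _ => []⟩

/-- Programs of the machine. -/
inductive Prog : Type
  | const (r c : ℕ)
  | plus (r a b : ℕ)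
  | minus (r a b : ℕ)
  | push (i r : ℕ)
  | pop (r i : ℕ)
  | seq (p q : Prog)
  | ite (r : ℕ) (p q : Prog)
  | loop (r : ℕ) (p : Prog)

/-- `Exec p s s' T`: the program `p`, started in the memory `s`, halts in the memory `s'` after `T`
steps. Here `loop r p` repeats `p` while the counter `r` is nonzero, `ite r p q` runs `p` if the
counter `r` is nonzero and `q` otherwise, and `pop` returns `0` on an empty stack. -/
inductive Exec : Prog → Store → Store → ℕ → Prop
  | const (r c : ℕ) (s : Store) : Exec (.const r c) s (s.setReg r c) 1
  | plus (r a b : ℕ) (s : Store) : Exec (.plus r a b) s (s.setReg r (s.reg a + s.reg b)) 1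
  | minus (r a b : ℕ) (s : Store) : Exec (.minus r a b) s (s.setReg r (s.reg a - s.reg b)) 1
  | push (i r : ℕ) (s : Store) : Exec (.push i r) s (s.setStk i (s.reg r :: s.stk i)) 1
  | pop (r i : ℕ) (s : Store) :
      Exec (.pop r i) s ((s.setReg r ((s.stk i).headD 0)).setStk i (s.stk i).tail) 1
  | seq {p q : Prog} {s s' s'' : Store} {T T' : ℕ} :
      Exec p s s' T → Exec q s' s'' T' → Exec (.seq p q) s s'' (T + T')
  | ite_true {r : ℕ} {p q : Prog} {s s' : Store} {T : ℕ} :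
      s.reg r ≠ 0 → Exec p s s' T → Exec (.ite r p q) s s' (T + 1)
  | ite_false {r : ℕ} {p q : Prog} {s s' : Store} {T : ℕ} :
      s.reg r = 0 → Exec q s s' T → Exec (.ite r p q) s s' (T + 1)
  | loop_done {r : ℕ} {p : Prog} {s : Store} : s.reg r = 0 → Exec (.loop r p) s s 1
  | loop_step {r : ℕ} {p : Prog} {s s' s'' : Store} {T T' : ℕ} :
      s.reg r ≠ 0 → Exec p s s' T → Exec (.loop r p) s' s'' T' →
        Exec (.loop r p) s s'' (T + T' + 1)

/-- The code of a gate: its kind and three wires (padded with `0`). -/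
def Gate.code {W : ℕ} : Gate W → List ℕ
  | .x i => [1, i, 0, 0]
  | .had i => [2, i, 0, 0]
  | .t i => [3, i, 0, 0]
  | .tdg i => [4, i, 0, 0]
  | .cx i j _ => [5, i, j, 0]
  | .ccx i j k _ _ _ => [6, i, j, k]

/-- `f` is bounded by a polynomial. -/
def PolyBounded (f : ℕ → ℕ) : Prop := ∃ c : ℕ, ∀ n, f n ≤ n ^ c + c

/-- A QPT algorithm, i.e. a uniform family of polynomial-size quantum circuits: one program writes
the description of the `n`-th circuit (the number of ancillas in counter `0`, the codes of the gates
on stack `0`), from the numbers `inp n`, in time polynomial in `n`. -/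
def IsQPT (L : ℕ → ℕ) (inp : ℕ → List ℕ) (C : ∀ n, Circuit (L n)) : Prop :=
  PolyBounded (fun n => (C n).size) ∧
  ∃ (P : Prog) (time : ℕ → ℕ), PolyBounded time ∧ ∀ n, ∃ s : Store,
    Exec P (Store.init (inp n)) s (time n) ∧
    s.reg 0 = (C n).anc ∧ s.stk 0 = (C n).gates.flatMap Gate.code

/-! ## Negligible functions, pseudorandom unitaries, pseudorandom density matrices -/

/-- Negligible functions. -/
def Negligible (μ : ℕ → ℝ) : Prop :=
  (∀ n, 0 ≤ μ n) ∧ ∀ c : ℕ, ∃ n₀ : ℕ, ∀ n, n₀ < n → μ n < ((n : ℝ) ^ c)⁻¹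

/-- The family `U` of unitaries on `n` qubits, with keys of `lam n` bits, is pseudorandom: it is
computed by a QPT algorithm, and no polynomial-size oracle circuits distinguish `U k`, for a uniformly
random key `k`, from a Haar random unitary. -/
def IsPRU (lam : ℕ → ℕ) (U : ∀ n, Bits (lam n) → UGroup n) : Prop :=
  (∃ G : ∀ n, Circuit (lam n + n),
    IsQPT (fun n => lam n + n) (fun n => [n, lam n]) G ∧
    ∀ (n : ℕ) (k : Bits (lam n)) (ψ : Bits n → ℂ), star ψ ⬝ᵥ ψ = 1 →
      (G n).output (tens (ket k) (proj ψ)) = proj ((U n k : QMat n) *ᵥ ψ)) ∧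
  ∀ A : ∀ n, OracleCircuit n, PolyBounded (fun n => (A n).size) →
    ∃ μ : ℕ → ℝ, Negligible μ ∧ ∀ n,
      |(Finset.univ.expect fun k : Bits (lam n) => (A n).acc (U n k : QMat n))
        - ∫ V : UGroup n, (A n).acc (V : QMat n) ∂(haarU n)| ≤ μ (lam n)

/-- Efficient preparation: a QPT algorithm outputs exactly `ρ n k` on the key `k`, with `n`, the key
length and the mixedness parameter as further inputs. -/
def EfficientlyPreparable (lam m : ℕ → ℕ) (ρ : ∀ n, Bits (lam n) → QMat n) : Prop :=
  ∃ G : ∀ n, Circuit (lam n + n),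
    IsQPT (fun n => lam n + n) (fun n => [n, lam n, m n]) G ∧
    ∀ (n : ℕ) (k : Bits (lam n)), (G n).output (tens (ket k) (zeroState n)) = ρ n k

/-- Computational indistinguishability: no polynomial-size circuits distinguish polynomially many
copies of `ρ n k`, for one random key `k`, from as many copies of one state from `η_{n,m}`. -/
def IndistFromGHSE (lam m : ℕ → ℕ) (ρ : ∀ n, Bits (lam n) → QMat n) : Prop :=
  ∀ t : ℕ → ℕ, PolyBounded t → ∀ A : ∀ n, Circuit (t n * n),
    PolyBounded (fun n => (A n).size) →
    ∃ μ : ℕ → ℝ, Negligible μ ∧ ∀ n,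
      |(Finset.univ.expect fun k : Bits (lam n) => (A n).acc (tensPow (t n) (ρ n k)))
        - ∫ σ : QMat n, (A n).acc (tensPow (t n) σ) ∂(ghse n (m n))| ≤ μ (lam n)

/-- `V` is an efficient verification algorithm for `ρ`: it is QPT, it accepts `ρ n k` with
certainty when given the key `k` (completeness), and for every `k` it accepts `ρ n k` with only
negligible probability when given a uniformly random key `k' ≠ k` (soundness). -/
def IsVerifier (lam m : ℕ → ℕ) (ρ : ∀ n, Bits (lam n) → QMat n)
    (V : ∀ n, Circuit (lam n + n)) : Prop :=
  IsQPT (fun n => lam n + n) (fun n => [n, lam n, m n]) V ∧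
  (∀ (n : ℕ) (k : Bits (lam n)), (V n).acc (tens (ket k) (ρ n k)) = 1) ∧
  ∃ μ : ℕ → ℝ, Negligible μ ∧ ∀ (n : ℕ) (k : Bits (lam n)),
    ((Finset.univ.erase k).expect fun k' => (V n).acc (tens (ket k') (ρ n k))) ≤ μ (lam n)

/-- Verifiable pseudorandom density matrices with mixedness parameter `m`. -/
def IsVPRDM (lam m : ℕ → ℕ) (ρ : ∀ n, Bits (lam n) → QMat n) : Prop :=
  (∀ n k, IsDensity (ρ n k)) ∧
  EfficientlyPreparable lam m ρ ∧
  IndistFromGHSE lam m ρ ∧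
  ∃ V : ∀ n, Circuit (lam n + n), IsVerifier lam m ρ V

/-- The state `U (|0⟩⟨0|^{⊗ (n-m)} ⊗ σ_m) U†`. -/
noncomputable def scrambled {n m : ℕ} (h : m ≤ n) (U : UGroup n) : QMat n :=
  (U : QMat n) * recast (Nat.sub_add_cancel h) (tens (zeroState (n - m)) (mixedState m))
    * (U : QMat n)ᴴ

end QCrypto

open QCrypto

/-! Preparation. A maximally mixed qubit is one half of an entangled pair, so elementary gates
produce `|0⟩⟨0| ⊗ σ_m` exactly once the other halves are discarded; feeding it to the given circuit
for `U_k` prepares the state (`prepCircuit_output`). That circuit is specified only on pure states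
and may leave garbage. Linearity extends it to mixed states (`Circuit.output_eq_of_proj`), and
purity of its outputs forces the garbage to be one vector independent of the data
(`exists_garbage`).

Verification. One wants to undo `U_k` and test whether the first `n - m` qubits are zero, but
running the circuit backwards requires its garbage. The verifier therefore runs the circuit once on
fresh zero data to create the garbage, swaps the real data in, and then runs the circuit backwards
(`uncompute_mulVec`). The acceptance probability is exactly the stated trace (`verifyCircuit_acc`,
`lowProb_eq_trace`), and completeness is immediate.

Soundness. The acceptance probability of the state of one key under another key is symmetric in the
two keys (`lowProb_scrambled_comm`). Hence averaging over the wrong key `k'` amounts to preparing a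
state with the oracle `U_{k'}` and verifying it under a fixed key, an experiment covered by
pseudorandomness. Its Haar value is `2^m / 2^n` (`integral_lowProb`). The worst fixed key is
hard-wired, as adversaries are non-uniform.

Indistinguishability. Pseudorandomness replaces `U_k` by a Haar unitary; the rest is statistical. A
reduced Haar state has at most `2^m` nonzero eigenvalues, and second moments bound `2^m` times its
mean purity by `1 + 6 * 2^m / 2^n` (`integral_purity_le`), so its spectrum is nearly flat. Both
ensembles are invariant under unitary conjugation, so eigenbases may be aligned, and `t` copies
differ by at most `4 t √(2^m / 2^n)` (`abs_integral_haarU_sub_ghse_le`). The gap between `n` and `m`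
beats every polynomial, and `exists_negligible_add` turns this into a negligible function of the key
length.

Uniformity is proved by explicit programs that transform the gate codes of the given circuit
(`isQPT_prepCircuit`, `isQPT_verifyCircuit`). -/

namespace QCrypto

/-! ## Operators on a subset of the wires -/

section Lift

variable {a b W : ℕ}

/-- The operator `A` acting on the wires `e 0, …, e (a - 1)` out of `W`. -/
def lift (e : Fin a ↪ Fin W) (A : QMat a) : QMat W := fun x y =>
  if ∀ l, l ∉ Set.range e → x l = y l then A (fun i => x (e i)) (fun i => y (e i)) else 0

/-- The bit string that is `y` on the wires in the range of `e`, and `x` elsewhere. -/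
noncomputable def overwrite (e : Fin a ↪ Fin W) (y : Bits a) (x : Bits W) : Bits W :=
  Function.extend e y x

/-- The reduced state of the wires `e 0, …, e (a - 1)`. -/
noncomputable def marginal (e : Fin a ↪ Fin W) (ρ : QMat W) : QMat a := fun x y =>
  ∑ z : Bits W, if (fun i => z (e i)) = x then ρ z (overwrite e y z) else 0

@[simp] theorem overwrite_apply (e : Fin a ↪ Fin W) (y : Bits a) (x : Bits W) (i : Fin a) :
    overwrite e y x (e i) = y i := e.injective.extend_apply _ _ _

theorem overwrite_of_notMem {e : Fin a ↪ Fin W} (y : Bits a) (x : Bits W) {l : Fin W}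
    (hl : l ∉ Set.range e) : overwrite e y x l = x l := Function.extend_apply' _ _ _ hl

theorem overwrite_eq {e : Fin a ↪ Fin W} {y : Bits a} {x z : Bits W}
    (h : ∀ l, l ∉ Set.range e → x l = z l) (hz : ∀ i, z (e i) = y i) : overwrite e y x = z := by
  funext l
  by_cases hl : l ∈ Set.range e
  · obtain ⟨i, rfl⟩ := hl
    simp [hz]
  · rw [overwrite_of_notMem _ _ hl, h l hl]

theorem overwrite_congr {e : Fin a ↪ Fin W} (y : Bits a) {x z : Bits W}
    (h : ∀ l, l ∉ Set.range e → x l = z l) : overwrite e y x = overwrite e y z :=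
  overwrite_eq (fun l hl => by rw [overwrite_of_notMem _ _ hl, h l hl]) (by simp)

@[simp] theorem overwrite_overwrite (e : Fin a ↪ Fin W) (y z : Bits a) (x : Bits W) :
    overwrite e y (overwrite e z x) = overwrite e y x :=
  overwrite_congr _ fun _ hl => overwrite_of_notMem _ _ hl

@[simp] theorem overwrite_self (e : Fin a ↪ Fin W) (x : Bits W) :
    overwrite e (fun i => x (e i)) x = x := overwrite_eq (fun _ _ => rfl) (fun _ => rfl)

/-- A string that agrees with `x` off `e` is determined by its bits on `e`. This reduces products
with `lift e A` to sums over `Bits a`. -/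
theorem sum_agree {M : Type*} [AddCommMonoid M] (e : Fin a ↪ Fin W) (x : Bits W)
    (F : Bits W → M) :
    (∑ z : Bits W, if ∀ l, l ∉ Set.range e → x l = z l then F z else 0) =
      ∑ y : Bits a, F (overwrite e y x) := by
  rw [← Finset.sum_filter]
  refine Finset.sum_nbij' (fun z i => z (e i)) (fun y => overwrite e y x) ?_ ?_ ?_ ?_ ?_
  · simp
  · intro y _
    simp only [Finset.mem_filter, Finset.mem_univ, true_and]
    exact fun l hl => (overwrite_of_notMem _ _ hl).symm
  · intro z hz
    exact overwrite_eq (Finset.mem_filter.mp hz).2 fun _ => rfl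
  · intro y _
    funext i
    simp
  · intro z hz
    congr 1
    exact (overwrite_eq (Finset.mem_filter.mp hz).2 fun _ => rfl).symm

theorem lift_apply_overwrite (e : Fin a ↪ Fin W) (A : QMat a) (x : Bits W) (y : Bits a) :
    lift e A x (overwrite e y x) = A (fun i => x (e i)) y := by
  unfold lift
  rw [if_pos fun l hl => (overwrite_of_notMem _ _ hl).symm]
  simp

theorem sum_lift_mul (e : Fin a ↪ Fin W) (A : QMat a) (x : Bits W) (F : Bits W → ℂ) :
    ∑ z, lift e A x z * F z = ∑ y, A (fun i => x (e i)) y * F (overwrite e y x) := by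
  rw [← Finset.sum_congr rfl fun y _ => congrArg (· * F (overwrite e y x))
    (lift_apply_overwrite e A x y), ← sum_agree e x (fun z => lift e A x z * F z)]
  refine Finset.sum_congr rfl fun z _ => ?_
  unfold lift
  split_ifs <;> simp

theorem lift_mulVec (e : Fin a ↪ Fin W) (A : QMat a) (v : Bits W → ℂ) (x : Bits W) :
    (lift e A *ᵥ v) x = ∑ y, A (fun i => x (e i)) y * v (overwrite e y x) :=
  sum_lift_mul e A x v

/-- An operator on the wires `e` acts on the first factor of a product vector. -/
theorem lift_mulVec_mul (e : Fin a ↪ Fin W) (A : QMat a) (φ : Bits a → ℂ) (χ : Bits W → ℂ)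
    (hχ : ∀ y x, χ (overwrite e y x) = χ x) (x : Bits W) :
    (lift e A *ᵥ fun z => φ (fun i => z (e i)) * χ z) x =
      (A *ᵥ φ) (fun i => x (e i)) * χ x := by
  rw [lift_mulVec]
  simp [hχ, Matrix.mulVec, dotProduct, Finset.sum_mul, mul_assoc]

theorem lift_mul (e : Fin a ↪ Fin W) (A B : QMat a) : lift e (A * B) = lift e A * lift e B := by
  ext x z
  rw [Matrix.mul_apply, sum_lift_mul e A x (fun y => lift e B y z)]
  have h : ∀ y : Bits a, (∀ l, l ∉ Set.range e → overwrite e y x l = z l) ↔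
      ∀ l, l ∉ Set.range e → x l = z l := fun y =>
    forall₂_congr fun l hl => by rw [overwrite_of_notMem _ _ hl]
  unfold lift
  simp only [h, overwrite_apply, Matrix.mul_apply]
  split_ifs <;> simp

theorem lift_one (e : Fin a ↪ Fin W) : lift e (1 : QMat a) = 1 := by
  ext x z
  unfold lift
  simp only [Matrix.one_apply]
  rw [← ite_and]
  refine if_congr ⟨fun h => ?_, fun h => by simp [h]⟩ rfl rfl
  rw [← overwrite_eq h.1 (y := fun i => x (e i)) (fun i => (congrFun h.2 i).symm)]
  simp

theorem lift_conjTranspose (e : Fin a ↪ Fin W) (A : QMat a) : lift e Aᴴ = (lift e A)ᴴ := by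
  ext x z
  simp only [lift, Matrix.conjTranspose_apply]
  rw [apply_ite star, star_zero]
  exact if_congr (forall₂_congr fun _ _ => eq_comm) rfl rfl

/-- Overwriting the bits on `e` is a bijection between the fibres of restriction to `e` over `x` and
over `p`. -/
theorem sum_eq_overwrite (e : Fin a ↪ Fin W) (x p : Bits a) (F : Bits W → ℂ) :
    (∑ z : Bits W, if (fun i => z (e i)) = x then F (overwrite e p z) else 0) =
      ∑ z : Bits W, if (fun i => z (e i)) = p then F z else 0 := by
  rw [← Finset.sum_filter, ← Finset.sum_filter]
  refine Finset.sum_nbij' (fun z => overwrite e p z) (fun z => overwrite e x z) ?_ ?_ ?_ ?_ ?_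
  · simp
  · simp
  · intro z hz
    simp [← (Finset.mem_filter.mp hz).2]
  · intro z hz
    simp [← (Finset.mem_filter.mp hz).2]
  · intro z _
    rfl

/-- The partial trace commutes with operators on the retained wires. Left multiplication only moves
between fibres of restriction to `e`; right multiplication follows by taking adjoints. -/
theorem marginal_lift (e : Fin a ↪ Fin W) (A : QMat a) (ρ : QMat W) :
    marginal e (lift e A * ρ * (lift e A)ᴴ) = A * marginal e ρ * Aᴴ := by
  have hR : ∀ (B : QMat W), marginal e (lift e A * B) = A * marginal e B := by
    intro B
    ext x y
    simp only [marginal, Matrix.mul_apply, Finset.mul_sum]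
    simp_rw [fun z => sum_lift_mul e A z fun j => B j (overwrite e y z)]
    have : ∀ z : Bits W, (if (fun i => z (e i)) = x then
        ∑ p, A (fun i => z (e i)) p * B (overwrite e p z) (overwrite e y z) else 0) =
        ∑ p, if (fun i => z (e i)) = x then
          A x p * B (overwrite e p z) (overwrite e y (overwrite e p z)) else 0 := by
      intro z
      split_ifs with h
      · simp [h]
      · simp
    rw [Finset.sum_congr rfl fun z _ => this z, Finset.sum_comm]
    refine Finset.sum_congr rfl fun p _ => ?_
    rw [sum_eq_overwrite e x p fun z => A x p * B z (overwrite e y z)]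
    refine Finset.sum_congr rfl fun z _ => ?_
    split_ifs <;> simp
  have hL : ∀ (B : QMat W), (marginal e B)ᴴ = marginal e Bᴴ := by
    intro B
    ext x y
    simp only [marginal, Matrix.conjTranspose_apply, star_sum, apply_ite star, star_zero]
    have h1 := sum_eq_overwrite e y x fun z => star (B (overwrite e y z) z)
    simp only [overwrite_overwrite] at h1
    rw [← h1]
    refine Finset.sum_congr rfl fun z _ => ?_
    split_ifs with h
    · simp [← h]
    · rfl
  have h2 : marginal e (ρ * (lift e A)ᴴ) = marginal e ρ * Aᴴ := by
    rw [← Matrix.conjTranspose_inj, hL, Matrix.conjTranspose_mul, Matrix.conjTranspose_mul,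
      Matrix.conjTranspose_conjTranspose, Matrix.conjTranspose_conjTranspose, hR, hL]
  rw [Matrix.mul_assoc, hR, h2, Matrix.mul_assoc]

theorem marginal_trans {c : ℕ} (e : Fin a ↪ Fin b) (f : Fin b ↪ Fin c) (ρ : QMat c) :
    marginal e (marginal f ρ) = marginal (e.trans f) ρ := by
  ext x y
  simp only [marginal, Finset.sum_ite, Finset.sum_const_zero, add_zero]
  rw [Finset.sum_sigma']
  refine Finset.sum_nbij' (fun z => z.2) (fun z => ⟨fun i => z (f i), z⟩) ?_ ?_ ?_ ?_ ?_
  · rintro ⟨z, w⟩ h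
    simp only [Finset.mem_sigma, Finset.mem_filter, Finset.mem_univ, true_and] at h ⊢
    rw [← h.1, ← h.2]
    rfl
  · intro z h
    simpa using h
  · rintro ⟨z, w⟩ h
    simp only [Finset.mem_sigma, Finset.mem_filter, Finset.mem_univ, true_and] at h ⊢
    rw [h.2]
  · simp
  · rintro ⟨z, w⟩ h
    simp only [Finset.mem_sigma, Finset.mem_filter, Finset.mem_univ, true_and] at h ⊢
    congr 1
    refine overwrite_eq (fun l hl => ?_) fun j => ?_
    · exact (overwrite_of_notMem _ _ fun ⟨i, hi⟩ => hl ⟨e i, hi⟩).symm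
    · by_cases hj : j ∈ Set.range e
      · obtain ⟨i, rfl⟩ := hj
        rw [overwrite_apply]
        exact overwrite_apply (e.trans f) y w i
      · rw [overwrite_of_notMem _ _ hj, ← h.2, overwrite_of_notMem]
        rintro ⟨i, hi⟩
        exact hj ⟨i, f.injective hi⟩

theorem traceRight_eq_marginal (A : QMat (a + b)) :
    traceRight A = marginal (Fin.castAddEmb b) A := by
  ext x y
  simp only [traceRight, marginal]
  rw [← Finset.sum_filter]
  refine Finset.sum_nbij' (fun z => Fin.append x z) (fun z i => z (Fin.natAdd a i)) ?_ ?_ ?_ ?_ ?_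
  · exact fun z _ => Finset.mem_filter.mpr ⟨Finset.mem_univ _, by funext i; simp⟩
  · simp
  · simp
  · intro z hz
    have := (Finset.mem_filter.mp hz).2
    rw [← this]
    exact Fin.append_castAdd_natAdd
  · intro z _
    congr 1
    symm
    refine overwrite_eq (fun l hl => ?_) fun i => by simp
    induction l using Fin.addCases with
    | left l => exact absurd ⟨l, rfl⟩ hl
    | right l => simp

theorem traceLeft_eq_marginal (A : QMat (a + b)) :
    traceLeft A = marginal (Fin.natAddEmb a) A := by
  ext x y
  simp only [traceLeft, marginal]
  rw [← Finset.sum_filter]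
  refine Finset.sum_nbij' (fun z => Fin.append z x) (fun z i => z (Fin.castAdd b i)) ?_ ?_ ?_ ?_ ?_
  · exact fun z _ => Finset.mem_filter.mpr ⟨Finset.mem_univ _, by funext i; simp⟩
  · simp
  · simp
  · intro z hz
    have := (Finset.mem_filter.mp hz).2
    rw [← this]
    exact Fin.append_castAdd_natAdd
  · intro z _
    congr 1
    symm
    refine overwrite_eq (fun l hl => ?_) fun i => by simp
    induction l using Fin.addCases with
    | left l => simp
    | right l => exact absurd ⟨l, rfl⟩ hl

/-- The acceptance probability depends only on the reduced state of wires containing wire `0`. -/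
theorem probOne_marginal (e : Fin a ↪ Fin W) (he : ∀ i : Fin a, (i : ℕ) = 0 → (e i : ℕ) = 0)
    (he' : ∀ l : Fin W, (l : ℕ) = 0 → ∃ i : Fin a, (i : ℕ) = 0) (ρ : QMat W) :
    probOne (marginal e ρ) = probOne ρ := by
  have key : ∀ x : Bits W, (∃ i : Fin a, (i : ℕ) = 0 ∧ x (e i) = true) ↔
      ∃ i : Fin W, (i : ℕ) = 0 ∧ x i = true := by
    intro x
    constructor
    · rintro ⟨i, hi, hx⟩
      exact ⟨e i, he i hi, hx⟩
    · rintro ⟨l, hl, hx⟩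
      obtain ⟨i, hi⟩ := he' l hl
      have : e i = l := Fin.ext (by rw [he i hi, hl])
      exact ⟨i, hi, this ▸ hx⟩
  simp only [probOne, marginal, Complex.re_sum, apply_ite Complex.re, Complex.zero_re]
  simp only [← Finset.sum_filter (p := fun z : Bits W => (fun i => z (e i)) = _)]
  -- The full sum is grouped by the restriction of `z` to the retained wires, on which the bit of
  -- wire `0` is constant.
  rw [← Finset.sum_fiberwise Finset.univ (fun (z : Bits W) i => z (e i))
    (fun z => if ∃ i : Fin W, (i : ℕ) = 0 ∧ z i = true then (ρ z z).re else 0)]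
  refine Finset.sum_congr rfl fun x _ => ?_
  by_cases hx : ∃ i : Fin a, (i : ℕ) = 0 ∧ x i = true
  · rw [if_pos hx]
    refine Finset.sum_congr rfl fun z hz => ?_
    obtain rfl := (Finset.mem_filter.mp hz).2
    rw [if_pos ((key z).mp hx), overwrite_self]
  · rw [if_neg hx, Finset.sum_eq_zero]
    intro z hz
    obtain rfl := (Finset.mem_filter.mp hz).2
    rw [if_neg (mt (key z).mpr hx)]

end Lift

end QCrypto

namespace QCrypto

/-! ## Gates and lists of gates -/

section Gates

variable {a W : ℕ}

/-- The same gate on the wires selected by `e`. -/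
def Gate.map (e : Fin a ↪ Fin W) : Gate a → Gate W
  | .x i => .x (e i)
  | .had i => .had (e i)
  | .t i => .t (e i)
  | .tdg i => .tdg (e i)
  | .cx i j h => .cx (e i) (e j) (e.injective.ne h)
  | .ccx i j k h h' h'' =>
      .ccx (e i) (e j) (e k) (e.injective.ne h) (e.injective.ne h') (e.injective.ne h'')

/-- The inverse gate. -/
def Gate.inv : Gate W → Gate W
  | .x i => .x i
  | .had i => .had i
  | .t i => .tdg i
  | .tdg i => .t i
  | .cx i j h => .cx i j h
  | .ccx i j k h h' h'' => .ccx i j k h h' h''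

/-- Serves `X`, controlled `X` and Toffoli at once: each replaces a single bit by a Boolean function
of the string. -/
theorem lift_basisMap_update (e : Fin a ↪ Fin W) (i : Fin a) (F : Bits a → Bool) :
    lift e (basisMap fun b => Function.update b i (F b)) =
      basisMap fun b => Function.update b (e i) (F fun j => b (e j)) := by
  ext x y
  simp only [lift, basisMap]
  rw [← ite_and]
  refine if_congr ⟨fun h => ?_, fun h => ?_⟩ rfl rfl
  · funext l
    by_cases hl : l ∈ Set.range e
    · obtain ⟨j, rfl⟩ := hl
      have := congrFun h.2 j
      rw [this]
      by_cases hj : j = i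
      · subst hj; simp
      · rw [Function.update_of_ne hj, Function.update_of_ne (e.injective.ne hj)]
    · rw [h.1 l hl, Function.update_of_ne]
      rintro rfl
      exact hl ⟨i, rfl⟩
  · subst h
    refine ⟨fun l hl => Function.update_of_ne ?_ _ _, ?_⟩
    · rintro rfl
      exact hl ⟨i, rfl⟩
    · funext j
      by_cases hj : j = i
      · subst hj; simp
      · rw [Function.update_of_ne hj, Function.update_of_ne (e.injective.ne hj)]

theorem lift_diagonal (e : Fin a ↪ Fin W) (d : Bits a → ℂ) :
    lift e (Matrix.diagonal d) = Matrix.diagonal fun b => d fun j => b (e j) := by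
  ext x y
  simp only [lift, Matrix.diagonal_apply]
  rw [← ite_and]
  refine if_congr ⟨fun h => ?_, fun h => by simp [h]⟩ rfl rfl
  rw [← overwrite_eq h.1 (y := fun i => x (e i)) (fun i => (congrFun h.2 i).symm)]
  simp

theorem Gate.mat_map (e : Fin a ↪ Fin W) (g : Gate a) : (g.map e).mat = lift e g.mat := by
  cases g with
  | x i => exact (lift_basisMap_update e i fun b => !(b i)).symm
  | had i =>
    ext x y
    simp only [Gate.map, Gate.mat, lift]
    rw [← ite_and]
    refine if_congr ⟨fun h => ⟨fun l hl => h l ?_, fun l hl => h _ (e.injective.ne hl)⟩,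
      fun h l hl => ?_⟩ rfl rfl
    · rintro rfl
      exact hl ⟨i, rfl⟩
    · by_cases hl' : l ∈ Set.range e
      · obtain ⟨j, rfl⟩ := hl'
        exact h.2 j fun hj => hl (by rw [hj])
      · exact h.1 l hl'
  | t i => exact (lift_diagonal e fun a =>
      if a i = true then Complex.exp (Complex.I * (Real.pi / 4)) else 1).symm
  | tdg i => exact (lift_diagonal e fun a =>
      if a i = true then Complex.exp (-(Complex.I * (Real.pi / 4))) else 1).symm
  | cx i j h => exact (lift_basisMap_update e j fun b => xor (b j) (b i)).symm
  | ccx i j k => exact (lift_basisMap_update e k fun b => xor (b k) (b i && b j)).symm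

theorem basisMap_conjTranspose {f : Bits W → Bits W} (hf : Function.Involutive f) :
    (basisMap f)ᴴ = basisMap f := by
  ext x y
  simp only [basisMap, Matrix.conjTranspose_apply, apply_ite star, star_one, star_zero]
  refine if_congr ⟨?_, ?_⟩ rfl rfl <;> rintro rfl <;> exact (hf _).symm

theorem basisMap_mulVec {f : Bits W → Bits W} (hf : Function.Involutive f) (v : Bits W → ℂ)
    (x : Bits W) : (basisMap f *ᵥ v) x = v (f x) := by
  simp only [Matrix.mulVec, dotProduct, basisMap]
  rw [Finset.sum_eq_single (f x)]
  · simp [hf x]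
  · intro y _ hy
    rw [if_neg, zero_mul]
    rintro rfl
    exact hy (hf y).symm
  · simp

theorem basisMap_mul_self {f : Bits W → Bits W} (hf : Function.Involutive f) :
    basisMap f * basisMap f = 1 := by
  ext x y
  have h := basisMap_mulVec hf (fun z => basisMap f z y) x
  rw [Matrix.mul_apply]
  refine h.trans ?_
  simp only [basisMap, Matrix.one_apply, hf.injective.eq_iff]

/-- The map of bit strings that a classical gate performs. -/
def Gate.act : Gate W → Bits W → Bits W
  | .x i => fun b => Function.update b i (!(b i))
  | .cx i j _ => fun b => Function.update b j (xor (b j) (b i))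
  | .ccx i j k _ _ _ => fun b => Function.update b k (xor (b k) (b i && b j))
  | _ => id

/-- The gates `X`, controlled `X` and Toffoli. -/
def Gate.IsClassical : Gate W → Prop
  | .x _ => True
  | .cx _ _ _ => True
  | .ccx _ _ _ _ _ _ => True
  | _ => False

theorem Gate.act_involutive (g : Gate W) : Function.Involutive g.act := by
  intro b
  cases g with
  | x i => simp [Gate.act]
  | cx i j h => simp [Gate.act, Function.update_of_ne h]
  | ccx i j k h h' h'' => simp [Gate.act, Function.update_of_ne h', Function.update_of_ne h'']
  | _ => rfl

theorem Gate.IsClassical.mat_eq {g : Gate W} (hg : g.IsClassical) : g.mat = basisMap g.act := by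
  cases g <;> first | rfl | exact hg.elim

theorem hadamard_isHermitian (i : Fin W) : ((Gate.had i).mat)ᴴ = (Gate.had i).mat := by
  ext x y
  rw [Matrix.conjTranspose_apply]
  simp only [Gate.mat]
  rw [apply_ite star, star_zero]
  refine if_congr (forall_congr' fun _ => imp_congr_right fun _ => eq_comm) ?_ rfl
  rw [Bool.and_comm]
  split_ifs <;> simp

theorem inv_sqrt_two_mul_self :
    ((Real.sqrt 2 : ℝ) : ℂ)⁻¹ * ((Real.sqrt 2 : ℝ) : ℂ)⁻¹ = 2⁻¹ := by
  rw [← mul_inv, ← Complex.ofReal_mul, Real.mul_self_sqrt (by norm_num)]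
  norm_num

/-- The identity is checked on a single qubit and transported to wire `i` by multiplicativity of
`lift`. -/
theorem hadamard_mul_self (i : Fin W) : (Gate.had i).mat * (Gate.had i).mat = 1 := by
  have h1 : ∀ x : Bits 1, x = (fun _ => x 0) := fun x => by
    funext i; rw [Subsingleton.elim i 0]
  have h0 : (Gate.had (0 : Fin 1)).mat * (Gate.had (0 : Fin 1)).mat = 1 := by
    ext x y
    rw [Matrix.mul_apply, ← (Equiv.funUnique (Fin 1) Bool).symm.sum_comp]
    simp only [Fintype.sum_bool, Gate.mat, Matrix.one_apply, Equiv.funUnique_symm_apply,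
      uniqueElim_const]
    have hl : ∀ z w : Bits 1, ∀ l : Fin 1, l ≠ 0 → z l = w l :=
      fun _ _ l hl => absurd (Subsingleton.elim l 0) hl
    rw [if_pos (hl _ _), if_pos (hl _ _), if_pos (hl _ _), if_pos (hl _ _)]
    rw [h1 x, h1 y]
    have := inv_sqrt_two_mul_self
    cases x 0 <;> cases y 0 <;> simp [funext_iff] <;> linear_combination 2 * this
  let e : Fin 1 ↪ Fin W := ⟨fun _ => i, fun _ _ _ => Subsingleton.elim _ _⟩
  have h2 := Gate.mat_map e (.had 0)
  rw [show (Gate.had i).mat = _ from h2, ← lift_mul, h0, lift_one]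

theorem Gate.mat_inv (g : Gate W) : g.inv.mat = g.matᴴ := by
  cases g with
  | x i => exact (basisMap_conjTranspose (Gate.act_involutive (.x i))).symm
  | had i => exact (hadamard_isHermitian i).symm
  | t i =>
    simp only [Gate.inv, Gate.mat, Matrix.diagonal_conjTranspose]
    congr 1
    funext b
    simp only [Pi.star_apply, apply_ite star, star_one]
    congr 1
    rw [Complex.star_def, ← Complex.exp_conj]
    simp [map_ofNat]
  | tdg i =>
    simp only [Gate.inv, Gate.mat, Matrix.diagonal_conjTranspose]
    congr 1
    funext b
    simp only [Pi.star_apply, apply_ite star, star_one]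
    congr 1
    rw [Complex.star_def, ← Complex.exp_conj]
    simp [map_ofNat]
  | cx i j h => exact (basisMap_conjTranspose (Gate.act_involutive (.cx i j h))).symm
  | ccx i j k h h' h'' =>
    exact (basisMap_conjTranspose (Gate.act_involutive (.ccx i j k h h' h''))).symm

theorem Gate.conjTranspose_mul_mat (g : Gate W) : g.matᴴ * g.mat = 1 := by
  rw [← Gate.mat_inv]
  cases g with
  | x i => exact basisMap_mul_self (Gate.act_involutive (.x i))
  | had i => exact hadamard_mul_self i
  | t i =>
    simp only [Gate.inv, Gate.mat, Matrix.diagonal_mul_diagonal, ← Matrix.diagonal_one]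
    congr 1
    funext b
    split_ifs <;> simp [← Complex.exp_add]
  | tdg i =>
    simp only [Gate.inv, Gate.mat, Matrix.diagonal_mul_diagonal, ← Matrix.diagonal_one]
    congr 1
    funext b
    split_ifs <;> simp [← Complex.exp_add]
  | cx i j h => exact basisMap_mul_self (Gate.act_involutive (.cx i j h))
  | ccx i j k h h' h'' => exact basisMap_mul_self (Gate.act_involutive (.ccx i j k h h' h''))

theorem foldl_mul_eq {α : Type*} (f : α → QMat W) (l : List α) (M : QMat W) :
    l.foldl (fun M g => f g * M) M = l.foldl (fun M g => f g * M) 1 * M := by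
  induction l generalizing M with
  | nil => simp
  | cons g l ih => rw [List.foldl_cons, List.foldl_cons, ih, ih (f g * 1), mul_one, mul_assoc]

/-- The matrix of a list of gates, the first of which is applied first. -/
noncomputable def gatesMat (l : List (Gate W)) : QMat W := l.foldl (fun M g => g.mat * M) 1

@[simp] theorem gatesMat_nil : gatesMat ([] : List (Gate W)) = 1 := rfl

theorem gatesMat_cons (g : Gate W) (l : List (Gate W)) :
    gatesMat (g :: l) = gatesMat l * g.mat := by
  rw [gatesMat, List.foldl_cons, foldl_mul_eq, mul_one]
  rfl

theorem gatesMat_append (l l' : List (Gate W)) :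
    gatesMat (l ++ l') = gatesMat l' * gatesMat l := by
  induction l with
  | nil => simp
  | cons g l ih => rw [List.cons_append, gatesMat_cons, gatesMat_cons, ih, mul_assoc]

theorem gatesMat_map (e : Fin a ↪ Fin W) (l : List (Gate a)) :
    gatesMat (l.map (Gate.map e)) = lift e (gatesMat l) := by
  induction l with
  | nil => simp [lift_one]
  | cons g l ih => rw [List.map_cons, gatesMat_cons, gatesMat_cons, ih, Gate.mat_map, lift_mul]

theorem gatesMat_inv (l : List (Gate W)) :
    gatesMat (l.reverse.map Gate.inv) = (gatesMat l)ᴴ := by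
  induction l with
  | nil => simp
  | cons g l ih =>
    rw [List.reverse_cons, List.map_append, gatesMat_append, ih, gatesMat_cons,
      Matrix.conjTranspose_mul, List.map_singleton, gatesMat_cons, Gate.mat_inv]
    simp

theorem gatesMat_conjTranspose_mul (l : List (Gate W)) : (gatesMat l)ᴴ * gatesMat l = 1 := by
  induction l with
  | nil => simp
  | cons g l ih =>
    rw [gatesMat_cons, Matrix.conjTranspose_mul, mul_assoc, ← mul_assoc _ _ g.mat, ih, one_mul,
      Gate.conjTranspose_mul_mat]

/-- A list of classical gates permutes the basis. -/
theorem gatesMat_mulVec_of_classical (l : List (Gate W)) (hl : ∀ g ∈ l, g.IsClassical)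
    (v : Bits W → ℂ) (x : Bits W) :
    (gatesMat l *ᵥ v) x = v (l.foldr Gate.act x) := by
  -- The amplitude at `x` is that of its preimage. The gates are involutions, so the preimage arises
  -- by applying the last gate first, which is what `foldr` does.
  induction l generalizing v with
  | nil => simp
  | cons g l ih =>
    rw [gatesMat_cons, ← Matrix.mulVec_mulVec, ih fun g hg => hl g (List.mem_cons_of_mem _ hg),
      (hl g List.mem_cons_self).mat_eq, basisMap_mulVec g.act_involutive]
    rfl

theorem foldl_act_foldr_act (l : List (Gate W)) (x : Bits W) :
    l.foldl (fun b g => g.act b) (l.foldr Gate.act x) = x := by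
  induction l with
  | nil => rfl
  | cons g l ih => rw [List.foldr_cons, List.foldl_cons, g.act_involutive, ih]

theorem foldr_act_foldl_act (l : List (Gate W)) (x : Bits W) :
    l.foldr Gate.act (l.foldl (fun b g => g.act b) x) = x := by
  induction l generalizing x with
  | nil => rfl
  | cons g l ih => rw [List.foldr_cons, List.foldl_cons, ih, g.act_involutive]

/-! ### Swapping pairs of wires -/

/-- The gates that swap the wires `i` and `j`. -/
def swapGates (i j : Fin W) (h : i ≠ j) : List (Gate W) :=
  [.cx i j h, .cx j i h.symm, .cx i j h]

/-- The XOR exchange of two bits. The list is a palindrome, so the left fold gives the same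
permutation. -/
theorem foldr_swapGates (i j : Fin W) (h : i ≠ j) (x : Bits W) :
    (swapGates i j h).foldr Gate.act x = x ∘ Equiv.swap i j := by
  funext l
  have h' := h.symm
  simp only [swapGates, List.foldr_cons, List.foldr_nil, Gate.act, Function.comp]
  by_cases h1 : l = i
  · subst h1
    cases hl : x l <;> cases hj : x j <;> simp [h, h', hl, hj]
  · by_cases h2 : l = j
    · subst h2
      simp [h, h']
    · rw [Equiv.swap_apply_of_ne_of_ne h1 h2]
      simp [h1, h2]

theorem isClassical_swapGates (i j : Fin W) (h : i ≠ j) : ∀ g ∈ swapGates i j h, g.IsClassical := by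
  simp [swapGates, Gate.IsClassical]

theorem isClassical_flatMap {α : Type*} (l : List α) (f : α → List (Gate W))
    (h : ∀ x, ∀ g ∈ f x, g.IsClassical) : ∀ g ∈ l.flatMap f, g.IsClassical := by
  intro g hg
  obtain ⟨x, _, hx⟩ := List.mem_flatMap.mp hg
  exact h x g hx

theorem foldr_act_flatMap {α : Type*} (l : List α) (f : α → List (Gate W)) (x : Bits W) :
    (l.flatMap f).foldr Gate.act x = l.foldr (fun j b => (f j).foldr Gate.act b) x := by
  induction l with
  | nil => rfl
  | cons j l ih => rw [List.flatMap_cons, List.foldr_append, ih, List.foldr_cons]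

/-- The gates that swap the wires `d j` and `e j` for all `j` in a list. -/
def multiSwap {α : Type*} (l : List α) (d e : α → Fin W) (h : ∀ i j, d i ≠ e j) :
    List (Gate W) := l.flatMap fun j => swapGates (d j) (e j) (h j j)

theorem isClassical_multiSwap {α : Type*} (l : List α) (d e : α → Fin W)
    (h : ∀ i j, d i ≠ e j) : ∀ g ∈ multiSwap l d e h, g.IsClassical :=
  isClassical_flatMap l _ fun _ => isClassical_swapGates _ _ _

/-- All the wires involved are distinct, so each transposition leaves the other pairs untouched and
the exchanges do not interfere. -/
theorem foldr_multiSwap {α : Type*} (l : List α) (hl : l.Nodup) (d e : α → Fin W)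
    (h : ∀ i j, d i ≠ e j) (hd : d.Injective) (he : e.Injective) (x : Bits W) :
    (∀ j ∈ l, (multiSwap l d e h).foldr Gate.act x (d j) = x (e j)) ∧
    (∀ j ∈ l, (multiSwap l d e h).foldr Gate.act x (e j) = x (d j)) ∧
    ∀ w, (∀ j ∈ l, w ≠ d j ∧ w ≠ e j) → (multiSwap l d e h).foldr Gate.act x w = x w := by
  induction l with
  | nil => simp [multiSwap]
  | cons j l ih =>
    obtain ⟨hj, hl⟩ := List.nodup_cons.mp hl
    obtain ⟨h1, h2, h3⟩ := ih hl
    have hrec : (multiSwap (j :: l) d e h).foldr Gate.act x =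
        (multiSwap l d e h).foldr Gate.act x ∘ Equiv.swap (d j) (e j) := by
      rw [multiSwap, foldr_act_flatMap, List.foldr_cons, foldr_swapGates, ← foldr_act_flatMap]
      rfl
    have hne : ∀ i ∈ l, i ≠ j := fun i hi hij => hj (hij ▸ hi)
    have hdj := h3 (d j) fun i hi => ⟨hd.ne (hne i hi).symm, h j i⟩
    have hej := h3 (e j) fun i hi => ⟨(h i j).symm, he.ne (hne i hi).symm⟩
    rw [hrec]
    refine ⟨fun i hi => ?_, fun i hi => ?_, fun w hw => ?_⟩
    · rcases List.mem_cons.mp hi with rfl | hi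
      · simp [hej]
      · simp only [Function.comp]
        rw [Equiv.swap_apply_of_ne_of_ne (hd.ne (hne i hi)) (h i j), h1 i hi]
    · rcases List.mem_cons.mp hi with rfl | hi
      · simp [hdj]
      · simp only [Function.comp]
        rw [Equiv.swap_apply_of_ne_of_ne (h j i).symm (he.ne (hne i hi)), h2 i hi]
    · have := hw j List.mem_cons_self
      simp only [Function.comp]
      rw [Equiv.swap_apply_of_ne_of_ne this.1 this.2,
        h3 w fun i hi => hw i (List.mem_cons_of_mem _ hi)]

end Gates

end QCrypto

namespace QCrypto

/-! ## Preparing mixed states -/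

section Mixed

variable {W : ℕ}

theorem mul_proj_mul {n : ℕ} (M : QMat n) (v : Bits n → ℂ) :
    M * proj v * Mᴴ = proj (M *ᵥ v) := by
  rw [proj, proj, Matrix.mul_vecMulVec, Matrix.vecMulVec_mul, Matrix.star_mulVec]

theorem ket_eq_proj {n : ℕ} (x : Bits n) : ket x = proj (Pi.single x 1) := by
  ext y z
  simp only [ket, proj, Matrix.vecMulVec_apply, Matrix.single_apply, Pi.star_apply]
  rcases eq_or_ne x y with rfl | h1
  · rcases eq_or_ne x z with rfl | h2
    · simp
    · simp [h2, h2.symm]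
  · simp [h1, h1.symm]

theorem append_eq_iff {a b : ℕ} (x : Bits a) (y : Bits b) (z : Bits (a + b)) :
    Fin.append x y = z ↔
      x = (fun i => z (Fin.castAdd b i)) ∧ y = fun j => z (Fin.natAdd a j) := by
  constructor
  · rintro rfl
    simp
  · rintro ⟨rfl, rfl⟩
    exact Fin.append_castAdd_natAdd

theorem tens_ket_ket {a b : ℕ} (x : Bits a) (y : Bits b) :
    tens (ket x) (ket y) = ket (Fin.append x y) := by
  ext z w
  simp only [tens, ket, Matrix.single_apply, append_eq_iff, ite_mul, one_mul, zero_mul]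
  rw [← ite_and]
  exact if_congr (by tauto) rfl rfl

/-- The gates that prepare the wires `d j`, `e j` in a maximally entangled state. -/
def eprGates {α : Type*} (l : List α) (d e : α → Fin W) (h : ∀ i j, d i ≠ e j) :
    List (Gate W) := l.flatMap fun j => [.had (e j), .cx (e j) (d j) (h j j).symm]

/-- Every pair becomes `(|00⟩ + |11⟩)/√2`: paired bits must agree, and each pair contributes one
factor `1/√2`. The induction appends pairs at the end of the list because the last gates are the
outermost matrix factors. -/
theorem eprGates_mulVec {α : Type*} (l : List α) (hl : l.Nodup) (d e : α → Fin W)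
    (h : ∀ i j, d i ≠ e j) (hd : d.Injective) (he : e.Injective) (b : Bits W)
    (hbd : ∀ j ∈ l, b (d j) = false) (hbe : ∀ j ∈ l, b (e j) = false) (x : Bits W) :
    (gatesMat (eprGates l d e h) *ᵥ Pi.single b 1) x =
      if (∀ w, (∀ j ∈ l, w ≠ d j ∧ w ≠ e j) → x w = b w) ∧ ∀ j ∈ l, x (e j) = x (d j) then
        ((Real.sqrt 2 : ℝ) : ℂ)⁻¹ ^ l.length else 0 := by
  induction l using List.reverseRecOn generalizing x with
  | nil =>
    simp only [eprGates, List.flatMap_nil, gatesMat_nil, Matrix.one_mulVec, Pi.single_apply]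
    simp [funext_iff]
  | append_singleton l j ih =>
    have hj : j ∉ l := fun hj => (List.nodup_append.mp hl).2.2 j hj j (by simp) rfl
    replace ih := ih (List.nodup_append.mp hl).1 (fun i hi => hbd i (by simp [hi]))
      (fun i hi => hbe i (by simp [hi]))
    have hne : ∀ i ∈ l, i ≠ j := fun i hi hij => hj (hij ▸ hi)
    have hbdj := hbd j (by simp)
    have hbej := hbe j (by simp)
    have hcx : (Gate.cx (e j) (d j) (h j j).symm).IsClassical := trivial
    rw [eprGates, List.flatMap_append, gatesMat_append, ← Matrix.mulVec_mulVec,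
      List.flatMap_singleton, gatesMat_cons, gatesMat_cons, gatesMat_nil, one_mul,
      ← Matrix.mulVec_mulVec, hcx.mat_eq, basisMap_mulVec (Gate.act_involutive _)]
    set x' := (Gate.cx (e j) (d j) (h j j).symm).act x with hx'
    have hx'e : x' (e j) = x (e j) := by simp [hx', Gate.act, (h j j).symm]
    have hx'd : x' (d j) = xor (x (d j)) (x (e j)) := by simp [hx', Gate.act]
    have hx'w : ∀ w, w ≠ d j → x' w = x w := fun w hw => by simp [hx', Gate.act, hw]
    -- The Hadamard gate connects only strings that agree off `e j`, and the new pair is still in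
    -- `|00⟩` before it, so a single intermediate string survives.
    rw [Matrix.mulVec, dotProduct, Finset.sum_eq_single (Function.update x' (e j) false)]
    · rw [show gatesMat (l.flatMap _) *ᵥ Pi.single b 1 = _ from funext ih]
      simp only [Gate.mat]
      rw [if_pos fun w hw => (Function.update_of_ne hw _ _).symm]
      simp only [Function.update_self, Bool.and_false, Bool.false_eq_true, if_false, mul_one,
        mul_ite, mul_zero, List.length_append, List.length_singleton, pow_succ']
      refine if_congr ⟨fun ⟨h1, h2⟩ => ?_, fun ⟨h1, h2⟩ => ?_⟩ rfl rfl
      · have hx : x (e j) = x (d j) := by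
          have := h1 (d j) fun i hi => ⟨hd.ne (hne i hi).symm, h j i⟩
          rw [Function.update_of_ne (h j j), hx'd, hbdj] at this
          cases h3 : x (e j) <;> cases h4 : x (d j) <;> simp_all
        refine ⟨fun w hw => ?_, fun i hi => ?_⟩
        · have hwj := hw j (by simp)
          have := h1 w fun i hi => hw i (by simp [hi])
          rwa [Function.update_of_ne hwj.2, hx'w w hwj.1] at this
        · rcases List.mem_append.mp hi with hi | hi
          · have := h2 i hi
            rwa [Function.update_of_ne (he.ne (hne i hi)), Function.update_of_ne (h i j),
              hx'w _ (h j i).symm, hx'w _ (hd.ne (hne i hi))] at this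
          · rw [List.mem_singleton.mp hi, hx]
      · refine ⟨fun w hw => ?_, fun i hi => ?_⟩
        · by_cases hwe : w = e j
          · rw [hwe, Function.update_self, hbej]
          rw [Function.update_of_ne hwe]
          by_cases hwd : w = d j
          · rw [hwd, hx'd, h2 j (by simp), hbdj, Bool.xor_self]
          · rw [hx'w w hwd]
            refine h1 w fun i hi => ?_
            rcases List.mem_append.mp hi with hi | hi
            · exact hw i hi
            · rw [List.mem_singleton.mp hi]
              exact ⟨hwd, hwe⟩
        · rw [Function.update_of_ne (he.ne (hne i hi)), Function.update_of_ne (h i j),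
              hx'w _ (h j i).symm, hx'w _ (hd.ne (hne i hi))]
          exact h2 i (by simp [hi])
    · intro z _ hz
      by_cases hze : z (e j) = false
      · simp only [Gate.mat]
        rw [if_neg, zero_mul]
        intro hagree
        refine hz (funext fun w => ?_)
        by_cases hw : w = e j
        · rw [hw, hze, Function.update_self]
        · rw [Function.update_of_ne hw, hagree w hw]
      · rw [show gatesMat (l.flatMap _) *ᵥ Pi.single b 1 = _ from funext ih]
        simp only
        rw [if_neg, mul_zero]
        rintro ⟨h1, _⟩
        refine hze ?_
        rw [h1 (e j) fun i hi => ⟨(h i j).symm, he.ne (hne i hi).symm⟩, hbej]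
    · simp

/-- The discarded partner of wire `d j` carries a copy of its bit. This kills the coherences between
distinct strings and leaves a uniform diagonal on the free bits. -/
theorem marginal_eprGates {r N : ℕ} (f : Fin r ↪ Fin W) (d : Fin N → Fin r) (hd : d.Injective)
    (e : Fin N → Fin W) (he : e.Injective) (hfe : ∀ i j, f i ≠ e j) (b : Bits W)
    (hbd : ∀ j, b (f (d j)) = false) (hbe : ∀ j, b (e j) = false) :
    marginal f (proj (gatesMat (eprGates (List.finRange N) (fun j => f (d j)) e
        fun i j => hfe (d i) j) *ᵥ Pi.single b 1)) =
      Matrix.diagonal fun x =>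
        if ∀ w, (∀ j, w ≠ d j) → x w = b (f w) then ((2 : ℂ) ^ N)⁻¹ else 0 := by
  have hv := eprGates_mulVec (List.finRange N) (List.nodup_finRange N) (fun j => f (d j)) e
    (fun i j => hfe (d i) j) (f.injective.comp hd) he b (fun j _ => hbd j) (fun j _ => hbe j)
  rw [funext hv]
  have her : ∀ j, e j ∉ Set.range f := fun j ⟨i, hi⟩ => hfe i j hi
  ext x y
  simp only [List.mem_finRange, List.length_finRange, forall_const]
  simp only [marginal, proj, Matrix.vecMulVec_apply, Pi.star_apply]
  -- The only contributing string equals `x` on the retained wires, copies `x (d j)` to the partner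
  -- of `d j`, and is `b` on all other wires.
  rw [Finset.sum_eq_single (Function.extend e (fun j => x (d j)) (overwrite f x b))]
  · have hz1 : ∀ i, Function.extend e (fun j => x (d j)) (overwrite f x b) (f i) = x i := by
      intro i
      rw [Function.extend_apply' _ _ _ fun ⟨j, hj⟩ => hfe i j hj.symm, overwrite_apply]
    have hz2 : ∀ j, Function.extend e (fun j => x (d j)) (overwrite f x b) (e j) = x (d j) :=
      fun j => he.extend_apply _ _ _
    have hz3 : ∀ l, l ∉ Set.range f → (∀ j, l ≠ e j) →
        Function.extend e (fun j => x (d j)) (overwrite f x b) l = b l := by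
      intro l hl hl'
      rw [Function.extend_apply' _ _ _ fun ⟨j, hj⟩ => hl' j hj.symm, overwrite_of_notMem _ _ hl]
    set z := Function.extend e (fun j => x (d j)) (overwrite f x b)
    rw [if_pos (funext hz1), Matrix.diagonal_apply]
    have hc : ∀ u : Bits r, ((∀ w, (∀ j, w ≠ f (d j) ∧ w ≠ e j) → overwrite f u z w = b w) ∧
        ∀ j, overwrite f u z (e j) = overwrite f u z (f (d j))) ↔
        (∀ w, (∀ j, w ≠ d j) → u w = b (f w)) ∧ ∀ j, x (d j) = u (d j) := by
      intro u
      refine and_congr ⟨fun h w hw => ?_, fun h w hw => ?_⟩ (forall_congr' fun j => ?_)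
      · rw [← h (f w) fun j => ⟨f.injective.ne (hw j), hfe w j⟩, overwrite_apply]
      · by_cases hwf : w ∈ Set.range f
        · obtain ⟨i, rfl⟩ := hwf
          rw [overwrite_apply]
          exact h i fun j hj => (hw j).1 (by rw [hj])
        · rw [overwrite_of_notMem _ _ hwf, hz3 w hwf fun j => (hw j).2]
      · rw [overwrite_of_notMem _ _ (her j), overwrite_apply, hz2]
    have hzz : overwrite f x z = z := overwrite_eq (fun _ _ => rfl) hz1
    have hcx := hc x
    rw [hzz] at hcx
    simp only [hc, hcx, implies_true, and_true]
    have hs : ((Real.sqrt 2 : ℝ) : ℂ)⁻¹ ^ N * star (((Real.sqrt 2 : ℝ) : ℂ)⁻¹ ^ N) =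
        ((2 : ℂ) ^ N)⁻¹ := by
      rw [star_pow, star_inv₀, Complex.star_def, Complex.conj_ofReal, ← mul_pow,
        inv_sqrt_two_mul_self, inv_pow]
    by_cases hxy : x = y
    · subst hxy
      simp only [implies_true, and_true, if_true]
      split_ifs
      · exact hs
      · simp
    · rw [if_neg hxy]
      -- An off-diagonal entry would need both `x (d j)` and `y (d j)` to equal the same partner
      -- bit, and `x`, `y` to agree with `b` elsewhere, forcing `x = y`.
      by_cases h1 : ∀ w, (∀ j, w ≠ d j) → x w = b (f w)
      · rw [if_pos h1, if_neg, star_zero, mul_zero]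
        rintro ⟨h2, h3⟩
        refine hxy (funext fun w => ?_)
        by_cases hw : ∀ j, w ≠ d j
        · rw [h1 w hw, h2 w hw]
        · push Not at hw
          obtain ⟨j, rfl⟩ := hw
          exact h3 j
      · rw [if_neg h1, zero_mul]
  · intro z _ hz
    split_ifs with hzx h1 <;> try simp
    exfalso
    refine hz (funext fun w => ?_)
    by_cases hw : ∃ j, e j = w
    · obtain ⟨j, rfl⟩ := hw
      rw [he.extend_apply, h1.2 j, ← hzx]
    · rw [Function.extend_apply' _ _ _ hw]
      by_cases hwf : w ∈ Set.range f
      · obtain ⟨i, rfl⟩ := hwf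
        rw [overwrite_apply, ← hzx]
      · rw [overwrite_of_notMem _ _ hwf]
        exact h1.1 w fun j => ⟨fun hj => hwf ⟨_, hj.symm⟩, fun hj => hw ⟨j, hj.symm⟩⟩
  · simp

end Mixed

end QCrypto

namespace QCrypto

/-! ## Product states of blocks of wires -/

section Block

variable {t n m L a N r W : ℕ}

/-- The state `|0⟩⟨0|^{⊗ (n-m)} ⊗ σ_m`. -/
noncomputable def lowState (n m : ℕ) : QMat n := Matrix.diagonal fun x =>
  if ∀ i : Fin n, (i : ℕ) < n - m → x i = false then ((2 : ℂ) ^ m)⁻¹ else 0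

/-- Eliminates the transport along `n - m + m = n` in favour of a condition on coordinates. -/
theorem recast_eq_lowState (h : m ≤ n) :
    recast (Nat.sub_add_cancel h) (tens (zeroState (n - m)) (mixedState m)) = lowState n m := by
  ext x y
  have hcast : ∀ i : Fin n, (i : ℕ) < n - m →
      ∃ j : Fin (n - m), Fin.cast (Nat.sub_add_cancel h) (Fin.castAdd m j) = i :=
    fun i hi => ⟨⟨i, hi⟩, rfl⟩
  have hcast' : ∀ i : Fin n, ¬ (i : ℕ) < n - m →
      ∃ j : Fin m, Fin.cast (Nat.sub_add_cancel h) (Fin.natAdd (n - m) j) = i :=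
    fun i hi => ⟨⟨i - (n - m), by omega⟩, Fin.ext (by simp; omega)⟩
  simp only [recast, tens, zeroState, ket, mixedState, lowState, Matrix.single_apply,
    Matrix.smul_apply, Matrix.one_apply, Matrix.diagonal_apply, smul_eq_mul, mul_ite, mul_one,
    mul_zero, ite_mul, one_mul, zero_mul]
  rw [← ite_and, ← ite_and]
  refine if_congr ⟨fun ⟨h1, h2, h3⟩ => ?_, ?_⟩ rfl rfl
  · refine ⟨funext fun i => ?_, fun i hi => ?_⟩
    · by_cases hi : (i : ℕ) < n - m
      · obtain ⟨j, rfl⟩ := hcast i hi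
        rw [← congrFun h2 j, ← congrFun h3 j]
      · obtain ⟨j, rfl⟩ := hcast' i hi
        exact congrFun h1 j
    · obtain ⟨j, rfl⟩ := hcast i hi
      exact (congrFun h2 j).symm
  · rintro ⟨rfl, h2⟩
    refine ⟨rfl, ?_, ?_⟩ <;>
    · funext j
      exact (h2 _ (by simp)).symm

/-- The state in which the block of wires `e (i, 0), …, e (i, n - 1)` is in the state `ρ i`, and
the wires outside the blocks are in the basis state given by `c`. -/
def blockState (e : Fin t × Fin n ↪ Fin L) (c : Bits L) (ρ : Fin t → QMat n) : QMat L :=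
  fun x y => if ∀ w, w ∉ Set.range e → x w = c w ∧ y w = c w then
    ∏ i, ρ i (fun j => x (e (i, j))) (fun j => y (e (i, j))) else 0

/-- The wires of the block `i`. -/
def blockEmb (e : Fin t × Fin n ↪ Fin L) (i : Fin t) : Fin n ↪ Fin L :=
  ⟨fun j => e (i, j), fun j k h => by simpa using h⟩

theorem lift_mul_blockState (e : Fin t × Fin n ↪ Fin L) (c : Bits L) (ρ : Fin t → QMat n)
    (i : Fin t) (A : QMat n) :
    lift (blockEmb e i) A * blockState e c ρ =
      blockState e c (Function.update ρ i (A * ρ i)) := by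
  ext x y
  rw [Matrix.mul_apply, sum_lift_mul (blockEmb e i) A x fun z => blockState e c ρ z y]
  have hoff : ∀ (p : Bits n) w, w ∉ Set.range e → overwrite (blockEmb e i) p x w = x w := by
    intro p w hw
    exact overwrite_of_notMem _ _ fun ⟨j, hj⟩ => hw ⟨(i, j), hj⟩
  have hc : ∀ p : Bits n,
      (∀ w, w ∉ Set.range e → overwrite (blockEmb e i) p x w = c w ∧ y w = c w) ↔
      ∀ w, w ∉ Set.range e → x w = c w ∧ y w = c w :=
    fun p => forall₂_congr fun w hw => by rw [hoff p w hw]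
  unfold blockState
  simp only [hc]
  split_ifs
  · rw [← Finset.mul_prod_erase Finset.univ _ (Finset.mem_univ i), Function.update_self,
      Matrix.mul_apply, Finset.sum_mul]
    refine Finset.sum_congr rfl fun p _ => ?_
    rw [← Finset.mul_prod_erase Finset.univ _ (Finset.mem_univ i), ← mul_assoc]
    congr 1
    · congr 2
      funext j
      exact overwrite_apply (blockEmb e i) p x j
    · refine Finset.prod_congr rfl fun i' hi' => ?_
      have hne := Finset.ne_of_mem_erase hi'
      rw [Function.update_of_ne hne]
      congr 1
      funext j
      refine overwrite_of_notMem _ _ ?_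
      rintro ⟨j', hj'⟩
      have := e.injective hj'
      simp only [Prod.mk.injEq] at this
      exact hne this.1.symm
  · simp

theorem blockState_conjTranspose (e : Fin t × Fin n ↪ Fin L) (c : Bits L) (ρ : Fin t → QMat n) :
    (blockState e c ρ)ᴴ = blockState e c fun i => (ρ i)ᴴ := by
  ext x y
  simp only [blockState, Matrix.conjTranspose_apply, apply_ite star, star_zero, star_prod]
  exact if_congr (forall₂_congr fun _ _ => and_comm) rfl rfl

/-- The right factor is handled by taking adjoints, which turns it into a second left
multiplication. -/
theorem lift_mul_blockState_mul (e : Fin t × Fin n ↪ Fin L) (c : Bits L) (ρ : Fin t → QMat n)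
    (i : Fin t) (A : QMat n) :
    lift (blockEmb e i) A * blockState e c ρ * (lift (blockEmb e i) A)ᴴ =
      blockState e c (Function.update ρ i (A * ρ i * Aᴴ)) := by
  rw [← Matrix.conjTranspose_inj, Matrix.conjTranspose_mul, Matrix.conjTranspose_conjTranspose,
    lift_mul_blockState, blockState_conjTranspose, lift_mul_blockState, blockState_conjTranspose]
  congr 1
  funext i'
  by_cases h : i' = i
  · subst h
    simp [Matrix.mul_assoc]
  · simp [h]

/-- The operator `A` acting on the blocks in the list `l`. -/
noncomputable def blocksMat (e : Fin t × Fin n ↪ Fin L) (A : QMat n) (l : List (Fin t)) : QMat L :=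
  l.foldl (fun M i => lift (blockEmb e i) A * M) 1

/-- Distinct entries of `l` ensure that no block is conjugated twice. -/
theorem blocksMat_mul_blockState (e : Fin t × Fin n ↪ Fin L) (c : Bits L) (A : QMat n)
    (l : List (Fin t)) (hl : l.Nodup) (ρ : Fin t → QMat n) :
    blocksMat e A l * blockState e c ρ * (blocksMat e A l)ᴴ =
      blockState e c fun i => if i ∈ l then A * ρ i * Aᴴ else ρ i := by
  induction l generalizing ρ with
  | nil => simp [blocksMat]
  | cons i l ih =>
    obtain ⟨hi, hl⟩ := List.nodup_cons.mp hl
    have h1 : blocksMat e A (i :: l) = blocksMat e A l * lift (blockEmb e i) A := by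
      rw [blocksMat, List.foldl_cons, foldl_mul_eq, mul_one]
      rfl
    have h2 : blocksMat e A l * lift (blockEmb e i) A * blockState e c ρ *
        (blocksMat e A l * lift (blockEmb e i) A)ᴴ = blocksMat e A l *
        (lift (blockEmb e i) A * blockState e c ρ * (lift (blockEmb e i) A)ᴴ) *
        (blocksMat e A l)ᴴ := by
      simp only [Matrix.conjTranspose_mul, Matrix.mul_assoc]
    rw [h1, h2, lift_mul_blockState_mul, ih hl]
    congr 1
    funext i'
    by_cases h : i' = i
    · subst h
      simp [hi]
    · simp [h]

/-- The wires that are to be made maximally mixed: the last `m` of each block. -/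
def lowWire (hm : m ≤ n) (e : Fin t × Fin n ↪ Fin L) (q : Fin N ≃ Fin t × Fin m) (j : Fin N) :
    Fin L := e ((q j).1, ⟨n - m + (q j).2, by omega⟩)

theorem lowWire_injective (hm : m ≤ n) (e : Fin t × Fin n ↪ Fin L) (q : Fin N ≃ Fin t × Fin m) :
    Function.Injective (lowWire hm e q) := by
  intro i j h
  have := e.injective h
  simp only [Prod.mk.injEq, Fin.mk.injEq, add_right_inj] at this
  exact q.injective (Prod.ext this.1 (Fin.ext this.2))

/-- A uniform diagonal on the free bits factors over the blocks; the normalizations match because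
`q` forces `N = m * t`. -/
theorem diagonal_eq_blockState (hm : m ≤ n) (e : Fin t × Fin n ↪ Fin L)
    (q : Fin N ≃ Fin t × Fin m) (c : Bits L) (hc : ∀ p, c (e p) = false) :
    (Matrix.diagonal fun x : Bits L =>
      if ∀ w, (∀ j, w ≠ lowWire hm e q j) → x w = c w then ((2 : ℂ) ^ N)⁻¹ else 0) =
      blockState e c fun _ => lowState n m := by
  have hN : N = m * t := by
    have := Fintype.card_congr q
    simpa [mul_comm] using this
  have hx : ∀ x : Bits L, (∀ w, (∀ j, w ≠ lowWire hm e q j) → x w = c w) ↔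
      (∀ w, w ∉ Set.range e → x w = c w) ∧
        ∀ i, ∀ j : Fin n, (j : ℕ) < n - m → x (e (i, j)) = false := by
    intro x
    refine ⟨fun h => ⟨fun w hw => h w fun j hj => hw ⟨_, hj.symm⟩, fun i j hj => ?_⟩,
      fun ⟨h1, h2⟩ w hw => ?_⟩
    · rw [h, hc]
      intro k hk
      have := e.injective hk
      simp only [Prod.mk.injEq, Fin.ext_iff] at this
      omega
    · by_cases hwe : w ∈ Set.range e
      · obtain ⟨⟨i, j⟩, rfl⟩ := hwe
        rw [hc]
        refine h2 i j ?_
        by_contra hj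
        refine hw (q.symm (i, ⟨j - (n - m), by omega⟩)) ?_
        simp only [lowWire, Equiv.apply_symm_apply]
        congr 2
        exact Fin.ext (by simp; omega)
      · exact h1 w hwe
  ext x y
  simp only [Matrix.diagonal_apply, hx, blockState, lowState]
  by_cases hxy : x = y
  · subst hxy
    simp only [if_true, and_self]
    rw [ite_and]
    refine if_congr Iff.rfl ?_ rfl
    by_cases h : ∀ i, ∀ j : Fin n, (j : ℕ) < n - m → x (e (i, j)) = false
    · rw [if_pos h, Finset.prod_congr rfl fun i _ => if_pos (h i)]
      simp [hN, pow_mul]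
    · rw [if_neg h]
      push Not at h
      obtain ⟨i, j, hj, hij⟩ := h
      refine (Finset.prod_eq_zero (Finset.mem_univ i) (if_neg fun h => hij ?_)).symm
      simpa using h j hj
  · rw [if_neg hxy]
    split_ifs with h
    · obtain ⟨w, hw⟩ := Function.ne_iff.mp hxy
      have hwe : w ∈ Set.range e := by
        by_contra hwe
        exact hw ((h w hwe).1.trans (h w hwe).2.symm)
      obtain ⟨⟨i, j⟩, rfl⟩ := hwe
      refine (Finset.prod_eq_zero (Finset.mem_univ i) (if_neg fun h => hw ?_)).symm
      exact congrFun h j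
    · rfl

/-- The wires of the last `n` qubits as a single block. -/
def lastBlock (l n : ℕ) : Fin 1 × Fin n ↪ Fin (l + n) :=
  ⟨fun p => Fin.natAdd l p.2, fun p q h => Prod.ext (Subsingleton.elim _ _) (by simpa using h)⟩

/-- The verifier's input is the case of one block with the key as classical background; a
distinguisher's input is the case of `t` blocks with no background. One oracle construction then
serves both. -/
theorem tens_ket_eq_blockState {l : ℕ} (k : Bits l) (ρ : QMat n) :
    tens (ket k) ρ = blockState (lastBlock l n) (Fin.append k fun _ => false) fun _ => ρ := by
  ext x y
  simp only [tens, ket, Matrix.single_apply, blockState, Finset.univ_unique,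
    Finset.prod_singleton, ite_mul, one_mul, zero_mul]
  refine if_congr ⟨fun ⟨h1, h2⟩ w hw => ?_, fun h => ?_⟩ rfl rfl
  · induction w using Fin.addCases with
    | left w =>
      have h1 := congrFun h1 w
      have h2 := congrFun h2 w
      simp [← h1, ← h2]
    | right w => exact absurd ⟨(0, w), rfl⟩ hw
  · have h' : ∀ w : Fin l, Fin.castAdd n w ∉ Set.range (lastBlock l n) := by
      rintro w ⟨p, hp⟩
      have : l + (p.2 : ℕ) = w := congrArg Fin.val hp
      omega
    refine ⟨funext fun w => ?_, funext fun w => ?_⟩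
    · have := (h _ (h' w)).1
      simpa using this.symm
    · have := (h _ (h' w)).2
      simpa using this.symm

theorem tensPow_eq_blockState (t : ℕ) (ρ : QMat n) :
    tensPow t ρ = blockState finProdFinEquiv.toEmbedding (fun _ => false) fun _ => ρ := by
  ext x y
  simp only [tensPow, blockState]
  rw [if_pos]
  · rfl
  · exact fun w hw => absurd ⟨finProdFinEquiv.symm w, finProdFinEquiv.apply_symm_apply w⟩ hw

theorem tens_blockState_zeroState (e : Fin t × Fin n ↪ Fin L) (c : Bits L) (ρ : Fin t → QMat n)
    (a : ℕ) : tens (blockState e c ρ) (zeroState a) =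
      blockState (e.trans (Fin.castAddEmb a)) (Fin.append c fun _ => false) ρ := by
  ext x y
  simp only [tens, zeroState, ket, Matrix.single_apply, blockState, mul_ite, mul_one, mul_zero]
  rw [← ite_and]
  have hr : ∀ w : Fin L, Fin.castAdd a w ∈ Set.range (e.trans (Fin.castAddEmb a)) ↔
      w ∈ Set.range e := by
    intro w
    constructor
    · rintro ⟨p, hp⟩
      exact ⟨p, Fin.castAdd_injective _ _ hp⟩
    · rintro ⟨p, rfl⟩
      exact ⟨p, rfl⟩
  have hr' : ∀ w : Fin a, Fin.natAdd L w ∉ Set.range (e.trans (Fin.castAddEmb a)) := by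
    rintro w ⟨p, hp⟩
    have := congrArg Fin.val hp
    simp at this
    omega
  refine if_congr ⟨fun ⟨⟨h1, h2⟩, h3⟩ w hw => ?_, fun h => ⟨⟨?_, ?_⟩, fun w hw => ?_⟩⟩ rfl rfl
  · induction w using Fin.addCases with
    | left w =>
      rw [hr] at hw
      simpa using h3 w hw
    | right w =>
      have h1 := congrFun h1 w
      have h2 := congrFun h2 w
      simp [← h1, ← h2]
  · funext w
    simpa using (h _ (hr' w)).1.symm
  · funext w
    simpa using (h _ (hr' w)).2.symm
  · simpa using h _ (mt (hr w).mp hw)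

/-- Maximally entangling the last `m` wires of each block with further wires gives each block the
reduced state `|0⟩⟨0|^{⊗ (n-m)} ⊗ σ_m`. -/
theorem marginal_eprGates_eq_blockState (hm : m ≤ n) (f : Fin r ↪ Fin W)
    (e : Fin t × Fin n ↪ Fin r) (q : Fin N ≃ Fin t × Fin m) (ex : Fin N → Fin W)
    (hex : ex.Injective) (hfe : ∀ i j, f i ≠ ex j) (b : Bits W)
    (hb : ∀ p, b (f (e p)) = false) (hbe : ∀ j, b (ex j) = false) :
    marginal f (proj (gatesMat (eprGates (List.finRange N) (fun j => f (lowWire hm e q j)) ex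
        fun i j => hfe (lowWire hm e q i) j) *ᵥ Pi.single b 1)) =
      blockState e (fun w => b (f w)) fun _ => lowState n m := by
  rw [marginal_eprGates f (lowWire hm e q) (lowWire_injective hm e q) ex hex hfe b
    (fun j => hb _) hbe]
  exact diagonal_eq_blockState hm e q (fun w => b (f w)) hb

end Block

/-! ## Oracle circuits that prepare copies of a scrambled state -/

section Oracle

variable {t n m L a b N W : ℕ}

theorem lift_trans (e : Fin n ↪ Fin L) (f : Fin L ↪ Fin W) (A : QMat n) :
    lift (e.trans f) A = lift f (lift e A) := by
  ext x y
  simp only [lift]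
  rw [← ite_and]
  refine if_congr ⟨fun h => ⟨fun l hl => h l ?_, fun l hl => h _ ?_⟩, fun ⟨h1, h2⟩ l hl => ?_⟩
    rfl rfl
  · rintro ⟨i, rfl⟩
    exact hl ⟨e i, rfl⟩
  · rintro ⟨i, hi⟩
    exact hl ⟨i, f.injective hi⟩
  · by_cases hlf : l ∈ Set.range f
    · obtain ⟨j, rfl⟩ := hlf
      refine h2 j ?_
      rintro ⟨i, rfl⟩
      exact hl ⟨i, rfl⟩
    · exact h1 l hlf

/-- The gates that flip the bits in which `b` is `1`. -/
def setGates (b : Bits W) : List (Gate W) := ((List.finRange W).filter fun i => b i).map Gate.x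

theorem foldr_map_x (l : List (Fin W)) (hl : l.Nodup) (x : Bits W) (w : Fin W) :
    (l.map Gate.x).foldr Gate.act x w = if w ∈ l then !(x w) else x w := by
  induction l with
  | nil => simp
  | cons i l ih =>
    have hi := (List.nodup_cons.mp hl).1
    have ih := ih (List.nodup_cons.mp hl).2
    rw [List.map_cons, List.foldr_cons]
    by_cases h : w = i
    · subst h
      simp [Gate.act, ih, hi]
    · simp [Gate.act, h, ih]

theorem setGates_mulVec (b : Bits W) :
    gatesMat (setGates b) *ᵥ Pi.single (fun _ => false) 1 = Pi.single b 1 := by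
  funext x
  rw [gatesMat_mulVec_of_classical]
  · simp only [Pi.single_apply]
    refine if_congr ?_ rfl rfl
    simp only [setGates, funext_iff,
      foldr_map_x _ ((List.nodup_finRange W).filter _), List.mem_filter, List.mem_finRange,
      true_and]
    refine forall_congr' fun w => ?_
    cases b w <;> simp
  · intro g hg
    obtain ⟨i, _, rfl⟩ := List.mem_map.mp hg
    trivial

/-- The matrix of a list of oracle gates. -/
noncomputable def oracleMat (U : QMat n) (l : List (OGate n W)) : QMat W :=
  l.foldl (fun M g => g.mat U * M) 1

theorem oracleMat_append (U : QMat n) (l l' : List (OGate n W)) :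
    oracleMat U (l ++ l') = oracleMat U l' * oracleMat U l := by
  rw [oracleMat, List.foldl_append, foldl_mul_eq]
  rfl

theorem oracleMat_map_gate (U : QMat n) (l : List (Gate W)) :
    oracleMat U (l.map OGate.gate) = gatesMat l := by
  rw [oracleMat, List.foldl_map]
  rfl

theorem oracleMat_map_query (U : QMat n) (e : Fin t × Fin n ↪ Fin L) (f : Fin L ↪ Fin W)
    (l : List (Fin t)) :
    oracleMat U (l.map fun i => OGate.query ((blockEmb e i).trans f)) =
      lift f (blocksMat e U l) := by
  induction l using List.reverseRecOn with
  | nil => simp [oracleMat, blocksMat, lift_one]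
  | append_singleton l i ih =>
    have h : blocksMat e U (l ++ [i]) = lift (blockEmb e i) U * blocksMat e U l := by
      rw [blocksMat, List.foldl_append]
      rfl
    rw [List.map_append, oracleMat_append, ih, h, lift_mul, ← lift_trans]
    simp only [oracleMat, List.map_cons, List.map_nil, List.foldl_cons, List.foldl_nil, mul_one]
    rfl

/-- The oracle circuit that prepares the blocks `e` of the input wires of `C` in the state
`U (|0⟩⟨0|^{⊗ (n-m)} ⊗ σ_m) U†`, sets the other input wires to `c`, and runs `C`. -/
def preparedCircuit (C : Circuit L) (hm : m ≤ n) (e : Fin t × Fin n ↪ Fin L)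
    (q : Fin N ≃ Fin t × Fin m) (c : Bits L) : OracleCircuit n where
  width := L + C.anc + N
  gates :=
    (setGates (Fin.append (Fin.append c fun _ => false : Bits (L + C.anc)) fun _ => false)).map
      OGate.gate ++
    (eprGates (List.finRange N)
      (fun j => Fin.castAddEmb N (lowWire hm (e.trans (Fin.castAddEmb C.anc)) q j))
      (fun j => Fin.natAdd (L + C.anc) j) fun i j h => by
        have := congrArg Fin.val h
        simp at this
        omega).map OGate.gate ++
    (List.finRange t).map
      (fun i => .query ((blockEmb (e.trans (Fin.castAddEmb C.anc)) i).trans (Fin.castAddEmb N))) ++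
    (C.gates.map (Gate.map (Fin.castAddEmb N))).map OGate.gate

/-- The queries and the gates of `C` avoid the partner wires of the entangled pairs, so these wires
may be traced out just after the pairs are made. What remains is `C` run on the scrambled blocks. -/
theorem preparedCircuit_acc (C : Circuit L) (hm : m ≤ n) (e : Fin t × Fin n ↪ Fin L)
    (q : Fin N ≃ Fin t × Fin m) (c : Bits L) (hc : ∀ p, c (e p) = false)
    (hN : L + C.anc = 0 → N = 0) (U : QMat n) :
    (preparedCircuit C hm e q c).acc U =
      C.acc (blockState e c fun _ => U * lowState n m * Uᴴ) := by
  set f : Fin (L + C.anc) ↪ Fin (L + C.anc + N) := Fin.castAddEmb N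
  set b : Bits (L + C.anc + N) :=
    Fin.append (Fin.append c fun _ => false : Bits (L + C.anc)) fun _ => false with hbdef
  set e' := e.trans (Fin.castAddEmb C.anc)
  have hfe : ∀ i j, f i ≠ Fin.natAdd (L + C.anc) j := by
    intro i j h
    have := congrArg Fin.val h
    simp [f] at this
    omega
  have hmat : (preparedCircuit C hm e q c).mat U = lift f (gatesMat C.gates) *
      (lift f (blocksMat e' U (List.finRange t)) *
        (gatesMat (eprGates (List.finRange N) (fun j => f (lowWire hm e' q j))
          (fun j => Fin.natAdd (L + C.anc) j) fun i j => hfe (lowWire hm e' q i) j) *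
            gatesMat (setGates b))) := by
    change oracleMat U (preparedCircuit C hm e q c).gates = _
    unfold preparedCircuit
    rw [oracleMat_append, oracleMat_append, oracleMat_append, oracleMat_map_gate,
      oracleMat_map_gate, oracleMat_map_gate, oracleMat_map_query, gatesMat_map]
  suffices H : ∀ M : QMat (L + C.anc + N), M = lift f (gatesMat C.gates) *
      (lift f (blocksMat e' U (List.finRange t)) *
        (gatesMat (eprGates (List.finRange N) (fun j => f (lowWire hm e' q j))
          (fun j => Fin.natAdd (L + C.anc) j) fun i j => hfe (lowWire hm e' q i) j) *
            gatesMat (setGates b))) →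
      probOne (M * zeroState (L + C.anc + N) * Mᴴ) =
        C.acc (blockState e c fun _ => U * lowState n m * Uᴴ) from H _ hmat
  intro M hM
  -- Regroups the conjugation into stages, so that each stage can be evaluated on the state left by
  -- the one before.
  have hstate : ∀ A B D E : QMat (L + C.anc + N),
      A * (B * (D * E)) * zeroState (L + C.anc + N) * (A * (B * (D * E)))ᴴ =
        A * (B * (D * (E * zeroState (L + C.anc + N) * Eᴴ) * Dᴴ) * Bᴴ) * Aᴴ := by
    intro A B D E
    simp only [Matrix.conjTranspose_mul, Matrix.mul_assoc]
  rw [hM, hstate, zeroState, ket_eq_proj, mul_proj_mul, setGates_mulVec, mul_proj_mul]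
  rw [← probOne_marginal f (fun i hi => hi) ?_, marginal_lift, marginal_lift,
    marginal_eprGates_eq_blockState hm f e' q _ (Fin.natAdd_injective _ _) hfe b ?_ ?_,
    blocksMat_mul_blockState _ _ _ _ (List.nodup_finRange t), Circuit.acc, Circuit.run,
    tens_blockState_zeroState]
  · congr 3
    simp [b, f, e']
  · intro p
    simp [b, f, e', hc]
  · intro j
    simp [b]
  -- Measured wire `0` must be a retained wire. Only if `C` has no wires could it be a partner wire,
  -- and `hN` then leaves no partner wires at all.
  · intro l hl
    rcases Nat.eq_zero_or_pos (L + C.anc) with h0 | h0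
    · have := l.2
      have := hN h0
      omega
    · exact ⟨⟨0, h0⟩, rfl⟩

theorem preparedCircuit_size_le (C : Circuit L) (hm : m ≤ n) (e : Fin t × Fin n ↪ Fin L)
    (q : Fin N ≃ Fin t × Fin m) (c : Bits L) :
    (preparedCircuit C hm e q c).size ≤ 4 * (L + C.size + N + t) := by
  have h1 : (setGates (Fin.append (Fin.append c fun _ => false : Bits (L + C.anc))
      fun _ : Fin N => false)).length ≤ L + C.anc + N := by
    rw [setGates, List.length_map]
    exact (List.length_filter_le _ _).trans (by simp)
  simp only [OracleCircuit.size, preparedCircuit, List.length_append, List.length_map,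
    List.length_finRange, Circuit.size, eprGates, List.length_flatMap, List.length_cons,
    List.length_nil, List.map_const', List.sum_replicate, smul_eq_mul]
  omega

end Oracle

end QCrypto

namespace QCrypto

/-! ## Circuits that compute a family of unitaries up to garbage -/

section Garbage

variable {l n a : ℕ}

theorem tens_add {a b : ℕ} (A : QMat a) (B B' : QMat b) :
    tens A (B + B') = tens A B + tens A B' := by
  ext x y
  simp [tens, mul_add]

theorem add_tens {a b : ℕ} (A A' : QMat a) (B : QMat b) :
    tens (A + A') B = tens A B + tens A' B := by
  ext x y
  simp [tens, add_mul]

theorem tens_smul {a b : ℕ} (A : QMat a) (c : ℂ) (B : QMat b) :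
    tens A (c • B) = c • tens A B := by
  ext x y
  simp only [tens, Matrix.smul_apply, smul_eq_mul]
  ring

theorem smul_tens {a b : ℕ} (c : ℂ) (A : QMat a) (B : QMat b) :
    tens (c • A) B = c • tens A B := by
  ext x y
  simp only [tens, Matrix.smul_apply, smul_eq_mul]
  ring

/-- The output of a circuit as a linear function of the state of the last `n` inputs. -/
noncomputable def Circuit.outputLin (C : Circuit (l + n)) (k : Bits l) : QMat n →ₗ[ℂ] QMat n where
  toFun ρ := C.output (tens (ket k) ρ)
  map_add' ρ σ := by
    ext x y
    simp only [Circuit.output, traceLeft, traceRight, Circuit.run, tens_add, add_tens,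
      Matrix.mul_add, Matrix.add_mul, Matrix.add_apply, Finset.sum_add_distrib]
  map_smul' c ρ := by
    ext x y
    simp only [Circuit.output, traceLeft, traceRight, Circuit.run, tens_smul, smul_tens,
      Matrix.mul_smul, Matrix.smul_mul, Matrix.smul_apply, Finset.smul_sum, RingHom.id_apply]

theorem proj_smul (c : ℂ) (ψ : Bits n → ℂ) : proj (c • ψ) = (c * star c) • proj ψ := by
  ext x y
  simp only [proj, Matrix.vecMulVec_apply, Pi.smul_apply, Pi.star_apply, smul_eq_mul,
    Matrix.smul_apply, star_mul']
  ring

/-- A linear map of matrices that vanishes on all pure states is zero. -/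
theorem linearMap_eq_zero_of_proj (D : QMat n →ₗ[ℂ] QMat n)
    (hD : ∀ ψ : Bits n → ℂ, star ψ ⬝ᵥ ψ = 1 → D (proj ψ) = 0) : D = 0 := by
  have h1 : ∀ ψ : Bits n → ℂ, D (proj ψ) = 0 := by
    intro ψ
    by_cases hψ : ψ = 0
    · subst hψ
      have : proj (0 : Bits n → ℂ) = 0 := by ext; simp [proj, Matrix.vecMulVec_apply]
      rw [this, map_zero]
    · have hpos : 0 < star ψ ⬝ᵥ ψ := Matrix.dotProduct_star_self_pos_iff.mpr hψ
      obtain ⟨hre, him⟩ := Complex.lt_def.mp hpos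
      set r := (star ψ ⬝ᵥ ψ).re
      have hr : star ψ ⬝ᵥ ψ = (r : ℂ) := Complex.ext rfl (by simpa using him.symm)
      have hs : ((Real.sqrt r : ℝ) : ℂ) * ((Real.sqrt r : ℝ) : ℂ) = r := by
        rw [← Complex.ofReal_mul, Real.mul_self_sqrt (by simpa using hre.le)]
      have hs0 : ((Real.sqrt r : ℝ) : ℂ) ≠ 0 := by
        intro h0
        rw [h0, zero_mul] at hs
        exact hpos.ne (hr.trans hs.symm).symm
      have h2 := hD ((((Real.sqrt r : ℝ) : ℂ)⁻¹) • ψ) (by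
        rw [star_smul, smul_dotProduct, dotProduct_smul, hr, ← hs]
        simp only [star_inv₀, Complex.star_def, Complex.conj_ofReal, smul_eq_mul]
        field_simp)
      rw [proj_smul, map_smul, smul_eq_zero] at h2
      refine h2.resolve_left ?_
      simp [hs0]
  have h2 : ∀ ψ φ : Bits n → ℂ, D (Matrix.vecMulVec ψ (star φ)) = 0 := by
    intro ψ φ
    -- Polarization: `ψ + φ` shows that the sum of the two cross terms is annihilated, and `ψ + iφ`
    -- that their difference is.
    have e1 : proj (ψ + φ) = proj ψ + proj φ +
        (Matrix.vecMulVec ψ (star φ) + Matrix.vecMulVec φ (star ψ)) := by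
      ext x y
      simp only [proj, Matrix.vecMulVec_apply, Matrix.add_apply, Pi.add_apply, Pi.star_apply,
        star_add]
      ring
    have e2 : proj (ψ + Complex.I • φ) = proj ψ + proj φ +
        Complex.I • (Matrix.vecMulVec φ (star ψ) - Matrix.vecMulVec ψ (star φ)) := by
      ext x y
      simp only [proj, Matrix.vecMulVec_apply, Matrix.add_apply, Pi.add_apply, Pi.star_apply,
        star_add, Pi.smul_apply, Matrix.smul_apply, Matrix.sub_apply, smul_eq_mul, star_mul',
        Complex.star_def, Complex.conj_I]
      linear_combination (-φ x * (starRingEnd ℂ) (φ y)) * Complex.I_mul_I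
    have f1 := h1 (ψ + φ)
    have f2 := h1 (ψ + Complex.I • φ)
    rw [e1, map_add, map_add, h1, h1, add_zero, zero_add, map_add] at f1
    rw [e2, map_add, map_add, h1, h1, add_zero, zero_add, map_smul, smul_eq_zero, map_sub] at f2
    have f3 := f2.resolve_left Complex.I_ne_zero
    have f4 : (2 : ℂ) • D (Matrix.vecMulVec ψ (star φ)) = 0 := by
      rw [two_smul]
      calc _ = (D (Matrix.vecMulVec ψ (star φ)) + D (Matrix.vecMulVec φ (star ψ))) -
          (D (Matrix.vecMulVec φ (star ψ)) - D (Matrix.vecMulVec ψ (star φ))) := by abel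
        _ = 0 := by rw [f1, f3, sub_zero]
    exact (smul_eq_zero.mp f4).resolve_left two_ne_zero
  refine LinearMap.ext fun ρ => ?_
  change D ρ = 0
  rw [Matrix.matrix_eq_sum_single ρ, map_sum]
  simp only [map_sum]
  refine Finset.sum_eq_zero fun x _ => Finset.sum_eq_zero fun y _ => ?_
  have : Matrix.single x y (ρ x y) =
      ρ x y • Matrix.vecMulVec (Pi.single x 1) (star (Pi.single y (1 : ℂ))) := by
    ext z w
    simp only [Matrix.single_apply, Matrix.smul_apply, Matrix.vecMulVec_apply, Pi.star_apply,
      Pi.single_apply, smul_eq_mul]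
    by_cases h1 : x = z <;> by_cases h2 : y = w <;> simp [h1, h2, eq_comm]
  rw [this, map_smul, h2, smul_zero]

/-- Both sides are linear in `ρ`, and pure states span all matrices. The result also applies to the
non-Hermitian matrix units used to read off the garbage. -/
theorem Circuit.output_eq_of_proj (C : Circuit (l + n)) (k : Bits l) (U : QMat n)
    (h : ∀ ψ : Bits n → ℂ, star ψ ⬝ᵥ ψ = 1 →
      C.output (tens (ket k) (proj ψ)) = proj (U *ᵥ ψ)) (ρ : QMat n) :
    C.output (tens (ket k) ρ) = U * ρ * Uᴴ := by
  let R : QMat n →ₗ[ℂ] QMat n :=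
    { toFun := fun ρ => U * ρ * Uᴴ
      map_add' := fun ρ σ => by rw [Matrix.mul_add, Matrix.add_mul]
      map_smul' := fun c ρ => by simp }
  have hD : C.outputLin k - R = 0 := linearMap_eq_zero_of_proj _ fun ψ hψ => by
    rw [LinearMap.sub_apply, sub_eq_zero]
    exact (h ψ hψ).trans (mul_proj_mul U ψ).symm
  exact sub_eq_zero.mp (LinearMap.congr_fun hD ρ)

/-- If all reduced states are pure, then the garbage is a fixed vector in a tensor factor. -/
theorem exists_garbage {X P : Type*} [Fintype X] [DecidableEq X] [Fintype P] (x₀ : X)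
    (U : Matrix X X ℂ) (hU : Uᴴ * U = 1) (Φ : X → X → P → ℂ)
    (h : ∀ x y w w', ∑ p, Φ x w p * star (Φ y w' p) = U w x * star (U w' y)) :
    ∃ γ : P → ℂ, ∀ x w p, Φ x w p = U w x * γ p := by
  have hU0 : ∑ w, star (U w x₀) * U w x₀ = 1 := by
    have := congrFun (congrFun hU x₀) x₀
    simpa [Matrix.mul_apply] using this
  -- `Φ x w p` is the amplitude of output `w` and garbage `p` on input `x`. The candidate garbage is
  -- the inner product of the output for `x₀` with column `x₀` of `U`.
  let γ : P → ℂ := fun p => ∑ w, star (U w x₀) * Φ x₀ w p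
  have hγ : ∀ x w, ∑ p, Φ x w p * star (γ p) = U w x := by
    intro x w
    have : ∀ p, Φ x w p * star (γ p) = ∑ w', U w' x₀ * (Φ x w p * star (Φ x₀ w' p)) := by
      intro p
      simp only [γ, star_sum, star_mul', star_star, Finset.mul_sum]
      exact Finset.sum_congr rfl fun _ _ => by ring
    simp_rw [this]
    rw [Finset.sum_comm]
    simp_rw [← Finset.mul_sum, h]
    calc _ = U w x * ∑ w', star (U w' x₀) * U w' x₀ := by
          rw [Finset.mul_sum]
          exact Finset.sum_congr rfl fun _ _ => by ring
      _ = U w x := by rw [hU0, mul_one]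
  have hγγ : ∑ p, γ p * star (γ p) = 1 := by
    have : ∀ p, γ p * star (γ p) = ∑ w, star (U w x₀) * (Φ x₀ w p * star (γ p)) := by
      intro p
      conv_lhs => enter [1]; simp only [γ]
      rw [Finset.sum_mul]
      exact Finset.sum_congr rfl fun _ _ => by ring
    simp_rw [this]
    rw [Finset.sum_comm]
    simp_rw [← Finset.mul_sum, hγ, hU0]
  refine ⟨γ, fun x w p => ?_⟩
  have hγ' : ∑ p, γ p * star (Φ x w p) = star (U w x) := by
    rw [← hγ x w, star_sum]
    exact Finset.sum_congr rfl fun _ _ => by rw [star_mul', star_star, mul_comm]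
  -- Since `γ` is a unit vector whose overlap with `Φ x w` is `U w x`, the squared distance between
  -- `Φ x w` and `U w x • γ` vanishes.
  have hsum : ∑ p, (Φ x w p - U w x * γ p) * star (Φ x w p - U w x * γ p) = 0 := by
    have : ∀ p, (Φ x w p - U w x * γ p) * star (Φ x w p - U w x * γ p) =
        Φ x w p * star (Φ x w p) - star (U w x) * (Φ x w p * star (γ p)) -
        U w x * (γ p * star (Φ x w p)) + U w x * star (U w x) * (γ p * star (γ p)) := by
      intro p
      rw [star_sub, star_mul']
      ring
    simp_rw [this, Finset.sum_add_distrib, Finset.sum_sub_distrib, ← Finset.mul_sum, h, hγ, hγ',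
      hγγ]
    ring
  have hz : ∀ p ∈ Finset.univ, (Φ x w p - U w x * γ p) * star (Φ x w p - U w x * γ p) = 0 :=
    (Finset.sum_eq_zero_iff_of_nonneg fun p _ => mul_star_self_nonneg _).mp hsum
  have := hz p (Finset.mem_univ p)
  exact sub_eq_zero.mp ((mul_eq_zero.mp this).elim id star_eq_zero.mp)

theorem tens_single_single {a b : ℕ} (x y : Bits a) (z w : Bits b) :
    tens (Matrix.single x y 1) (Matrix.single z w 1) =
      Matrix.single (Fin.append x z) (Fin.append y w) 1 := by
  ext p q
  simp only [tens, Matrix.single_apply, append_eq_iff, ite_mul, one_mul, zero_mul]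
  rw [← ite_and]
  exact if_congr (by tauto) rfl rfl

theorem mul_single_mul_apply {n : ℕ} (M : QMat n) (p q x y : Bits n) :
    (M * Matrix.single p q 1 * Mᴴ : QMat n) x y = M x p * star (M y q) := by
  rw [Matrix.mul_assoc, Matrix.mul_apply, Finset.sum_eq_single p]
  · rw [Matrix.single_mul_apply_same, one_mul, Matrix.conjTranspose_apply]
  · intro z _ hz
    rw [Matrix.single_mul_apply_of_ne (h := hz), mul_zero]
  · simp

/-- A circuit that computes `U` on pure states leaves garbage that does not depend on the input. -/
theorem Circuit.exists_garbage (C : Circuit (l + n)) (k : Bits l) (U : UGroup n)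
    (h : ∀ ψ : Bits n → ℂ, star ψ ⬝ᵥ ψ = 1 →
      C.output (tens (ket k) (proj ψ)) = proj ((U : QMat n) *ᵥ ψ)) :
    ∃ γ : Bits l → Bits C.anc → ℂ, ∀ (x : Bits n) (κ : Bits l) (w : Bits n) (α : Bits C.anc),
      C.mat (Fin.append (Fin.append κ w) α) (Fin.append (Fin.append k x) fun _ => false) =
        (U : QMat n) w x * γ κ α := by
  have hU : (U : QMat n)ᴴ * (U : QMat n) = 1 := Matrix.UnitaryGroup.star_mul_self U
  -- Only the data wires are output, so the final contents of the key wires count as garbage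
  -- together with the ancillas.
  obtain ⟨γ, hγ⟩ := QCrypto.exists_garbage (P := Bits l × Bits C.anc) (fun _ => false) (U : QMat n)
    hU (fun x w p => C.mat (Fin.append (Fin.append p.1 w) p.2)
      (Fin.append (Fin.append k x) fun _ => false)) (by
    intro x y w w'
    have h1 := C.output_eq_of_proj k U h (Matrix.single x y 1)
    have h2 := congrFun (congrFun h1 w) w'
    rw [mul_single_mul_apply] at h2
    rw [← h2, Fintype.sum_prod_type]
    simp only [Circuit.output, traceLeft, traceRight, Circuit.run, ket, zeroState,
      tens_single_single, mul_single_mul_apply])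
  exact ⟨fun κ α => γ (κ, α), fun x κ w α => hγ x w (κ, α)⟩

end Garbage

/-! ## The preparation circuit -/

section Prep

variable {l n m : ℕ}

/-- The wires of a circuit inside those of a circuit with more ancillas. -/
def moreAnc (L a b : ℕ) : Fin (L + a) ↪ Fin (L + (a + b)) :=
  (Fin.castLEEmb (by omega : L + a ≤ L + (a + b)))

theorem castAddEmb_trans_moreAnc (L a b : ℕ) :
    (Fin.castAddEmb a).trans (moreAnc L a b) = Fin.castAddEmb (a + b) := by
  ext i
  rfl

theorem moreAnc_ne (L a b : ℕ) (i : Fin (L + a)) (j : Fin b) :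
    moreAnc L a b i ≠ Fin.natAdd L (Fin.natAdd a j) := by
  intro h
  have : (i : ℕ) = L + (a + j) := congrArg Fin.val h
  omega

/-- The circuit that prepares `|0⟩⟨0|^{⊗ (n-m)} ⊗ σ_m` in the last `n` inputs and then runs `C`. -/
def prepCircuit (C : Circuit (l + n)) (hm : m ≤ n) : Circuit (l + n) where
  anc := C.anc + m
  gates :=
    eprGates (List.finRange m)
      (fun j => moreAnc (l + n) C.anc m
        (lowWire hm ((lastBlock l n).trans (Fin.castAddEmb C.anc))
          (Equiv.uniqueProd (Fin m) (Fin 1)).symm j))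
      (fun j => Fin.natAdd (l + n) (Fin.natAdd C.anc j))
      (fun _ j => moreAnc_ne (l + n) C.anc m _ j) ++
    C.gates.map (Gate.map (moreAnc (l + n) C.anc m))

/-- The `m` extra ancillas hold the partners of the entangled pairs and are never touched by `C`;
discarding them first leaves the last `m` data qubits maximally mixed. -/
theorem prepCircuit_output (C : Circuit (l + n)) (hm : m ≤ n) (k : Bits l) :
    (prepCircuit C hm).output (tens (ket k) (zeroState n)) =
      C.output (tens (ket k) (lowState n m)) := by
  set f := moreAnc (l + n) C.anc m
  set b : Bits (l + n + (C.anc + m)) :=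
    Fin.append (Fin.append k fun _ => false) fun _ => false with hb
  have hbf : ∀ i, b (f i) = (Fin.append (Fin.append k fun _ => false) fun _ => false :
      Bits (l + n + C.anc)) i := by
    intro i
    induction i using Fin.addCases with
    | left i =>
      rw [show f (Fin.castAdd C.anc i) = Fin.castAdd (C.anc + m) i from rfl, hb,
        Fin.append_left, Fin.append_left]
    | right i =>
      rw [show f (Fin.natAdd (l + n) i) = Fin.natAdd (l + n) (Fin.castAdd m i) from rfl, hb,
        Fin.append_right, Fin.append_right]
  have hstate : (prepCircuit C hm).run (tens (ket k) (zeroState n)) =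
      lift f (gatesMat C.gates) * proj (gatesMat (eprGates (List.finRange m)
      (fun j => f (lowWire hm ((lastBlock l n).trans (Fin.castAddEmb C.anc))
          (Equiv.uniqueProd (Fin m) (Fin 1)).symm j))
      (fun j => Fin.natAdd (l + n) (Fin.natAdd C.anc j))
      (fun _ j => moreAnc_ne (l + n) C.anc m _ j)) *ᵥ Pi.single b 1) *
      (lift f (gatesMat C.gates))ᴴ := by
    rw [mul_proj_mul, ← gatesMat_map, Matrix.mulVec_mulVec, ← gatesMat_append, ← mul_proj_mul,
      ← ket_eq_proj, hb, ← tens_ket_ket, ← tens_ket_ket]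
    rfl
  refine (congrArg (fun ρ : QMat (l + n + (C.anc + m)) => (traceLeft (traceRight ρ) : QMat n))
    hstate).trans ?_
  rw [traceRight_eq_marginal, traceLeft_eq_marginal, ← castAddEmb_trans_moreAnc, ← marginal_trans, marginal_lift,
    marginal_eprGates_eq_blockState hm f _ _ _ _ (moreAnc_ne _ _ _) b]
  · rw [Circuit.output, traceRight_eq_marginal, traceLeft_eq_marginal, Circuit.run,
      tens_ket_eq_blockState, tens_blockState_zeroState, funext hbf]
    rfl
  · rintro ⟨i, j⟩
    rw [hbf]
    change Fin.append (Fin.append k fun _ => false) _ (Fin.castAdd _ (Fin.natAdd l j)) = false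
    simp
  · intro j
    simp [hb]
  · exact fun i j h => by simpa using h

end Prep

end QCrypto

namespace QCrypto

/-! ## The verification circuit -/

section Verify

variable {l n s W : ℕ}

/-- A chain of Toffoli gates that computes the conjunction of the negations of the wires `D j`. -/
def norGates (D : Fin s → Fin W) (A : Fin (s + 1) → Fin W) (hDA : ∀ i j, D i ≠ A j)
    (hA : A.Injective) : List (Gate W) :=
  (List.finRange s).flatMap fun j =>
    [.x (D j), .ccx (D j) (A j.castSucc) (A j.succ) (hDA _ _) (hDA _ _)
      (hA.ne (Fin.castSucc_lt_succ (i := j)).ne)]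

theorem isClassical_norGates (D : Fin s → Fin W) (A : Fin (s + 1) → Fin W)
    (hDA : ∀ i j, D i ≠ A j) (hA : A.Injective) : ∀ g ∈ norGates D A hDA hA, g.IsClassical :=
  isClassical_flatMap _ _ fun _ => by simp [Gate.IsClassical]

/-- After step `j` the wire `A j.succ` holds the conjunction of `A 0` and the negations of the `D i`
with `i ≤ j`. Each Toffoli acts on a control just flipped by `X` and a target still equal to `0`. -/
theorem foldl_norGates (D : Fin s → Fin W) (A : Fin (s + 1) → Fin W)
    (hDA : ∀ i j, D i ≠ A j) (hD : D.Injective) (hA : A.Injective) (b : Bits W)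
    (hb : ∀ j : Fin s, b (A j.succ) = false) :
    ((norGates D A hDA hA).foldl (fun b g => g.act b) b (A (Fin.last s)) = true ↔
      b (A 0) = true ∧ ∀ j, b (D j) = false) ∧
    ∀ w, (∀ j, w ≠ D j) → (∀ j, w ≠ A j) →
      (norGates D A hDA hA).foldl (fun b g => g.act b) b w = b w := by
  induction s with
  | zero => simp [norGates]
  | succ s ih =>
    have hrec : norGates D A hDA hA =
        norGates (D ∘ Fin.castSucc) (A ∘ Fin.castSucc) (fun i j => hDA _ _)
          (hA.comp (Fin.castSucc_injective _)) ++
        [.x (D (Fin.last s)), .ccx (D (Fin.last s)) (A (Fin.last s).castSucc)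
          (A (Fin.last s).succ) (hDA _ _) (hDA _ _)
          (hA.ne (Fin.castSucc_lt_succ (i := Fin.last s)).ne)] := by
      rw [norGates, List.finRange_succ_last, List.flatMap_append, List.flatMap_map]
      rfl
    obtain ⟨h1, h2⟩ := ih (D ∘ Fin.castSucc) (A ∘ Fin.castSucc) (fun i j => hDA _ _)
      (hD.comp (Fin.castSucc_injective _)) (hA.comp (Fin.castSucc_injective _))
      fun j => by simpa using hb j.castSucc
    rw [hrec, List.foldl_append]
    set b' := (norGates (D ∘ Fin.castSucc) (A ∘ Fin.castSucc) (fun i j => hDA _ _)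
      (hA.comp (Fin.castSucc_injective _))).foldl (fun b g => g.act b) b
    have h3 : b' (D (Fin.last s)) = b (D (Fin.last s)) :=
      h2 _ (fun j => hD.ne (Fin.castSucc_lt_last j).ne') fun j => hDA _ _
    have h4 : b' (A (Fin.last s).succ) = false := by
      rw [h2 _ (fun j => (hDA _ _).symm) fun j => hA.ne ?_, hb]
      rw [Fin.succ_last]
      exact (Fin.castSucc_lt_last j).ne'
    refine ⟨?_, fun w hwD hwA => ?_⟩
    · have h5 : (A (Fin.last s).castSucc) ≠ D (Fin.last s) := (hDA _ _).symm
      have h6 : (A (Fin.last s).succ) ≠ D (Fin.last s) := (hDA _ _).symm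
      simp only [List.foldl_cons, List.foldl_nil, Gate.act, ← Fin.succ_last,
        Function.update_self, Function.update_of_ne h5, Function.update_of_ne h6, h3, h4,
        Bool.false_xor, Bool.and_eq_true]
      rw [show b' (A (Fin.last s).castSucc) = true ↔ _ from h1]
      rw [Fin.forall_fin_succ']
      simp only [Function.comp, Fin.castSucc_zero, Bool.not_eq_true']
      tauto
    · simp only [List.foldl_cons, List.foldl_nil, Gate.act]
      rw [Function.update_of_ne (hwA _), Function.update_of_ne (hwD _)]
      exact h2 w (fun j => hwD _) fun j => hwA _

/-- The wires of the verification circuit: keys, data, ancillas of `C`, a second data register, and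
the ancillas of the conjunction. -/
abbrev VWires (l n a s : ℕ) : ℕ := l + n + (a + (n + (s + 2)))

namespace VWires

variable (l n a s : ℕ)

def key (i : Fin l) : Fin (VWires l n a s) := Fin.castAdd _ (Fin.castAdd n i)
def data (i : Fin n) : Fin (VWires l n a s) := Fin.castAdd _ (Fin.natAdd l i)
def anc (i : Fin a) : Fin (VWires l n a s) := Fin.natAdd (l + n) (Fin.castAdd _ i)
def copy (i : Fin n) : Fin (VWires l n a s) := Fin.natAdd (l + n) (Fin.natAdd a (Fin.castAdd _ i))
def work (i : Fin (s + 2)) : Fin (VWires l n a s) :=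
  Fin.natAdd (l + n) (Fin.natAdd a (Fin.natAdd n i))
/-- The first wire. -/
def first : Fin (VWires l n a s) := ⟨0, by unfold VWires; omega⟩

variable {l n a s}

theorem data_ne_copy (i j : Fin n) : data l n a s i ≠ copy l n a s j := by
  simp only [data, copy, ne_eq, Fin.ext_iff, Fin.val_castAdd, Fin.val_natAdd]
  omega

theorem data_ne_work (i : Fin n) (j : Fin (s + 2)) : data l n a s i ≠ work l n a s j := by
  simp only [data, work, ne_eq, Fin.ext_iff, Fin.val_castAdd, Fin.val_natAdd]
  omega

/-- Work wire `0` is a spare: if there are no key, data, copy or ancilla wires, it is itself the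
first wire. The test uses only the work wires from `1` on, which therefore never coincide with the
measured wire. -/
theorem first_ne_work (j : Fin (s + 1)) : first l n a s ≠ work l n a s j.succ := by
  simp only [first, work, ne_eq, Fin.ext_iff, Fin.val_natAdd, Fin.val_succ]
  omega

theorem data_injective : (data l n a s).Injective := fun i j h => by
  simpa [data, Fin.ext_iff] using h

theorem copy_injective : (copy l n a s).Injective := fun i j h => by
  simpa [copy, Fin.ext_iff] using h

theorem work_injective : (work l n a s).Injective := fun i j h => by
  simpa [work, Fin.ext_iff] using h

end VWires

open VWires in
/-- The gates that exchange the two data registers. -/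
def dataSwap (l n a s : ℕ) : List (Gate (VWires l n a s)) :=
  multiSwap (List.finRange n) (data l n a s) (copy l n a s) data_ne_copy

open VWires in
/-- The gates that write into the first wire whether the first `s` data wires are `0`. -/
def zeroTest (l n a s : ℕ) (hs : s ≤ n) : List (Gate (VWires l n a s)) :=
  .x (work l n a s 1) ::
    (norGates (fun j : Fin s => data l n a s (Fin.castLE hs j)) (fun j => work l n a s j.succ)
      (fun _ _ => data_ne_work _ _) (work_injective.comp (Fin.succ_injective _)) ++
    swapGates (first l n a s) (work l n a s (Fin.last s).succ) (first_ne_work _))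

/-- The verification circuit: it reproduces the garbage of `C` on the input `|0⟩`, runs `C`
backwards with this garbage and the data, and tests whether the first `s` data wires are `0`. -/
def verifyCircuit (C : Circuit (l + n)) (s : ℕ) (hs : s ≤ n) : Circuit (l + n) where
  anc := C.anc + (n + (s + 2))
  gates := dataSwap l n C.anc s ++
    (C.gates.map (Gate.map (moreAnc (l + n) C.anc (n + (s + 2)))) ++
    (dataSwap l n C.anc s ++
    ((C.gates.reverse.map Gate.inv).map (Gate.map (moreAnc (l + n) C.anc (n + (s + 2)))) ++
    zeroTest l n C.anc s hs)))

open VWires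

variable {a : ℕ}

theorem isClassical_zeroTest (hs : s ≤ n) : ∀ g ∈ zeroTest l n a s hs, g.IsClassical := by
  intro g hg
  rw [zeroTest, List.mem_cons, List.mem_append] at hg
  rcases hg with rfl | hg | hg
  · trivial
  · exact isClassical_norGates _ _ _ _ g hg
  · exact isClassical_swapGates _ _ _ g hg

/-- Work wire `1` is set to `1` and seeds the conjunction; the final swap carries the result to the
measured wire, even though this wire may itself carry key or data. -/
theorem foldl_zeroTest (hs : s ≤ n) (b : Bits (VWires l n a s))
    (hb : ∀ i, b (work l n a s i) = false) :
    (zeroTest l n a s hs).foldl (fun b g => g.act b) b (first l n a s) = true ↔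
      ∀ j : Fin n, (j : ℕ) < s → b (data l n a s j) = false := by
  have hswap : ∀ x : Bits (VWires l n a s),
      (swapGates (first l n a s) (work l n a s (Fin.last s).succ) (first_ne_work _)).foldl
        (fun b g => g.act b) x = x ∘ Equiv.swap (first l n a s) (work l n a s (Fin.last s).succ) :=
    fun x => foldr_swapGates _ _ (first_ne_work _) x
  rw [zeroTest, List.foldl_cons, List.foldl_append, hswap]
  simp only [Function.comp, Equiv.swap_apply_left]
  have h1 : ∀ w, w ≠ work l n a s 1 → (Gate.x (work l n a s 1)).act b w = b w :=
    fun w hw => Function.update_of_ne hw _ _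
  refine ((foldl_norGates (fun j : Fin s => data l n a s (Fin.castLE hs j))
    (fun j => work l n a s j.succ) (fun _ _ => data_ne_work _ _)
    (data_injective.comp (Fin.castLE_injective hs))
    (work_injective.comp (Fin.succ_injective _)) _ ?_).1).trans ?_
  · intro j
    rw [h1 _ (work_injective.ne ?_), hb]
    simp [Fin.ext_iff]
  · rw [show (Gate.x (work l n a s 1)).act b (work l n a s (Fin.succ 0)) = true by
      simp [Gate.act, hb]]
    simp only [h1 _ (data_ne_work _ _), true_and]
    exact ⟨fun h j hj => h ⟨j, hj⟩, fun h j => h _ j.2⟩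

theorem comp_dataSwap (b : Bits (VWires l n a s)) :
    let b' := (dataSwap l n a s).foldr Gate.act b
    (b' ∘ key l n a s = b ∘ key l n a s) ∧ (b' ∘ data l n a s = b ∘ copy l n a s) ∧
    (b' ∘ anc l n a s = b ∘ anc l n a s) ∧ (b' ∘ copy l n a s = b ∘ data l n a s) ∧
    (b' ∘ work l n a s = b ∘ work l n a s) := by
  obtain ⟨h1, h2, h3⟩ := foldr_multiSwap (List.finRange n) (List.nodup_finRange n)
    (data l n a s) (copy l n a s) data_ne_copy data_injective copy_injective b
  refine ⟨funext fun i => h3 _ fun j _ => ⟨?_, ?_⟩, funext fun i => h1 i (List.mem_finRange i),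
    funext fun i => h3 _ fun j _ => ⟨?_, ?_⟩, funext fun i => h2 i (List.mem_finRange i),
    funext fun i => h3 _ fun j _ => ⟨?_, ?_⟩⟩ <;>
  · simp only [key, anc, work, data, copy, ne_eq, Fin.ext_iff, Fin.val_castAdd, Fin.val_natAdd]
    omega

theorem bits_ext_iff (b : Bits (VWires l n a s)) (k : Bits l) (x : Bits n) (α : Bits a)
    (ξ : Bits n) (ζ : Bits (s + 2)) :
    Fin.append (Fin.append k x) (Fin.append α (Fin.append ξ ζ)) = b ↔
      b ∘ key l n a s = k ∧ b ∘ data l n a s = x ∧ b ∘ anc l n a s = α ∧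
        b ∘ copy l n a s = ξ ∧ b ∘ work l n a s = ζ := by
  simp only [append_eq_iff]
  constructor
  · rintro ⟨⟨h1, h2⟩, h3, h4, h5⟩
    exact ⟨h1.symm, h2.symm, h3.symm, h4.symm, h5.symm⟩
  · rintro ⟨rfl, rfl, rfl, rfl, rfl⟩
    exact ⟨⟨rfl, rfl⟩, rfl, rfl, rfl⟩

/-- The state of the verification circuit before the final test, on the input `|k, x⟩`. -/
theorem uncompute_mulVec (C : Circuit (l + n)) (k : Bits l) (U : QMat n) (hUU : U * Uᴴ = 1)
    (γ : Bits l → Bits C.anc → ℂ)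
    (hγ : ∀ (x : Bits n) (κ : Bits l) (w : Bits n) (α : Bits C.anc),
      C.mat (Fin.append (Fin.append κ w) α) (Fin.append (Fin.append k x) fun _ => false) =
        U w x * γ κ α) (x : Bits n) (b : Bits (VWires l n C.anc s)) :
    (lift (moreAnc (l + n) C.anc (n + (s + 2))) (gatesMat C.gates)ᴴ *ᵥ
      (gatesMat (dataSwap l n C.anc s) *ᵥ
      (lift (moreAnc (l + n) C.anc (n + (s + 2))) (gatesMat C.gates) *ᵥ
      (gatesMat (dataSwap l n C.anc s) *ᵥ
        Pi.single (Fin.append (Fin.append k x) fun _ => false) 1)))) b =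
      (if b ∘ key l n C.anc s = k ∧ b ∘ anc l n C.anc s = fun _ => false then
        star (U x (b ∘ data l n C.anc s)) else 0) *
      (U (b ∘ copy l n C.anc s) (fun _ => false) *
        if b ∘ work l n C.anc s = fun _ => false then 1 else 0) := by
  set e := moreAnc (l + n) C.anc (n + (s + 2)) with he
  have hcl : ∀ g ∈ dataSwap l n C.anc s, g.IsClassical := isClassical_multiSwap (List.finRange n) (data l n C.anc s) (copy l n C.anc s)
    data_ne_copy
  have hoff : ∀ (i : Fin (n + (s + 2))),
      (Fin.natAdd (l + n) (Fin.natAdd C.anc i) : Fin (VWires l n C.anc s)) ∉ Set.range e :=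
    fun i ⟨j, hj⟩ => moreAnc_ne _ _ _ j i hj
  have hcopy : ∀ y (b : Bits (VWires l n C.anc s)),
      overwrite e y b ∘ copy l n C.anc s = b ∘ copy l n C.anc s :=
    fun y b => funext fun i => overwrite_of_notMem _ _ (hoff _)
  have hwork : ∀ y (b : Bits (VWires l n C.anc s)),
      overwrite e y b ∘ work l n C.anc s = b ∘ work l n C.anc s :=
    fun y b => funext fun i => overwrite_of_notMem _ _ (hoff _)
  have hbe : ∀ b : Bits (VWires l n C.anc s), (fun i => b (e i)) =
      Fin.append (Fin.append (b ∘ key l n C.anc s) (b ∘ data l n C.anc s))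
        (b ∘ anc l n C.anc s) := by
    intro b
    refine ((append_eq_iff _ _ _).mpr ⟨(append_eq_iff _ _ _).mpr ⟨rfl, rfl⟩, rfl⟩).symm
  -- the state after the first exchange
  have h1 : gatesMat (dataSwap l n C.anc s) *ᵥ
      Pi.single (Fin.append (Fin.append k x) fun _ => false) (1 : ℂ) = fun b =>
      (Pi.single (Fin.append (Fin.append k fun _ => false) fun _ => false) 1 :
        Bits (l + n + C.anc) → ℂ) (fun i => b (e i)) *
      (if b ∘ copy l n C.anc s = x ∧ b ∘ work l n C.anc s = fun _ => false then 1 else 0) := by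
    funext b
    rw [gatesMat_mulVec_of_classical _ hcl]
    obtain ⟨s1, s2, s3, s4, s5⟩ := comp_dataSwap b
    simp only [Pi.single_apply, hbe]
    rw [ite_mul, one_mul, zero_mul, ← ite_and]
    refine if_congr ?_ rfl rfl
    have hz : (fun _ => false : Bits (C.anc + (n + (s + 2)))) =
        Fin.append (fun _ => false) (Fin.append (fun _ => false) fun _ => false) :=
      ((append_eq_iff _ _ _).mpr ⟨rfl, (append_eq_iff _ _ _).mpr ⟨rfl, rfl⟩⟩).symm
    rw [hz, eq_comm, bits_ext_iff, s1, s2, s3, s4, s5]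
    rw [append_eq_iff, append_eq_iff]
    simp only [Fin.append_left, Fin.append_right]
    constructor
    · rintro ⟨rfl, rfl, h3, h4, h5⟩
      exact ⟨⟨⟨rfl, h4⟩, h3⟩, rfl, h5⟩
    · rintro ⟨⟨⟨h1, h4⟩, h3⟩, h2, h5⟩
      exact ⟨h1, h2, h3, h4, h5⟩
  -- Running `C` on zero data produces `U|0⟩` together with the garbage `γ`, while `x` waits in the
  -- second register.
  have h2 : lift e (gatesMat C.gates) *ᵥ (gatesMat (dataSwap l n C.anc s) *ᵥ
      Pi.single (Fin.append (Fin.append k x) fun _ => false) (1 : ℂ)) = fun b =>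
      U (b ∘ data l n C.anc s) (fun _ => false) *
        γ (b ∘ key l n C.anc s) (b ∘ anc l n C.anc s) *
      (if b ∘ copy l n C.anc s = x ∧ b ∘ work l n C.anc s = fun _ => false then 1 else 0) := by
    rw [h1]
    funext b
    rw [lift_mulVec_mul e _ _ _ fun y b => by rw [hcopy, hwork], Matrix.mulVec_single_one]
    congr 1
    rw [hbe]
    exact hγ _ _ _ _
  -- After the second exchange `U|0⟩` is set aside. Because `|x⟩ = U U†|x⟩`, the data `x` next to
  -- the garbage `γ` is the output of `C` on the input `U†|x⟩`.
  have h3 : gatesMat (dataSwap l n C.anc s) *ᵥ (lift e (gatesMat C.gates) *ᵥ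
      (gatesMat (dataSwap l n C.anc s) *ᵥ
      Pi.single (Fin.append (Fin.append k x) fun _ => false) (1 : ℂ))) = fun b =>
      (gatesMat C.gates *ᵥ fun u => ∑ w, star (U x w) *
        (Pi.single (Fin.append (Fin.append k w) fun _ => false) 1 : Bits (l + n + C.anc) → ℂ) u)
          (fun i => b (e i)) *
      (U (b ∘ copy l n C.anc s) (fun _ => false) *
        if b ∘ work l n C.anc s = fun _ => false then 1 else 0) := by
    rw [h2]
    funext b
    rw [gatesMat_mulVec_of_classical _ hcl]
    obtain ⟨s1, s2, s3, s4, s5⟩ := comp_dataSwap b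
    simp only [s1, s2, s3, s4, s5]
    have hsum : (gatesMat C.gates *ᵥ fun u => ∑ w, star (U x w) *
        (Pi.single (Fin.append (Fin.append k w) fun _ => false) 1 : Bits (l + n + C.anc) → ℂ) u)
          (fun i => b (e i)) = (if b ∘ data l n C.anc s = x then 1 else 0) *
            γ (b ∘ key l n C.anc s) (b ∘ anc l n C.anc s) := by
      have hlin : (fun u => ∑ w, star (U x w) *
          (Pi.single (Fin.append (Fin.append k w) fun _ => false) 1 :
            Bits (l + n + C.anc) → ℂ) u) = ∑ w, star (U x w) •
          (Pi.single (Fin.append (Fin.append k w) fun _ => false) 1 :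
            Bits (l + n + C.anc) → ℂ) := by
        funext u
        simp
      have hx := congrFun (congrFun hUU (b ∘ data l n C.anc s)) x
      rw [Matrix.mul_apply, Matrix.one_apply] at hx
      rw [hlin, Matrix.mulVec_sum, Finset.sum_apply, ← hx, Finset.sum_mul]
      refine Finset.sum_congr rfl fun w _ => ?_
      rw [Matrix.mulVec_smul, Pi.smul_apply, Matrix.mulVec_single_one, hbe]
      rw [show (gatesMat C.gates).col _ _ = _ from hγ w _ _ _, smul_eq_mul,
        Matrix.conjTranspose_apply]
      ring
    rw [hsum]
    by_cases hd : b ∘ data l n C.anc s = x <;> by_cases hw : b ∘ work l n C.anc s = fun _ => false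
    · simp only [hd, hw, and_self, if_true]
      ring
    all_goals simp [hd, hw]
  -- The reversed circuit cancels `C`, leaving `U†|x⟩` in the data register and clear ancillas.
  rw [h3, lift_mulVec_mul e _ _ _ fun y b => by rw [hcopy, hwork], Matrix.mulVec_mulVec,
    gatesMat_conjTranspose_mul, Matrix.one_mulVec, hbe]
  congr 1
  simp only [Pi.single_apply, append_eq_iff, Fin.append_left, Fin.append_right]
  rw [Finset.sum_eq_single (b ∘ data l n C.anc s)]
  · rw [mul_ite, mul_one, mul_zero]
    exact if_congr ⟨fun h => ⟨h.1.1, h.2⟩, fun h => ⟨⟨h.1, rfl⟩, h.2⟩⟩ rfl rfl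
  · intro w _ hw
    rw [if_neg fun h => hw h.1.2.symm, mul_zero]
  · simp

end Verify

end QCrypto

namespace QCrypto

/-! ### The acceptance probability of the verification circuit -/

section VerifyAcc

open VWires

variable {l n s a : ℕ}

theorem sum_append {M : Type*} [AddCommMonoid M] {a b : ℕ} (F : Bits (a + b) → M) :
    ∑ x, F x = ∑ x : Bits a, ∑ y : Bits b, F (Fin.append x y) := by
  rw [← (Fin.appendEquiv a b).sum_comp F, Fintype.sum_prod_type]
  rfl

theorem mul_tens_ket_mul_apply (M : QMat (l + n + a)) (k : Bits l) (σ : QMat n)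
    (x : Bits (l + n + a)) :
    (M * tens (tens (ket k) σ) (zeroState a) * Mᴴ : QMat (l + n + a)) x x =
      ∑ y, ∑ z, σ y z * (M x (Fin.append (Fin.append k y) fun _ => false) *
        star (M x (Fin.append (Fin.append k z) fun _ => false))) := by
  have h : tens (tens (ket k) σ) (zeroState a) = ∑ y, ∑ z, σ y z •
      Matrix.single (Fin.append (Fin.append k y) fun _ => false)
        (Fin.append (Fin.append k z) fun _ => false) (1 : ℂ) := by
    have h1 : ∀ y z, σ y z • Matrix.single (Fin.append (Fin.append k y) fun _ => false)
        (Fin.append (Fin.append k z) fun _ => false : Bits (l + n + a)) (1 : ℂ) =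
        tens (tens (ket k) (Matrix.single y z (σ y z))) (zeroState a) := by
      intro y z
      rw [← tens_single_single, ← tens_single_single, ← smul_tens, ← tens_smul,
        Matrix.smul_single, smul_eq_mul, mul_one]
      rfl
    simp only [h1]
    conv_lhs => rw [Matrix.matrix_eq_sum_single σ]
    ext p q
    simp only [tens, Matrix.sum_apply, Finset.mul_sum, Finset.sum_mul]
  rw [h]
  simp only [Matrix.mul_sum, Matrix.sum_mul, Matrix.sum_apply, Matrix.mul_smul, Matrix.smul_mul,
    Matrix.smul_apply, mul_single_mul_apply, smul_eq_mul]

/-- The verification circuit accepts `σ` under the key `k` with probability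
`tr (|0⟩⟨0|^{⊗ s} U† σ U)`. -/
theorem verifyCircuit_acc (C : Circuit (l + n)) (hs : s ≤ n) (k : Bits l) (U : UGroup n)
    (h : ∀ ψ : Bits n → ℂ, star ψ ⬝ᵥ ψ = 1 →
      C.output (tens (ket k) (proj ψ)) = proj ((U : QMat n) *ᵥ ψ)) (σ : QMat n) :
    (verifyCircuit C s hs).acc (tens (ket k) σ) =
      ∑ w : Bits n, if ∀ j : Fin n, (j : ℕ) < s → w j = false then
        (((U : QMat n)ᴴ * σ * (U : QMat n)) w w).re else 0 := by
  obtain ⟨γ, hγ⟩ := C.exists_garbage k U h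
  have hUU : (U : QMat n) * (U : QMat n)ᴴ = 1 := Matrix.mem_unitaryGroup_iff.mp U.2
  have hUU' : (U : QMat n)ᴴ * (U : QMat n) = 1 := Matrix.UnitaryGroup.star_mul_self U
  set V : QMat n := (U : QMat n)
  have hv := uncompute_mulVec (s := s) C k V hUU γ hγ
  set v : Bits n → Bits (VWires l n C.anc s) → ℂ := fun x b =>
    (if b ∘ key l n C.anc s = k ∧ b ∘ anc l n C.anc s = fun _ => false then
        star (V x (b ∘ data l n C.anc s)) else 0) *
      (V (b ∘ copy l n C.anc s) (fun _ => false) *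
        if b ∘ work l n C.anc s = fun _ => false then 1 else 0) with hvdef
  have hM : ∀ x (b : Bits (VWires l n C.anc s)), (verifyCircuit C s hs).mat b (Fin.append (Fin.append k x) fun _ => false) =
      v x ((zeroTest l n C.anc s hs).foldr Gate.act b) := by
    intro x b
    have h1 : (verifyCircuit C s hs).mat b (Fin.append (Fin.append k x) fun _ => false) =
        (gatesMat (verifyCircuit C s hs).gates *ᵥ
          Pi.single (Fin.append (Fin.append k x) fun _ => false) 1) b := by
      rw [Matrix.mulVec_single_one]
      rfl
    rw [h1]
    unfold verifyCircuit
    rw [gatesMat_append, gatesMat_append, gatesMat_append, gatesMat_append,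
      gatesMat_map, gatesMat_map, gatesMat_inv]
    simp only [← Matrix.mulVec_mulVec]
    exact (gatesMat_mulVec_of_classical _ (isClassical_zeroTest hs) _ b).trans (hv x _)
  -- The final test permutes basis states. Summing over the string before the test lets the
  -- amplitudes `v` be used directly.
  let T : Bits (VWires l n C.anc s) ≃ Bits (VWires l n C.anc s) :=
    ⟨fun b => (zeroTest l n C.anc s hs).foldl
      (fun (b : Bits (VWires l n C.anc s)) (g : Gate (VWires l n C.anc s)) => g.act b) b,
      fun b => (zeroTest l n C.anc s hs).foldr Gate.act b,
      foldr_act_foldl_act _, foldl_act_foldr_act _⟩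
  have hacc : (verifyCircuit C s hs).acc (tens (ket k) σ) =
      ∑ b : Bits (VWires l n C.anc s), if T b (first l n C.anc s) = true then
        (∑ y, ∑ z, σ y z * (v y b * star (v z b))).re else 0 := by
    have hprob : ∀ ρ : QMat (VWires l n C.anc s), probOne ρ =
        ∑ b : Bits (VWires l n C.anc s), if T b (first l n C.anc s) = true then
          (ρ (T b) (T b)).re else 0 := by
      intro ρ
      rw [T.sum_comp fun b => if b (first l n C.anc s) = true then (ρ b b).re else 0, probOne]
      refine Finset.sum_congr rfl fun b _ => if_congr ⟨?_, fun h => ⟨_, rfl, h⟩⟩ rfl rfl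
      rintro ⟨i, hi, hb⟩
      rwa [show first l n C.anc s = i from Fin.ext hi.symm]
    refine (hprob _).trans (Finset.sum_congr rfl fun b _ => if_congr Iff.rfl ?_ rfl)
    have hMT : ∀ y, (verifyCircuit C s hs).mat (T b) (Fin.append (Fin.append k y) fun _ => false) =
        v y b := fun y => (hM y (T b)).trans (congrArg (v y) (T.symm_apply_apply b))
    refine congrArg Complex.re ((mul_tens_ket_mul_apply (a := C.anc + (n + (s + 2))) _ k σ
      (T b)).trans (Finset.sum_congr rfl fun y _ => Finset.sum_congr rfl fun z _ => ?_))
    exact congrArg (σ y z * ·) (congrArg₂ (fun p q => p * star q) (hMT y) (hMT z))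
  have hquad : ∀ w, ∑ y, ∑ z, σ y z * (star (V y w) * V z w) = (Vᴴ * σ * V) w w := by
    intro w
    simp only [Matrix.mul_apply, Finset.sum_mul, Matrix.conjTranspose_apply]
    rw [Finset.sum_comm]
    exact Finset.sum_congr rfl fun _ _ => Finset.sum_congr rfl fun _ _ => by ring
  -- The second register is left in the unit vector `U|0⟩`, in a tensor factor of its own, so
  -- summing over it contributes `1`.
  have hnorm : ∑ ξ : Bits n, Complex.normSq (V ξ fun _ => false) = 1 := by
    have := congrFun (congrFun hUU' fun _ => false) fun _ => false
    rw [Matrix.mul_apply, Matrix.one_apply_eq] at this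
    have h2 := congrArg Complex.re this
    rw [Complex.re_sum, Complex.one_re] at h2
    rw [← h2]
    refine Finset.sum_congr rfl fun ξ _ => ?_
    rw [Matrix.conjTranspose_apply, Complex.star_def, ← Complex.normSq_eq_conj_mul_self,
      Complex.ofReal_re]
  have hterm : ∀ b : Bits (VWires l n C.anc s), (if T b (first l n C.anc s) = true then
        (∑ y, ∑ z, σ y z * (v y b * star (v z b))).re else 0) =
      if b ∘ key l n C.anc s = k then if b ∘ anc l n C.anc s = (fun _ => false) then
        if b ∘ work l n C.anc s = (fun _ => false) then
          (if ∀ j : Fin n, (j : ℕ) < s → (b ∘ data l n C.anc s) j = false then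
            ((Vᴴ * σ * V) (b ∘ data l n C.anc s) (b ∘ data l n C.anc s)).re else 0) *
            Complex.normSq (V (b ∘ copy l n C.anc s) fun _ => false) else 0 else 0 else 0 := by
    intro b
    by_cases h1 : b ∘ key l n C.anc s = k; swap
    · simp [hvdef, h1]
    by_cases h2 : b ∘ anc l n C.anc s = fun _ => false; swap
    · simp [hvdef, h2]
    by_cases h3 : b ∘ work l n C.anc s = fun _ => false; swap
    · simp [hvdef, h3]
    rw [if_pos h1, if_pos h2, if_pos h3, ite_mul, zero_mul]
    refine if_congr (foldl_zeroTest hs b (congrFun h3)) ?_ rfl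
    have h4 : ∀ y z, σ y z * (v y b * star (v z b)) =
        σ y z * (star (V y (b ∘ data l n C.anc s)) * V z (b ∘ data l n C.anc s)) *
          (Complex.normSq (V (b ∘ copy l n C.anc s) fun _ => false) : ℂ) := by
      intro y z
      simp only [hvdef, h1, h2, h3, and_self, if_true, mul_one, star_mul', star_star]
      rw [Complex.normSq_eq_conj_mul_self, Complex.star_def]
      ring
    simp only [h4, ← Finset.sum_mul]
    rw [hquad, Complex.re_mul_ofReal]
  rw [hacc, Finset.sum_congr rfl fun b _ => hterm b]
  have hcomp : ∀ (κ : Bits l) (w : Bits n) (α : Bits C.anc) (ξ : Bits n) (ζ : Bits (s + 2)),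
      _ := fun κ w α ξ ζ => (bits_ext_iff (Fin.append (Fin.append κ w) (Fin.append α
        (Fin.append ξ ζ))) κ w α ξ ζ).mp rfl
  rw [sum_append, sum_append, Finset.sum_eq_single k]
  · refine Finset.sum_congr rfl fun w _ => ?_
    rw [sum_append, Finset.sum_eq_single fun _ => false]
    · rw [sum_append]
      have : ∀ ξ : Bits n, ∀ ζ : Bits (s + 2), _ := fun ξ ζ => hcomp k w (fun _ => false) ξ ζ
      simp only [this, if_true]
      simp only [Finset.sum_ite_eq', Finset.mem_univ, if_true, ← Finset.mul_sum, hnorm, mul_one]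
    · intro α _ hα
      rw [sum_append]
      refine Finset.sum_eq_zero fun ξ _ => Finset.sum_eq_zero fun ζ _ => ?_
      rw [(hcomp k w α ξ ζ).2.2.1, if_neg hα, ite_self]
    · simp
  · intro κ _ hκ
    refine Finset.sum_eq_zero fun w _ => ?_
    rw [sum_append]
    refine Finset.sum_eq_zero fun α _ => ?_
    rw [sum_append]
    refine Finset.sum_eq_zero fun ξ _ => Finset.sum_eq_zero fun ζ _ => ?_
    rw [(hcomp κ w α ξ ζ).1, if_neg hκ]
  · simp

end VerifyAcc

end QCrypto

namespace QCrypto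

/-! ## Programs -/

section Programs

/-- The program terminates in `s'` after at most `B` steps. -/
def Runs (p : Prog) (s s' : Store) (B : ℕ) : Prop := ∃ T, Exec p s s' T ∧ T ≤ B

theorem Runs.seq {p q : Prog} {s s' s'' : Store} {B B' : ℕ} (h : Runs p s s' B)
    (h' : Runs q s' s'' B') : Runs (.seq p q) s s'' (B + B') := by
  obtain ⟨T, hT, hB⟩ := h
  obtain ⟨T', hT', hB'⟩ := h'
  exact ⟨T + T', hT.seq hT', by omega⟩

theorem Runs.mono {p : Prog} {s s' : Store} {B B' : ℕ} (h : Runs p s s' B) (hB : B ≤ B') :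
    Runs p s s' B' := by
  obtain ⟨T, hT, hT'⟩ := h
  exact ⟨T, hT, hT'.trans hB⟩

/-- All counters and stacks of the program have numbers below `R`. -/
def Prog.Below (R : ℕ) : Prog → Prop
  | .const r _ => r < R
  | .plus r a b => r < R ∧ a < R ∧ b < R
  | .minus r a b => r < R ∧ a < R ∧ b < R
  | .push i r => i < R ∧ r < R
  | .pop r i => r < R ∧ i < R
  | .seq p q => p.Below R ∧ q.Below R
  | .ite r p q => r < R ∧ p.Below R ∧ q.Below R
  | .loop r p => r < R ∧ p.Below R

theorem Prog.exists_below (p : Prog) : ∃ R₀, ∀ R, R₀ ≤ R → p.Below R := by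
  induction p with
  | const r c => exact ⟨r + 1, fun R h => h⟩
  | plus r a b => exact ⟨r + a + b + 1, fun R h => ⟨by omega, by omega, by omega⟩⟩
  | minus r a b => exact ⟨r + a + b + 1, fun R h => ⟨by omega, by omega, by omega⟩⟩
  | push i r => exact ⟨i + r + 1, fun R h => ⟨by omega, by omega⟩⟩
  | pop r i => exact ⟨i + r + 1, fun R h => ⟨by omega, by omega⟩⟩
  | seq p q hp hq =>
    obtain ⟨P, hP⟩ := hp
    obtain ⟨Q, hQ⟩ := hq
    exact ⟨P + Q, fun R h => ⟨hP R (by omega), hQ R (by omega)⟩⟩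
  | ite r p q hp hq =>
    obtain ⟨P, hP⟩ := hp
    obtain ⟨Q, hQ⟩ := hq
    exact ⟨r + P + Q + 1, fun R h => ⟨by omega, hP R (by omega), hQ R (by omega)⟩⟩
  | loop r p hp =>
    obtain ⟨P, hP⟩ := hp
    exact ⟨r + P + 1, fun R h => ⟨by omega, hP R (by omega)⟩⟩

/-- The two memories agree below `R`. -/
def Store.Agree (R : ℕ) (s u : Store) : Prop :=
  (∀ r, r < R → s.reg r = u.reg r) ∧ ∀ i, i < R → s.stk i = u.stk i

theorem Store.Agree.setReg {R : ℕ} {s u : Store} (h : s.Agree R u) (r v : ℕ) :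
    (s.setReg r v).Agree R (u.setReg r v) := by
  refine ⟨fun r' hr' => ?_, h.2⟩
  simp only [Store.setReg, Function.update_apply, h.1 r' hr']

theorem Store.Agree.setStk {R : ℕ} {s u : Store} (h : s.Agree R u) (i : ℕ) (l : List ℕ) :
    (s.setStk i l).Agree R (u.setStk i l) := by
  refine ⟨h.1, fun i' hi' => ?_⟩
  simp only [Store.setStk, Function.update_apply, h.2 i' hi']

theorem Store.setReg_of_ge {R r : ℕ} (u : Store) (hr : r < R) (v : ℕ) :
    ∀ q, R ≤ q → (u.setReg r v).reg q = u.reg q :=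
  fun _ hq => Function.update_of_ne (by omega) _ _

/-- A program neither reads nor writes the counters and stacks that it does not mention. -/
theorem Exec.frame {R : ℕ} {p : Prog} {s s' : Store} {T : ℕ} (h : Exec p s s' T) :
    p.Below R → ∀ u : Store, s.Agree R u →
      ∃ u', Exec p u u' T ∧ s'.Agree R u' ∧ ∀ r, R ≤ r → u'.reg r = u.reg r := by
  induction h with
  | const r c s =>
    exact fun hp u hu => ⟨_, .const r c u, hu.setReg r c, u.setReg_of_ge hp _⟩
  | plus r a b s =>
    refine fun hp u hu => ⟨_, .plus r a b u, ?_, u.setReg_of_ge hp.1 _⟩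
    rw [hu.1 a hp.2.1, hu.1 b hp.2.2]
    exact hu.setReg _ _
  | minus r a b s =>
    refine fun hp u hu => ⟨_, .minus r a b u, ?_, u.setReg_of_ge hp.1 _⟩
    rw [hu.1 a hp.2.1, hu.1 b hp.2.2]
    exact hu.setReg _ _
  | push i r s =>
    refine fun hp u hu => ⟨_, .push i r u, ?_, fun _ _ => rfl⟩
    rw [hu.1 r hp.2, hu.2 i hp.1]
    exact hu.setStk _ _
  | pop r i s =>
    refine fun hp u hu => ⟨_, .pop r i u, ?_, u.setReg_of_ge hp.1 _⟩
    rw [hu.2 i hp.2]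
    exact (hu.setReg _ _).setStk _ _
  | seq _ _ ih ih' =>
    intro hp u hu
    obtain ⟨u', h1, h2, h3⟩ := ih hp.1 u hu
    obtain ⟨u'', h1', h2', h3'⟩ := ih' hp.2 u' h2
    exact ⟨u'', h1.seq h1', h2', fun r hr => (h3' r hr).trans (h3 r hr)⟩
  | ite_true hr _ ih =>
    intro hp u hu
    obtain ⟨u', h1, h2, h3⟩ := ih hp.2.1 u hu
    exact ⟨u', .ite_true (hu.1 _ hp.1 ▸ hr) h1, h2, h3⟩
  | ite_false hr _ ih =>
    intro hp u hu
    obtain ⟨u', h1, h2, h3⟩ := ih hp.2.2 u hu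
    exact ⟨u', .ite_false (hu.1 _ hp.1 ▸ hr) h1, h2, h3⟩
  | loop_done hr =>
    exact fun hp u hu => ⟨u, .loop_done (hu.1 _ hp.1 ▸ hr), hu, fun _ _ => rfl⟩
  | loop_step hr _ _ ih ih' =>
    intro hp u hu
    obtain ⟨u', h1, h2, h3⟩ := ih hp.2 u hu
    obtain ⟨u'', h1', h2', h3'⟩ := ih' hp u' h2
    exact ⟨u'', .loop_step (hu.1 _ hp.1 ▸ hr) h1 h1', h2', fun r hr => (h3' r hr).trans (h3 r hr)⟩

/-! ### Straight-line programs -/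

/-- The program has no branches. -/
def Prog.Straight : Prog → Prop
  | .seq p q => p.Straight ∧ q.Straight
  | .ite _ _ _ => False
  | .loop _ _ => False
  | _ => True

/-- The effect of a straight-line program. -/
def Prog.eval : Prog → Store → Store
  | .const r c, s => s.setReg r c
  | .plus r a b, s => s.setReg r (s.reg a + s.reg b)
  | .minus r a b, s => s.setReg r (s.reg a - s.reg b)
  | .push i r, s => s.setStk i (s.reg r :: s.stk i)
  | .pop r i, s => (s.setReg r ((s.stk i).headD 0)).setStk i (s.stk i).tail
  | .seq p q, s => q.eval (p.eval s)
  | _, s => s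

/-- The number of steps of a straight-line program. -/
def Prog.cost : Prog → ℕ
  | .seq p q => p.cost + q.cost
  | _ => 1

theorem Prog.exec_eval (p : Prog) (hp : p.Straight) (s : Store) : Exec p s (p.eval s) p.cost := by
  induction p generalizing s with
  | const r c => exact .const r c s
  | plus r a b => exact .plus r a b s
  | minus r a b => exact .minus r a b s
  | push i r => exact .push i r s
  | pop r i => exact .pop r i s
  | seq p q hp' hq' => exact (hp' hp.1 s).seq (hq' hp.2 _)
  | ite r p q => exact hp.elim
  | loop r p => exact hp.elim

/-- The programs of a list, one after the other. -/
def seqs : List Prog → Prog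
  | [] => .const 11 0
  | p :: l => .seq p (seqs l)

/-! ### Loops -/

/-- The index of the invariant is the number of rounds still to come. The counter need not equal it,
only vanish at the same time: in `moveGates` it holds the code of the next gate. -/
theorem runs_loop {c : ℕ} {p : Prog} {B : ℕ} (Inv : ℕ → Store → Prop)
    (hc : ∀ j s, Inv j s → (s.reg c = 0 ↔ j = 0))
    (hp : ∀ j s, Inv (j + 1) s → ∃ s', Runs p s s' B ∧ Inv j s') (N : ℕ) (s : Store)
    (hs : Inv N s) : ∃ s', Runs (.loop c p) s s' (N * (B + 1) + 1) ∧ Inv 0 s' := by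
  induction N generalizing s with
  | zero => exact ⟨s, ⟨1, .loop_done ((hc 0 s hs).mpr rfl), by omega⟩, hs⟩
  | succ N ih =>
    obtain ⟨s', ⟨T, hT, hTB⟩, hs'⟩ := hp N s hs
    obtain ⟨s'', ⟨T', hT', hTB'⟩, hs''⟩ := ih s' hs'
    refine ⟨s'', ⟨T + T' + 1, .loop_step (fun h => ?_) hT hT', ?_⟩, hs''⟩
    · exact absurd ((hc _ s hs).mp h) (by omega)
    · rw [Nat.add_mul]
      omega

/-! ### Writing gates

Counter `10` is the loop counter, `11` and `14` to `20` are scratch, `12` and `13` hold `1` and `0`. -/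

/-- An entry of a template: a constant, or the sum of a counter and the loop counter. -/
abbrev Entry : Type := ℕ ⊕ ℕ

/-- The value of an entry. -/
def Entry.val (reg : ℕ → ℕ) (j : ℕ) : Entry → ℕ
  | .inl c => c
  | .inr r => reg r + j

/-- The entry does not use the counters `10` and `11`. -/
def Entry.Ok : Entry → Prop
  | .inl _ => True
  | .inr r => r ≠ 10 ∧ r ≠ 11

/-- Push the values of a template on the stack `i`. -/
def emit (i : ℕ) : List Entry → Prog
  | [] => .const 11 0
  | .inl c :: l => .seq (emit i l) (.seq (.const 11 c) (.push i 11))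
  | .inr r :: l => .seq (emit i l) (.seq (.plus 11 r 10) (.push i 11))

/-- Stacks grow at the head, so a template is pushed from its last entry to its first. -/
theorem emit_runs (i : ℕ) (l : List Entry) (hl : ∀ v ∈ l, v.Ok) (s : Store) :
    ∃ s', Runs (emit i l) s s' (2 * l.length + 1) ∧ (∀ r, r ≠ 11 → s'.reg r = s.reg r) ∧
      s'.stk = Function.update s.stk i (l.map (Entry.val s.reg (s.reg 10)) ++ s.stk i) := by
  induction l with
  | nil =>
    refine ⟨_, ⟨1, .const 11 0 s, by simp⟩, fun r hr => Function.update_of_ne hr _ _, ?_⟩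
    simp [Store.setReg]
  | cons v l ih =>
    obtain ⟨s', h1, h2, h3⟩ := ih fun v hv => hl v (List.mem_cons_of_mem _ hv)
    have hv := hl v List.mem_cons_self
    rcases v with c | r
    · refine ⟨_, (h1.seq ⟨_, (Exec.const 11 c s').seq (.push i 11 _), le_rfl⟩).mono
        (by simp; omega), fun r hr => ?_, ?_⟩
      · simp [Store.setReg, Store.setStk, hr, h2]
      · simp [Store.setReg, Store.setStk, h3, Entry.val]
    · refine ⟨_, (h1.seq ⟨_, (Exec.plus 11 r 10 s').seq (.push i 11 _), le_rfl⟩).mono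
        (by simp; omega), fun r hr => ?_, ?_⟩
      · simp [Store.setReg, Store.setStk, hr, h2]
      · simp [Store.setReg, Store.setStk, h3, Entry.val, h2 r hv.2, h2 10]

/-- Push the values of a template on the stack `i`, for all values of the loop counter below the
value of the counter `N`. -/
def emitLoop (i N : ℕ) (l : List Entry) : Prog :=
  .seq (.plus 10 N 13) (.loop 10 (.seq (.minus 10 10 12) (emit i l)))

/-- The counters that hold parameters. -/
def Param (r : ℕ) : Prop := r < 10 ∨ r = 12 ∨ r = 13

/-- The parameters are the same in both memories. -/
def Store.Keeps (s s' : Store) : Prop := ∀ r, Param r → s'.reg r = s.reg r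

theorem Store.Keeps.trans {s s' s'' : Store} (h : s.Keeps s') (h' : s'.Keeps s'') :
    s.Keeps s'' := fun r hr => (h' r hr).trans (h r hr)

/-- The entry is a constant or refers to a parameter. -/
def Entry.IsParam : Entry → Prop
  | .inl _ => True
  | .inr r => Param r

/-- The counter is decremented before each push, so the indices run from `N - 1` down to `0` (with
`N` the value held in that counter), and the pushed blocks end up in increasing order. -/
theorem emitLoop_runs (i N : ℕ) (l : List Entry) (hl : ∀ v ∈ l, v.IsParam) (s : Store)
    (h12 : s.reg 12 = 1) (h13 : s.reg 13 = 0) :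
    ∃ s', Runs (emitLoop i N l) s s' ((s.reg N + 1) * (2 * l.length + 3)) ∧ s.Keeps s' ∧
      s'.stk = Function.update s.stk i
        ((List.range (s.reg N)).flatMap (fun j => l.map (Entry.val s.reg j)) ++ s.stk i) := by
  have hok : ∀ v ∈ l, v.Ok := by
    intro v hv
    have := hl v hv
    rcases v with c | r
    · trivial
    · simp only [Entry.IsParam, Param] at this
      simp only [Entry.Ok]
      omega
  have hval : ∀ (reg : ℕ → ℕ), (∀ r, Param r → reg r = s.reg r) → ∀ j,
      l.map (Entry.val reg j) = l.map (Entry.val s.reg j) := by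
    intro reg hreg j
    refine List.map_congr_left fun v hv => ?_
    have := hl v hv
    rcases v with c | r
    · rfl
    · simp only [Entry.val, hreg r this]
  -- `w` is the part already written: prefixed by the blocks with index below `j`, it is the
  -- complete output.
  let Inv : ℕ → Store → Prop := fun j u => u.reg 10 = j ∧ s.Keeps u ∧ j ≤ s.reg N ∧
    ∃ w, u.stk = Function.update s.stk i (w ++ s.stk i) ∧
      (List.range j).flatMap (fun j => l.map (Entry.val s.reg j)) ++ w =
        (List.range (s.reg N)).flatMap (fun j => l.map (Entry.val s.reg j))
  obtain ⟨s', hs', -, hk, -, w, hw, hw'⟩ := runs_loop (c := 10)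
    (p := .seq (.minus 10 10 12) (emit i l)) (B := 2 * l.length + 2) Inv
    (fun j u hu => by rw [hu.1]) (fun j u ⟨h1, h2, h3, w, h4, h5⟩ => by
      obtain ⟨u', g1, g2, g3⟩ := emit_runs i l hok (u.setReg 10 j)
      have hu12 : u.reg 12 = 1 := (h2 12 (by simp [Param])).trans h12
      have hset : u.setReg 10 j = u.setReg 10 (u.reg 10 - u.reg 12) := by
        rw [h1, hu12, Nat.add_sub_cancel]
      have hkeep : s.Keeps u' := by
        intro r hr
        have hr' : r ≠ 10 ∧ r ≠ 11 := by simp only [Param] at hr; omega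
        rw [g2 r hr'.2, ← h2 r hr]
        simp [Store.setReg, hr'.1]
      refine ⟨u', (Runs.seq ⟨1, .minus 10 10 12 u, le_rfl⟩ (hset ▸ g1)).mono (by omega), ?_, hkeep,
        by omega, l.map (Entry.val s.reg j) ++ w, ?_, ?_⟩
      · rw [g2 10 (by omega)]
        simp [Store.setReg]
      · rw [g3, hval _ fun r hr => ?_]
        · simp [Store.setReg, h4]
        · have hr' : r ≠ 10 := by simp only [Param] at hr; omega
          simpa [Store.setReg, hr'] using h2 r hr
      · rw [← h5, List.range_succ, List.flatMap_append]
        simp) (s.reg N) (s.setReg 10 (s.reg N + s.reg 13))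
    ⟨by simp [Store.setReg, h13], fun r hr => Function.update_of_ne (by
      simp only [Param] at hr; omega) _ _, le_rfl, [], by simp [Store.setReg], by simp⟩
  refine ⟨s', (Runs.seq ⟨1, .plus 10 N 13 s, le_rfl⟩ hs').mono ?_, hk, ?_⟩
  · rw [Nat.add_mul, show 2 * l.length + 2 + 1 = 2 * l.length + 3 from rfl]
    omega
  · rw [hw, ← hw']
    simp

/-! ### Moving gates -/

/-- Move the gate codes from the stack `i` to the stack `j`, in reversed order, and push the codes
of the inverse gates on the stack `k`. -/
def moveGates (i j k : ℕ) : Prog :=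
  .seq (.pop 14 i) (.loop 14 (seqs
    [.pop 15 i, .pop 16 i, .pop 17 i,
      .const 18 3, .minus 18 18 14, .minus 18 12 18,
      .const 19 4, .minus 19 19 14, .minus 19 12 19,
      .const 20 5, .minus 20 20 14, .minus 20 12 20,
      .plus 18 18 20, .plus 18 18 14, .minus 18 18 19, .minus 18 18 19,
      .push j 17, .push j 16, .push j 15, .push j 14,
      .push k 17, .push k 16, .push k 15, .push k 18, .pop 14 i]))

/-- Truncated subtraction makes `1 - (r - c)` the indicator of `r ≤ c` for `r = 3, 4, 5`. Adding the
indicators for `3` and `5` and subtracting that for `4` twice exchanges the codes `3` and `4` of `T`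
and `T†` without branching. Gate codes are nonzero, so `0` can mark the end of a list. -/
theorem Gate.exists_code {W : ℕ} (g : Gate W) : ∃ c x y z, g.code = [c, x, y, z] ∧ c ≠ 0 ∧
    g.inv.code = [(1 - (3 - c)) + (1 - (5 - c)) + c - (1 - (4 - c)) - (1 - (4 - c)), x, y, z] := by
  cases g <;> exact ⟨_, _, _, _, rfl, by decide, rfl⟩

/-- The loop stops at the first zero code, which is a marker below the gate codes or the default
value on an empty stack; hence the condition on `rest`. The invariant splits `L` into the moved part
`L₁` and the remaining part `L₂`, the kind of whose first gate is already in counter `14`. -/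
theorem moveGates_runs {W : ℕ} (i j k : ℕ) (hij : i ≠ j) (hik : i ≠ k) (hjk : j ≠ k)
    (L : List (Gate W)) (rest : List ℕ) (hrest : rest.headD 0 = 0) (s : Store)
    (h12 : s.reg 12 = 1) (hs : s.stk i = L.flatMap Gate.code ++ rest) :
    ∃ s', Runs (moveGates i j k) s s' ((L.length + 1) * 30) ∧ s.Keeps s' ∧
      s'.stk = Function.update (Function.update (Function.update s.stk i rest.tail) j
        (L.reverse.flatMap Gate.code ++ s.stk j)) k
          ((L.reverse.map Gate.inv).flatMap Gate.code ++ s.stk k) := by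
  let Inv : ℕ → Store → Prop := fun t u => s.Keeps u ∧ ∃ L₁ L₂ : List (Gate W),
    L = L₁ ++ L₂ ∧ L₂.length = t ∧
    u.reg 14 = (L₂.flatMap Gate.code ++ rest).headD 0 ∧
    u.stk = Function.update (Function.update (Function.update s.stk i
      (L₂.flatMap Gate.code ++ rest).tail) j
        (L₁.reverse.flatMap Gate.code ++ s.stk j)) k
          ((L₁.reverse.map Gate.inv).flatMap Gate.code ++ s.stk k)
  obtain ⟨s', hs', hk, L₁, L₂, hL, hL₂, -, hst⟩ := runs_loop (c := 14) (p := seqs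
    [.pop 15 i, .pop 16 i, .pop 17 i,
      .const 18 3, .minus 18 18 14, .minus 18 12 18,
      .const 19 4, .minus 19 19 14, .minus 19 12 19,
      .const 20 5, .minus 20 20 14, .minus 20 12 20,
      .plus 18 18 20, .plus 18 18 14, .minus 18 18 19, .minus 18 18 19,
      .push j 17, .push j 16, .push j 15, .push j 14,
      .push k 17, .push k 16, .push k 15, .push k 18, .pop 14 i]) (B := 26) Inv
    (fun t u ⟨_, L₁, L₂, _, h1, h2, _⟩ => by
      rw [h2, ← h1]
      cases L₂ with
      | nil => simpa using hrest
      | cons g L₂ =>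
        obtain ⟨c, x, y, z, hc, hc0, -⟩ := g.exists_code
        simp [hc, hc0])
    (fun t u ⟨hk, L₁, L₂, hL, h1, h2, h3⟩ => by
      cases L₂ with
      | nil => simp at h1
      | cons g L₂ =>
        obtain ⟨c, x, y, z, hc, hc0, hinv⟩ := g.exists_code
        have hu12 : u.reg 12 = 1 := (hk 12 (by simp [Param])).trans h12
        refine ⟨_, ⟨_, Prog.exec_eval _ (by simp [seqs, Prog.Straight]) u,
          by simp [seqs, Prog.cost]⟩, fun r hr => ?_, L₁ ++ [g], L₂, by simp [hL],
          by simpa using h1, ?_, ?_⟩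
        · rw [← hk r hr]
          simp only [Param] at hr
          have : r ≠ 11 ∧ r ≠ 14 ∧ r ≠ 15 ∧ r ≠ 16 ∧ r ≠ 17 ∧ r ≠ 18 ∧ r ≠ 19 ∧ r ≠ 20 := by omega
          simp [seqs, Prog.eval, Store.setReg, Store.setStk, this]
        · have h4 : u.stk i = x :: y :: z :: (L₂.flatMap Gate.code ++ rest) := by
            simp [h3, hij, hik, hc]
          simp [seqs, Prog.eval, Store.setReg, Store.setStk, h4, hij, hik]
        · have h4 : u.stk i = x :: y :: z :: (L₂.flatMap Gate.code ++ rest) := by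
            simp [h3, hij, hik, hc]
          have h5 : u.stk j = L₁.reverse.flatMap Gate.code ++ s.stk j := by
            simp [h3, hjk]
          have h6 : u.stk k = (L₁.reverse.map Gate.inv).flatMap Gate.code ++ s.stk k := by
            simp [h3]
          have h7 : u.reg 14 = c := by simp [h2, hc]
          funext q
          simp only [seqs, Prog.eval, Store.setReg, Store.setStk, Function.update_apply]
          by_cases hqk : q = k
          · subst hqk
            simp [h4, h6, h7, hu12, hinv, hik.symm, hjk.symm]
          by_cases hqj : q = j
          · subst hqj
            simp [h4, h5, h7, hc, hqk, hij.symm]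
          by_cases hqi : q = i
          · subst hqi
            simp [h4, hij, hik]
          · simp [hqi, hqj, hqk, h3]) L.length
    ((s.setReg 14 ((s.stk i).headD 0)).setStk i (s.stk i).tail)
    ⟨fun r hr => Function.update_of_ne (by simp only [Param] at hr; omega) _ _, [], L, rfl, rfl,
      by simp [Store.setReg, Store.setStk, hs], by
        funext q
        simp only [Store.setReg, Store.setStk, Function.update_apply, hs]
        split_ifs <;> simp_all⟩
  refine ⟨s', (Runs.seq ⟨1, .pop 14 i s, le_rfl⟩ hs').mono (by omega), hk, ?_⟩
  obtain rfl := List.length_eq_zero_iff.mp hL₂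
  simpa [hL] using hst

end Programs

end QCrypto

namespace QCrypto

/-! ## Polynomial bounds -/

section Poly

/-- For `n ≥ 2` the constant and the shift are absorbed by `k ≤ n ^ k` and `n + 1 ≤ n ^ 2`; the
values below `2` are covered by the additive constant. -/
theorem polyBounded_of_le {f : ℕ → ℕ} {c k : ℕ} (h : ∀ n, f n ≤ k * (n + 1) ^ c) :
    PolyBounded f := by
  refine ⟨2 * c + k + k * 2 ^ c, fun n => (h n).trans ?_⟩
  have hk : k * 2 ^ c ≥ k := Nat.le_mul_of_pos_right k (by positivity)
  rcases Nat.lt_or_ge n 2 with hn | hn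
  · have : (n + 1) ^ c ≤ 2 ^ c := Nat.pow_le_pow_left (by omega) c
    calc k * (n + 1) ^ c ≤ k * 2 ^ c := Nat.mul_le_mul_left k this
      _ ≤ _ := by omega
  · have h1 : (n + 1) ^ c ≤ n ^ (2 * c) := by
      rw [pow_mul]
      exact Nat.pow_le_pow_left (by nlinarith) c
    have h2 : k ≤ n ^ k := (Nat.lt_pow_self (by omega)).le
    calc k * (n + 1) ^ c ≤ n ^ k * n ^ (2 * c) := Nat.mul_le_mul h2 h1
      _ = n ^ (2 * c + k) := by rw [← pow_add, add_comm]
      _ ≤ n ^ (2 * c + k + k * 2 ^ c) := Nat.pow_le_pow_right (by omega) (by omega)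
      _ ≤ _ := by omega

theorem PolyBounded.exists_le {f : ℕ → ℕ} (h : PolyBounded f) :
    ∃ c k, ∀ n, f n ≤ k * (n + 1) ^ c := by
  obtain ⟨c, hc⟩ := h
  refine ⟨c, c + 1, fun n => (hc n).trans ?_⟩
  have h1 : n ^ c ≤ (n + 1) ^ c := Nat.pow_le_pow_left (by omega) c
  have h2 : 1 ≤ (n + 1) ^ c := Nat.one_le_pow _ _ (by omega)
  nlinarith

theorem PolyBounded.mono {f g : ℕ → ℕ} (hg : PolyBounded g) (h : ∀ n, f n ≤ g n) :
    PolyBounded f := by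
  obtain ⟨c, hc⟩ := hg
  exact ⟨c, fun n => (h n).trans (hc n)⟩

theorem polyBounded_id : PolyBounded fun n => n := ⟨1, fun n => by simp⟩

theorem polyBounded_const (k : ℕ) : PolyBounded fun _ => k := ⟨k, fun _ => Nat.le_add_left _ _⟩

theorem PolyBounded.mul {f g : ℕ → ℕ} (hf : PolyBounded f) (hg : PolyBounded g) :
    PolyBounded fun n => f n * g n := by
  obtain ⟨c, k, hc⟩ := hf.exists_le
  obtain ⟨c', k', hc'⟩ := hg.exists_le
  refine polyBounded_of_le (c := c + c') (k := k * k') fun n => ?_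
  calc f n * g n ≤ (k * (n + 1) ^ c) * (k' * (n + 1) ^ c') := Nat.mul_le_mul (hc n) (hc' n)
    _ = _ := by ring

theorem PolyBounded.add {f g : ℕ → ℕ} (hf : PolyBounded f) (hg : PolyBounded g) :
    PolyBounded fun n => f n + g n := by
  obtain ⟨c, k, hc⟩ := hf.exists_le
  obtain ⟨c', k', hc'⟩ := hg.exists_le
  refine polyBounded_of_le (c := c + c') (k := k + k') fun n => ?_
  have h1 : (n + 1) ^ c ≤ (n + 1) ^ (c + c') := Nat.pow_le_pow_right (by omega) (by omega)
  have h2 : (n + 1) ^ c' ≤ (n + 1) ^ (c + c') := Nat.pow_le_pow_right (by omega) (by omega)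
  calc f n + g n ≤ k * (n + 1) ^ c + k' * (n + 1) ^ c' := Nat.add_le_add (hc n) (hc' n)
    _ ≤ k * (n + 1) ^ (c + c') + k' * (n + 1) ^ (c + c') :=
      Nat.add_le_add (Nat.mul_le_mul_left _ h1) (Nat.mul_le_mul_left _ h2)
    _ = _ := by ring

end Poly

/-! ## Programs for the preparation and verification circuits -/

section Uniform

/-- A program that runs `P` on the first two inputs and keeps all three inputs. -/
theorem exists_setup (P : Prog) : ∃ (P' : Prog) (c : ℕ), ∀ (n l m : ℕ) (s : Store) (T : ℕ),
    Exec P (Store.init [n, l]) s T → ∃ s', Runs P' (Store.init [n, l, m]) s' (T + c) ∧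
      s'.reg 0 = s.reg 0 ∧ s'.reg 1 = n ∧ s'.reg 2 = l ∧ s'.reg 3 = m ∧ s'.stk 0 = s.stk 0 := by
  obtain ⟨R₀, hR₀⟩ := P.exists_below
  -- Counters from `R` on are invisible to `P`, so the inputs survive there; `R + 3` holds `0` and
  -- turns addition into copying. Counter `2` is cleared because `P` expects only two inputs.
  obtain ⟨R, hR, hR20⟩ : ∃ R, R₀ ≤ R ∧ 20 ≤ R := ⟨R₀ + 20, by omega, by omega⟩
  set A := seqs [.const (R + 3) 0, .plus R 0 (R + 3), .plus (R + 1) 1 (R + 3),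
    .plus (R + 2) 2 (R + 3), .const 2 0] with hA
  set B := seqs [.plus 1 R (R + 3), .plus 2 (R + 1) (R + 3), .plus 3 (R + 2) (R + 3)] with hB
  refine ⟨.seq A (.seq P B), A.cost + B.cost, fun n l m s T h => ?_⟩
  have hne : ∀ a b, a < 20 → R + b ≠ a := fun a b h => by omega
  have hne' : ∀ a b, a < 20 → a ≠ R + b := fun a b h => by omega
  have hR0 : ∀ a, a < 20 → R ≠ a := fun a h => by omega
  have hR0' : ∀ a, a < 20 → a ≠ R := fun a h => by omega
  have hagree : (Store.init [n, l]).Agree R (A.eval (Store.init [n, l, m])) := by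
    refine ⟨fun r hr => ?_, fun i hi => by simp [hA, seqs, Prog.eval, Store.setReg, Store.init]⟩
    have h1 : r ≠ R ∧ r ≠ R + 1 ∧ r ≠ R + 2 ∧ r ≠ R + 3 := by omega
    simp only [hA, seqs, Prog.eval, Store.setReg, Store.init, Function.update_apply, h1, if_false]
    rcases r with _ | _ | _ | r <;> simp
  obtain ⟨u, h1, h2, h3⟩ := h.frame (hR₀ R hR) _ hagree
  refine ⟨B.eval u, (Runs.seq ⟨_, A.exec_eval (by simp [hA, seqs, Prog.Straight]) _, le_rfl⟩
    (Runs.seq ⟨_, h1, le_rfl⟩ ⟨_, B.exec_eval (by simp [hB, seqs, Prog.Straight]) _,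
      le_rfl⟩)).mono (by omega), ?_, ?_, ?_, ?_, ?_⟩
  · rw [h2.1 0 (by omega)]
    simp [hB, seqs, Prog.eval, Store.setReg]
  · simp [hB, seqs, Prog.eval, Store.setReg, h3, hA, Store.init, hR0, hR0', hne, hne']
  · simp [hB, seqs, Prog.eval, Store.setReg, h3, hA, Store.init, hR0, hR0', hne, hne']
  · simp [hB, seqs, Prog.eval, Store.setReg, h3, hA, Store.init, hR0, hR0', hne, hne']
  · rw [h2.2 0 (by omega)]
    simp [hB, seqs, Prog.eval, Store.setReg]

theorem flatMap_finRange {α : Type*} (N : ℕ) (f : ℕ → List α) :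
    (List.finRange N).flatMap (fun j : Fin N => f j) = (List.range N).flatMap f := by
  rw [← List.map_coe_finRange_eq_range, List.flatMap_map]

theorem flatMap_code_map {a W : ℕ} (e : Fin a ↪ Fin W) (he : ∀ i, (e i : ℕ) = i)
    (l : List (Gate a)) : (l.map (Gate.map e)).flatMap Gate.code = l.flatMap Gate.code := by
  rw [List.flatMap_map]
  congr 1
  funext g
  cases g <;> simp [Gate.map, Gate.code, he]

/-- The codes of the pair-creating gates are pushed on top of those of `G n`. Counter `5` holds the
first partner wire and counter `6` the first of the last `m` data wires. -/
theorem isQPT_prepCircuit {lam m : ℕ → ℕ} (hm : ∀ n, m n ≤ n) {G : ∀ n, Circuit (lam n + n)}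
    (hG : IsQPT (fun n => lam n + n) (fun n => [n, lam n]) G) :
    IsQPT (fun n => lam n + n) (fun n => [n, lam n, m n])
      fun n => prepCircuit (G n) (hm n) := by
  obtain ⟨hsize, P, time, htime, hP⟩ := hG
  obtain ⟨P', c, hP'⟩ := exists_setup P
  set A := seqs [.const 12 1, .const 13 0, .plus 5 2 1, .plus 5 5 0, .minus 6 1 3,
    .plus 6 2 6, .plus 0 0 3] with hA
  set tm : List Entry := [.inl 2, .inr 5, .inl 0, .inl 0, .inl 5, .inr 5, .inr 6, .inl 0] with htm
  have hrun : ∀ n, ∃ s, Runs (.seq P' (.seq A (emitLoop 0 3 tm))) (Store.init [n, lam n, m n]) s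
      ((time n + c) + (A.cost + (m n + 1) * 19)) ∧ s.reg 0 = (prepCircuit (G n) (hm n)).anc ∧
      s.stk 0 = (prepCircuit (G n) (hm n)).gates.flatMap Gate.code := by
    intro n
    obtain ⟨s, h1, h2, h3⟩ := hP n
    obtain ⟨u, g1, g2, g3, g4, g5, g6⟩ := hP' n (lam n) (m n) s _ h1
    obtain ⟨v, f1, f2, f3⟩ := emitLoop_runs 0 3 tm (by
        intro v hv
        simp only [htm, List.mem_cons, List.not_mem_nil, or_false] at hv
        rcases hv with rfl | rfl | rfl | rfl | rfl | rfl | rfl | rfl <;>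
          simp [Entry.IsParam, Param]) (A.eval u)
      (by simp [hA, seqs, Prog.eval, Store.setReg]) (by simp [hA, seqs, Prog.eval, Store.setReg])
    have hA3 : (A.eval u).reg 3 = m n := by simp [hA, seqs, Prog.eval, Store.setReg, g5]
    rw [hA3] at f1 f3
    refine ⟨v, g1.seq (Runs.seq ⟨_, A.exec_eval (by simp [hA, seqs, Prog.Straight]) u, le_rfl⟩ f1),
      ?_, ?_⟩
    · rw [f2 0 (by simp [Param])]
      simp [hA, seqs, Prog.eval, Store.setReg, g2, g5, h2, prepCircuit]
    · rw [f3, Function.update_self, prepCircuit, List.flatMap_append, flatMap_code_map]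
      · congr 1
        · rw [eprGates, List.flatMap_assoc, ← flatMap_finRange]
          congr 1
          funext j
          simp [htm, hA, seqs, Prog.eval, Store.setReg, Entry.val, Gate.code, g2, g3, g4, g5, h2,
            lowWire, lastBlock, moreAnc, add_assoc]
          rfl
        · simp [hA, seqs, Prog.eval, Store.setReg, g6, h3]
      · intro i
        rfl
  choose s hs hs0 hs1 using hrun
  choose T hT hTB using hs
  refine ⟨?_, _, T, ?_, fun n => ⟨s n, hT n, hs0 n, hs1 n⟩⟩
  · refine (hsize.add ((polyBounded_const 3).mul polyBounded_id)).mono fun n => ?_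
    have := hm n
    simp only [Circuit.size, prepCircuit, List.length_append, eprGates, List.length_flatMap,
      List.length_cons, List.length_nil, List.map_const', List.sum_replicate, smul_eq_mul,
      List.length_map, List.length_finRange]
    omega
  · refine (htime.add ((polyBounded_const (c + A.cost + 19)).add
      ((polyBounded_const 19).mul polyBounded_id))).mono fun n => (hTB n).trans ?_
    have := hm n
    omega

theorem length_zeroTest (l n a s : ℕ) (hs : s ≤ n) :
    (zeroTest l n a s hs).length = 2 * s + 4 := by
  simp only [zeroTest, norGates, swapGates, List.length_cons, List.length_append,
    List.length_flatMap, List.length_nil, List.map_const', List.sum_replicate, smul_eq_mul,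
    List.length_finRange]
  omega

theorem length_dataSwap (l n a s : ℕ) : (dataSwap l n a s).length = 3 * n := by
  simp only [dataSwap, multiSwap, swapGates, List.length_cons, List.length_flatMap,
    List.length_nil, List.map_const', List.sum_replicate, smul_eq_mul, List.length_finRange]
  omega

/-- The template of the exchange of the data registers. -/
def swapTemplate : List Entry :=
  [.inl 5, .inr 2, .inr 5, .inl 0, .inl 5, .inr 5, .inr 2, .inl 0, .inl 5, .inr 2, .inr 5, .inl 0]

/-- The template of the first gate of the test. -/
def flipTemplate : List Entry := [.inl 1, .inr 7, .inl 0, .inl 0]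

/-- The template of the chain of Toffoli gates. -/
def norTemplate : List Entry := [.inl 1, .inr 2, .inl 0, .inl 0, .inl 6, .inr 2, .inr 7, .inr 8]

/-- The template of the last gates of the test. -/
def resultTemplate : List Entry :=
  [.inl 5, .inl 0, .inr 9, .inl 0, .inl 5, .inr 9, .inl 0, .inl 0, .inl 5, .inl 0, .inr 9, .inl 0]

/-- The program that computes the parameters of the verification circuit. -/
def verifySetup : Prog := seqs [.const 12 1, .const 13 0, .minus 4 1 3, .plus 5 2 1, .plus 5 5 0,
  .plus 7 5 1, .plus 7 7 12, .plus 8 7 12, .plus 9 7 4, .plus 0 0 1, .plus 0 0 4, .plus 0 0 12,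
  .plus 0 0 12]

theorem isParam_of_mem {v : Entry} (hv : v ∈ swapTemplate ∨ v ∈ flipTemplate ∨ v ∈ norTemplate ∨
    v ∈ resultTemplate) : v.IsParam := by
  rcases v with c | r
  · trivial
  · simp only [swapTemplate, flipTemplate, norTemplate, resultTemplate, List.mem_cons,
      List.not_mem_nil, reduceCtorEq, Sum.inr.injEq, false_or, or_false] at hv
    simp only [Entry.IsParam, Param]
    omega

/-- Expresses the emitted codes through the parameters of one fixed memory `s₀`, so that successive
phases can be concatenated. -/
theorem emitLoop_param (i N : ℕ) (t : List Entry) (ht : ∀ v ∈ t, v ∈ swapTemplate ∨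
    v ∈ flipTemplate ∨ v ∈ norTemplate ∨ v ∈ resultTemplate) (hN : Param N) (s₀ s : Store)
    (hk : s₀.Keeps s) (h12 : s₀.reg 12 = 1) (h13 : s₀.reg 13 = 0) :
    ∃ s', Runs (emitLoop i N t) s s' ((s₀.reg N + 1) * (2 * t.length + 3)) ∧ s₀.Keeps s' ∧
      s'.stk = Function.update s.stk i
        ((List.range (s₀.reg N)).flatMap (fun j => t.map (Entry.val s₀.reg j)) ++ s.stk i) := by
  obtain ⟨s', h1, h2, h3⟩ := emitLoop_runs i N t (fun v hv => isParam_of_mem (ht v hv)) s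
    ((hk 12 (by simp [Param])).trans h12) ((hk 13 (by simp [Param])).trans h13)
  rw [hk N hN] at h1 h3
  refine ⟨s', h1, hk.trans h2, h3.trans ?_⟩
  congr 3
  funext j
  refine List.map_congr_left fun v hv => ?_
  have := isParam_of_mem (ht v hv)
  rcases v with c | r
  · rfl
  · simp only [Entry.val, hk r this]

/-- The codes that a template produces. -/
def templateCode (reg : ℕ → ℕ) (N : ℕ) (t : List Entry) : List ℕ :=
  (List.range (reg N)).flatMap fun j => t.map (Entry.val reg j)

/-- The program that turns the codes of `G` on stack `0` into those of the verification circuit. -/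
def verifyProg : Prog :=
  .seq (.push 1 13) (.seq (moveGates 0 1 3)
    (.seq (.push 2 13) (.seq (moveGates 1 2 3) (.seq (emitLoop 0 12 resultTemplate)
    (.seq (emitLoop 0 4 norTemplate) (.seq (emitLoop 0 12 flipTemplate) (.seq (.push 1 13)
    (.seq (moveGates 2 1 0) (.seq (emitLoop 0 1 swapTemplate) (.seq (moveGates 1 0 3)
    (emitLoop 0 1 swapTemplate)))))))))))

/-- The circuit is written back to front. Two reversing moves park the codes of `L` on stack `2`,
leaving stack `0` empty for the test. Moving them to stack `1` then pushes the reversed inverse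
circuit on stack `0`, and moving them back restores `L` in its original order. Zeros pushed
beforehand mark the bottoms of the lists; stack `3` receives unwanted copies. -/
theorem verifyProg_runs {W : ℕ} (L : List (Gate W)) (u₀ : Store) (r12 : u₀.reg 12 = 1)
    (r13 : u₀.reg 13 = 0) (t0 : u₀.stk 0 = L.flatMap Gate.code) :
    ∃ s, Runs verifyProg u₀ s (500 * (u₀.reg 1 + u₀.reg 4 + L.length + 1)) ∧ u₀.Keeps s ∧
      s.stk 0 = templateCode u₀.reg 1 swapTemplate ++ (L.flatMap Gate.code ++
        (templateCode u₀.reg 1 swapTemplate ++ ((L.reverse.map Gate.inv).flatMap Gate.code ++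
        (templateCode u₀.reg 12 flipTemplate ++ (templateCode u₀.reg 4 norTemplate ++
          templateCode u₀.reg 12 resultTemplate))))) := by
  have p12 : Param 12 := by simp [Param]
  have p13 : Param 13 := by simp [Param]
  have p1 : Param 1 := by simp [Param]
  have p4 : Param 4 := by simp [Param]
  obtain ⟨u₁, hu₁⟩ : ∃ u, u = u₀.setStk 1 (u₀.reg 13 :: u₀.stk 1) := ⟨_, rfl⟩
  have e1 : Runs (.push 1 13) u₀ u₁ 1 := hu₁ ▸ ⟨1, .push 1 13 _, le_rfl⟩
  have k1 : u₀.Keeps u₁ := hu₁ ▸ fun _ _ => rfl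
  obtain ⟨u₂, e2, k2, s2⟩ := moveGates_runs 0 1 3 (by omega) (by omega) (by omega) L [] rfl u₁
    ((k1 12 p12).trans r12) (by simp [hu₁, Store.setStk, t0])
  replace k2 := k1.trans k2
  obtain ⟨u₃, hu₃⟩ : ∃ u, u = u₂.setStk 2 (u₂.reg 13 :: u₂.stk 2) := ⟨_, rfl⟩
  have e3 : Runs (.push 2 13) u₂ u₃ 1 := hu₃ ▸ ⟨1, .push 2 13 _, le_rfl⟩
  have k3 : u₀.Keeps u₃ := hu₃ ▸ k2
  obtain ⟨u₄, e4, k4, s4⟩ := moveGates_runs 1 2 3 (by omega) (by omega) (by omega) L.reverse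
    (0 :: u₀.stk 1) rfl u₃ ((k3 12 p12).trans r12)
    (by simp [hu₃, s2, Store.setStk, hu₁, r13])
  replace k4 := k3.trans k4
  obtain ⟨u₅, e5, k5, s5⟩ := emitLoop_param 0 12 resultTemplate (fun v hv => by simp [hv]) p12
    u₀ u₄ k4 r12 r13
  obtain ⟨u₆, e6, k6, s6⟩ := emitLoop_param 0 4 norTemplate (fun v hv => by simp [hv]) p4
    u₀ u₅ k5 r12 r13
  obtain ⟨u₇, e7, k7, s7⟩ := emitLoop_param 0 12 flipTemplate (fun v hv => by simp [hv]) p12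
    u₀ u₆ k6 r12 r13
  obtain ⟨u₈, hu₈⟩ : ∃ u, u = u₇.setStk 1 (u₇.reg 13 :: u₇.stk 1) := ⟨_, rfl⟩
  have e8 : Runs (.push 1 13) u₇ u₈ 1 := hu₈ ▸ ⟨1, .push 1 13 _, le_rfl⟩
  have k8 : u₀.Keeps u₈ := hu₈ ▸ k7
  have s42 : u₄.stk 2 = L.flatMap Gate.code ++ 0 :: u₂.stk 2 := by
    simp [s4, hu₃, Store.setStk, k2 13 p13, r13]
  have s72 : u₇.stk 2 = u₄.stk 2 := by simp [s7, s6, s5]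
  have s40 : u₄.stk 0 = [] := by simp [s4, hu₃, s2, Store.setStk]
  have s70 : u₇.stk 0 = templateCode u₀.reg 12 flipTemplate ++ (templateCode u₀.reg 4 norTemplate ++
      templateCode u₀.reg 12 resultTemplate) := by
    rw [s7, Function.update_self, s6, Function.update_self, s5, Function.update_self, s40,
      List.append_nil]
    rfl
  obtain ⟨u₉, e9, k9, s9⟩ := moveGates_runs 2 1 0 (by omega) (by omega) (by omega) L
    (0 :: u₂.stk 2) rfl u₈ ((k8 12 p12).trans r12) (by simp [hu₈, Store.setStk, s72, s42])
  replace k9 := k8.trans k9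
  have s90 : u₉.stk 0 = (L.reverse.map Gate.inv).flatMap Gate.code ++ u₇.stk 0 := by
    rw [s9, Function.update_self, hu₈]
    rfl
  have s91 : u₉.stk 1 = L.reverse.flatMap Gate.code ++ 0 :: u₇.stk 1 := by
    simp [s9, hu₈, Store.setStk, k7 13 p13, r13]
  obtain ⟨u₁₀, e10, k10, s10⟩ := emitLoop_param 0 1 swapTemplate (fun v hv => by simp [hv]) p1
    u₀ u₉ k9 r12 r13
  obtain ⟨u₁₁, e11, k11, s11⟩ := moveGates_runs 1 0 3 (by omega) (by omega) (by omega) L.reverse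
    (0 :: u₇.stk 1) rfl u₁₀ ((k10 12 p12).trans r12) (by simp [s10, s91])
  replace k11 := k10.trans k11
  have s110 : u₁₁.stk 0 = L.flatMap Gate.code ++ u₁₀.stk 0 := by simp [s11]
  obtain ⟨u₁₂, e12, k12, s12⟩ := emitLoop_param 0 1 swapTemplate (fun v hv => by simp [hv]) p1
    u₀ u₁₁ k11 r12 r13
  refine ⟨u₁₂, (e1.seq (e2.seq (e3.seq (e4.seq (e5.seq (e6.seq (e7.seq (e8.seq (e9.seq (e10.seq
    (e11.seq e12))))))))))).mono ?_, k12, ?_⟩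
  · simp only [r12, List.length_reverse]
    simp only [resultTemplate, norTemplate, flipTemplate, swapTemplate, List.length_cons,
      List.length_nil]
    omega
  · rw [s12, Function.update_self, s110, s10, Function.update_self, s90, s70]
    rfl

/-- Counter `5` holds the first wire of the second data register; counters `7`, `8` and `9` hold the
work wires `1`, `2` and `s + 1`. Templates governed by counter `12` are emitted exactly once, since
it holds `1`. -/
theorem verifyCircuit_code {l n : ℕ} (C : Circuit (l + n)) (s : ℕ) (hs : s ≤ n) (reg : ℕ → ℕ)
    (r1 : reg 1 = n) (r2 : reg 2 = l) (r4 : reg 4 = s) (r5 : reg 5 = l + n + C.anc)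
    (r7 : reg 7 = l + n + C.anc + n + 1) (r8 : reg 8 = l + n + C.anc + n + 2)
    (r9 : reg 9 = l + n + C.anc + n + 1 + s) (r12 : reg 12 = 1) :
    (verifyCircuit C s hs).gates.flatMap Gate.code =
      templateCode reg 1 swapTemplate ++ (C.gates.flatMap Gate.code ++
        (templateCode reg 1 swapTemplate ++ ((C.gates.reverse.map Gate.inv).flatMap Gate.code ++
        (templateCode reg 12 flipTemplate ++ (templateCode reg 4 norTemplate ++
          templateCode reg 12 resultTemplate))))) := by
  have hS : (dataSwap l n C.anc s).flatMap Gate.code = templateCode reg 1 swapTemplate := by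
    rw [dataSwap, multiSwap, List.flatMap_assoc, templateCode, r1, ← flatMap_finRange]
    congr 1
    funext j
    simp [swapTemplate, Entry.val, r2, r5, swapGates, Gate.code, VWires.data, VWires.copy,
      add_assoc]
  have hN : (norGates (fun j : Fin s => VWires.data l n C.anc s (Fin.castLE hs j))
      (fun j => VWires.work l n C.anc s j.succ) (fun _ _ => VWires.data_ne_work _ _)
      (VWires.work_injective.comp (Fin.succ_injective _))).flatMap Gate.code =
      templateCode reg 4 norTemplate := by
    rw [norGates, List.flatMap_assoc, templateCode, r4, ← flatMap_finRange]
    congr 1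
    funext j
    simp [norTemplate, Entry.val, r2, r7, r8, Gate.code, VWires.work, VWires.data]
    omega
  have hF : (Gate.x (VWires.work l n C.anc s 1)).code = templateCode reg 12 flipTemplate := by
    simp [templateCode, flipTemplate, Entry.val, r7, r12, Gate.code, VWires.work, add_assoc]
  have hR : (swapGates (VWires.first l n C.anc s) (VWires.work l n C.anc s (Fin.last s).succ)
      (VWires.first_ne_work _)).flatMap Gate.code = templateCode reg 12 resultTemplate := by
    simp [templateCode, resultTemplate, Entry.val, r9, r12, Gate.code, VWires.work, VWires.first,
      swapGates]
    omega
  simp only [verifyCircuit, List.flatMap_append, zeroTest, List.flatMap_cons]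
  rw [flatMap_code_map _ fun i => rfl, flatMap_code_map _ fun i => rfl, hS, hN, hF, hR]

theorem isQPT_verifyCircuit {lam m : ℕ → ℕ} {G : ∀ n, Circuit (lam n + n)}
    (hG : IsQPT (fun n => lam n + n) (fun n => [n, lam n]) G) :
    IsQPT (fun n => lam n + n) (fun n => [n, lam n, m n])
      fun n => verifyCircuit (G n) (n - m n) (Nat.sub_le n (m n)) := by
  obtain ⟨hsize, P, time, htime, hP⟩ := hG
  obtain ⟨P', c, hP'⟩ := exists_setup P
  have hrun : ∀ n, ∃ s, Runs (.seq P' (.seq verifySetup verifyProg))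
      (Store.init [n, lam n, m n]) s
      ((time n + c) + 1100 * (n + (G n).gates.length + 1)) ∧
      s.reg 0 = (verifyCircuit (G n) (n - m n) (Nat.sub_le n (m n))).anc ∧
      s.stk 0 =
        (verifyCircuit (G n) (n - m n) (Nat.sub_le n (m n))).gates.flatMap Gate.code := by
    intro n
    obtain ⟨s, h1, h2, h3⟩ := hP n
    obtain ⟨u, g1, g2, g3, g4, g5, g6⟩ := hP' n (lam n) (m n) s _ h1
    obtain ⟨u₀, hu₀⟩ : ∃ v, v = verifySetup.eval u := ⟨_, rfl⟩
    have e0 : Runs verifySetup u u₀ verifySetup.cost :=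
      hu₀ ▸ ⟨_, Prog.exec_eval _ (by simp [verifySetup, seqs, Prog.Straight]) u, le_rfl⟩
    have r0 : u₀.reg 0 = (G n).anc + (n + (n - m n + 2)) := by
      simp [hu₀, verifySetup, seqs, Prog.eval, Store.setReg, g2, g3, g5, h2]
      omega
    have r1 : u₀.reg 1 = n := by simp [hu₀, verifySetup, seqs, Prog.eval, Store.setReg, g3]
    have r2 : u₀.reg 2 = lam n := by simp [hu₀, verifySetup, seqs, Prog.eval, Store.setReg, g4]
    have r4 : u₀.reg 4 = n - m n := by
      simp [hu₀, verifySetup, seqs, Prog.eval, Store.setReg, g3, g5]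
    have r5 : u₀.reg 5 = lam n + n + (G n).anc := by
      simp [hu₀, verifySetup, seqs, Prog.eval, Store.setReg, g2, g3, g4, h2]
    have r7 : u₀.reg 7 = lam n + n + (G n).anc + n + 1 := by
      simp [hu₀, verifySetup, seqs, Prog.eval, Store.setReg, g2, g3, g4, h2]
    have r8 : u₀.reg 8 = lam n + n + (G n).anc + n + 2 := by
      simp [hu₀, verifySetup, seqs, Prog.eval, Store.setReg, g2, g3, g4, h2]
    have r9 : u₀.reg 9 = lam n + n + (G n).anc + n + 1 + (n - m n) := by
      simp [hu₀, verifySetup, seqs, Prog.eval, Store.setReg, g2, g3, g4, g5, h2]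
    have r12 : u₀.reg 12 = 1 := by simp [hu₀, verifySetup, seqs, Prog.eval, Store.setReg]
    have r13 : u₀.reg 13 = 0 := by simp [hu₀, verifySetup, seqs, Prog.eval, Store.setReg]
    have t0 : u₀.stk 0 = (G n).gates.flatMap Gate.code := by
      simp [hu₀, verifySetup, seqs, Prog.eval, Store.setReg, g6, h3]
    obtain ⟨v, f1, f2, f3⟩ := verifyProg_runs (G n).gates u₀ r12 r13 t0
    refine ⟨v, (g1.seq (e0.seq f1)).mono ?_, (f2 0 (by simp [Param])).trans r0, f3.trans
      (verifyCircuit_code (G n) _ (Nat.sub_le n (m n)) u₀.reg r1 r2 r4 r5 r7 r8 r9 r12).symm⟩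
    have : n - m n ≤ n := Nat.sub_le _ _
    rw [r1, r4]
    simp only [verifySetup, seqs, Prog.cost]
    omega
  choose s hs hs0 hs1 using hrun
  choose T hT hTB using hs
  refine ⟨?_, _, T, ?_, fun n => ⟨s n, hT n, hs0 n, hs1 n⟩⟩
  · refine ((((polyBounded_const 2).mul hsize).add ((polyBounded_const 10).mul
      polyBounded_id)).add (polyBounded_const 10)).mono fun n => ?_
    have : n - m n ≤ n := Nat.sub_le _ _
    simp only [Circuit.size, verifyCircuit, List.length_append, length_zeroTest, length_dataSwap,
      List.length_map, List.length_reverse]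
    omega
  · refine (htime.add ((polyBounded_const (c + 1100)).add
      (((polyBounded_const 1100).mul polyBounded_id).add
        ((polyBounded_const 1100).mul hsize)))).mono fun n => (hTB n).trans ?_
    simp only [Circuit.size]
    omega

end Uniform

end QCrypto

namespace QCrypto

/-! ### Invariance of Haar measure and fourth moments of a random state -/

section Haar

variable {n : ℕ}

instance instIsHaarMeasureHaarU (n : ℕ) : (haarU n).IsHaarMeasure := by
  unfold haarU; infer_instance

/-- A right translate of Haar measure is again a Haar probability measure, and such a measure is
unique. -/
instance instIsMulRightInvariantHaarU (n : ℕ) : (haarU n).IsMulRightInvariant := by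
  refine ⟨fun g => ?_⟩
  have h : ((haarU n).map (· * g)).IsHaarMeasure :=
    Measure.isHaarMeasure_map_mul_right _ g
  have : IsProbabilityMeasure ((haarU n).map (· * g)) :=
    Measure.isProbabilityMeasure_map (measurable_mul_const g).aemeasurable
  exact Measure.isHaarMeasure_eq_of_isProbabilityMeasure _ _

theorem integrable_haarU {E : Type*} [NormedAddCommGroup E] {f : UGroup n → E}
    (hf : Continuous f) : Integrable f (haarU n) :=
  hf.integrable_of_hasCompactSupport (HasCompactSupport.of_compactSpace f)

theorem UGroup.conjTranspose_mul (V : UGroup n) : (V : QMat n)ᴴ * (V : QMat n) = 1 :=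
  Matrix.mem_unitaryGroup_iff'.mp V.2

/-- The unitary that permutes the computational basis. -/
def permU (π : Equiv.Perm (Bits n)) : UGroup n :=
  ⟨Matrix.of fun a b => if a = π b then 1 else 0, by
    rw [Matrix.mem_unitaryGroup_iff']
    ext a b
    simp [Matrix.mul_apply, Matrix.one_apply, Matrix.star_eq_conjTranspose, eq_comm]⟩

theorem permU_apply (π : Equiv.Perm (Bits n)) (a b : Bits n) :
    (permU π : QMat n) a b = if a = π b then 1 else 0 := rfl

theorem permU_mul_apply (π : Equiv.Perm (Bits n)) (A : QMat n) (a b : Bits n) :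
    ((permU π : QMat n) * A) a b = A (π.symm a) b := by
  simp [Matrix.mul_apply, permU_apply, ← Equiv.symm_apply_eq]

theorem permU_conj_apply (π : Equiv.Perm (Bits n)) (A : QMat n) (a b : Bits n) :
    ((permU π : QMat n) * A * (permU π : QMat n)ᴴ) a b = A (π.symm a) (π.symm b) := by
  rw [← Matrix.conjTranspose_conjTranspose A, Matrix.mul_assoc, ← Matrix.conjTranspose_mul,
    permU_mul_apply, Matrix.conjTranspose_apply, permU_mul_apply, Matrix.conjTranspose_apply,
    star_star, Matrix.conjTranspose_conjTranspose]

/-- The diagonal unitary that changes the sign of one basis vector. -/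
def signU (i : Bits n) : UGroup n :=
  ⟨Matrix.diagonal fun a => if a = i then -1 else 1, by
    rw [Matrix.mem_unitaryGroup_iff', Matrix.star_eq_conjTranspose, Matrix.diagonal_conjTranspose,
      Matrix.diagonal_mul_diagonal]
    ext a b
    by_cases h : a = i <;> simp [Matrix.diagonal_apply, Matrix.one_apply, h]⟩

theorem signU_mul_apply (i : Bits n) (A : QMat n) (a b : Bits n) :
    ((signU i : QMat n) * A) a b = (if a = i then -1 else 1) * A a b := by
  simp [signU, Matrix.diagonal_mul]

/-- A gate as an element of the unitary group. -/
noncomputable def Gate.toU (g : Gate n) : UGroup n :=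
  ⟨g.mat, Matrix.mem_unitaryGroup_iff'.mpr g.conjTranspose_mul_mat⟩

/-! ### Moments of the first column of a Haar random unitary -/

/-- The amplitude of the basis state `i` in the state `V |0…0⟩`. -/
def amp (V : UGroup n) (i : Bits n) : ℂ := (V : QMat n) i fun _ => false

theorem continuous_amp (i : Bits n) : Continuous fun V : UGroup n => amp V i :=
  continuous_subtype_val.matrix_elem _ _

theorem sum_norm_amp (V : UGroup n) : ∑ i, ‖amp V i‖ ^ 2 = 1 := by
  have h := congrFun (congrFun (V.conjTranspose_mul) fun _ => false) fun _ => false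
  rw [Matrix.mul_apply, Matrix.one_apply_eq] at h
  have h2 : ((∑ i, ‖amp V i‖ ^ 2 : ℝ) : ℂ) = 1 := by
    rw [← h]; push_cast
    refine Finset.sum_congr rfl fun i _ => ?_
    rw [Matrix.conjTranspose_apply, ← Complex.conj_mul']; rfl
  exact_mod_cast h2

theorem amp_permU (π : Equiv.Perm (Bits n)) (V : UGroup n) (i : Bits n) :
    amp (permU π * V) i = amp V (π.symm i) := permU_mul_apply π _ i _

theorem amp_signU (j : Bits n) (V : UGroup n) (i : Bits n) :
    amp (signU j * V) i = (if i = j then -1 else 1) * amp V i := signU_mul_apply j _ i _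

/-- The mixed moment `E |ψ_i|² |ψ_j|²` of a Haar random state. -/
noncomputable def moment (i j : Bits n) : ℝ :=
  ∫ V : UGroup n, ‖amp V i‖ ^ 2 * ‖amp V j‖ ^ 2 ∂(haarU n)

theorem integrable_moment (i j : Bits n) :
    Integrable (fun V : UGroup n => ‖amp V i‖ ^ 2 * ‖amp V j‖ ^ 2) (haarU n) :=
  integrable_haarU (((continuous_amp i).norm.pow 2).mul ((continuous_amp j).norm.pow 2))

theorem moment_comm (i j : Bits n) : moment i j = moment j i := by
  simp only [moment, mul_comm]

theorem moment_nonneg (i j : Bits n) : 0 ≤ moment i j :=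
  integral_nonneg fun _ => by positivity

theorem moment_perm (π : Equiv.Perm (Bits n)) (i j : Bits n) :
    moment (π i) (π j) = moment i j := by
  unfold moment
  rw [← integral_mul_left_eq_self _ (permU π)]
  simp [amp_permU]

theorem moment_self_eq (i j : Bits n) : moment i i = moment j j := by
  simpa using (moment_perm (Equiv.swap i j) i i).symm

theorem moment_eq_of_ne {i j i' : Bits n} (h : i ≠ j) (h' : i' ≠ j) : moment i j = moment i' j := by
  have := moment_perm (Equiv.swap i i') i j
  rwa [Equiv.swap_apply_left, Equiv.swap_apply_of_ne_of_ne h.symm h'.symm, eq_comm] at this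

/-- Basis permutations are unitary, so all mixed moments with distinct indices agree: one index is
changed at a time, with symmetry when an index would collide. -/
theorem moment_eq {i j i' j' : Bits n} (h : i ≠ j) (h' : i' ≠ j') : moment i j = moment i' j' := by
  by_cases hj : i' = j
  · subst hj
    rw [moment_eq_of_ne h h'.symm, moment_comm]
  · rw [moment_eq_of_ne h hj, moment_comm, moment_eq_of_ne (Ne.symm hj) h'.symm, moment_comm]

theorem sum_moment : ∑ i : Bits n, ∑ j : Bits n, moment i j = 1 := by
  unfold moment
  simp_rw [← integral_finsetSum _ fun j _ => integrable_moment _ j]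
  rw [← integral_finsetSum _ fun i _ => integrable_finsetSum _ fun j _ => integrable_moment i j]
  simp_rw [← Finset.mul_sum, ← Finset.sum_mul, sum_norm_amp]
  simp

/-- The amplitudes have total weight `1`, so all moments sum to `1`; the `2^n (2^n - 1)`
off-diagonal ones are equal and the rest are nonnegative. -/
theorem moment_le {i j : Bits n} (h : i ≠ j) : (2 : ℝ) ^ n * ((2 : ℝ) ^ n - 1) * moment i j ≤ 1 := by
  have key : ∑ a : Bits n, ∑ b ∈ Finset.univ.erase a, moment a b ≤ 1 := by
    rw [← sum_moment (n := n)]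
    exact Finset.sum_le_sum fun a _ => Finset.sum_le_sum_of_subset_of_nonneg
      (Finset.erase_subset _ _) fun _ _ _ => moment_nonneg _ _
  refine le_of_eq_of_le ?_ key
  have : ∀ a : Bits n, ∑ b ∈ Finset.univ.erase a, moment a b = ((2 : ℝ) ^ n - 1) * moment i j := by
    intro a
    rw [Finset.sum_congr rfl fun b hb => moment_eq (Finset.ne_of_mem_erase hb).symm h,
      Finset.sum_const, Finset.card_erase_of_mem (Finset.mem_univ _), nsmul_eq_mul]
    simp [Nat.cast_sub Nat.one_le_two_pow]
  simp_rw [this]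
  simp [mul_assoc]

/-- The left side is `2 (|u|² + |v|²)² + 8 (Re u v̄)²`, and `(Re u v̄)² ≤ |u|² |v|²`. -/
theorem norm_add_sub_pow_four (u v : ℂ) :
    ‖u + v‖ ^ 4 + ‖u - v‖ ^ 4 ≤
      2 * (‖u‖ ^ 2 * ‖u‖ ^ 2) + 2 * (‖v‖ ^ 2 * ‖v‖ ^ 2) + 12 * (‖u‖ ^ 2 * ‖v‖ ^ 2) := by
  have h : ∀ z : ℂ, ‖z‖ ^ 2 = z.re ^ 2 + z.im ^ 2 := fun z => by
    rw [Complex.sq_norm, Complex.normSq_apply, sq, sq]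
  have e : ∀ z : ℂ, ‖z‖ ^ 4 = (z.re ^ 2 + z.im ^ 2) ^ 2 := fun z => by
    rw [← h, ← pow_mul]
  simp only [e, h, Complex.add_re, Complex.add_im, Complex.sub_re, Complex.sub_im]
  nlinarith [sq_nonneg (u.re * v.im - u.im * v.re)]

/-- A Hadamard gate sends two amplitudes `u, v` to `(u ± v)/√2` and preserves Haar measure. With `M`
the diagonal and `c` the mixed moment, this gives `2M ≤ M + 3c`. -/
theorem moment_self_le {i j : Bits n} (h : i ≠ j) : moment i i ≤ 3 * moment i j := by
  obtain ⟨l, -⟩ := Function.ne_iff.mp h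
  set f : Bits n := fun _ => false with hf
  set g : Bits n := Function.update f l true with hg
  have hfg : f ≠ g := fun e => by simpa [hf, hg] using congrFun e l
  rw [moment_self_eq i f, moment_eq h hfg]
  have had : ∀ (V : UGroup n) (c : Bits n), amp ((Gate.had l).toU * V) c =
      ∑ b, (Gate.had l).mat c b * amp V b := fun V c => Matrix.mul_apply
  have key : ∀ (V : UGroup n) (c : Bits n), (∀ q, q ≠ l → c q = false) →
      amp ((Gate.had l).toU * V) c = ((Real.sqrt 2 : ℝ) : ℂ)⁻¹ *
        (amp V f + (if c l = true then -1 else 1) * amp V g) := by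
    intro V c hc
    rw [had, ← Finset.sum_subset (Finset.subset_univ {f, g}), Finset.sum_pair hfg]
    · have h1 : ∀ q, q ≠ l → c q = f q := fun q hq => by simp [hc q hq, hf]
      have h2 : ∀ q, q ≠ l → c q = g q := fun q hq => by simp [hc q hq, hf, hg, hq]
      simp only [Gate.mat, if_pos h1, if_pos h2]
      cases c l <;> simp [hf, hg] <;> ring
    · intro b _ hb
      simp only [Finset.mem_insert, Finset.mem_singleton, not_or] at hb
      refine mul_eq_zero_of_left (if_neg fun hcb => ?_) _
      have hb' : ∀ q, q ≠ l → b q = false := fun q hq => by rw [← hcb q hq, hc q hq]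
      cases hbl : b l
      · exact hb.1 (funext fun q => by by_cases hq : q = l <;> simp_all)
      · exact hb.2 (funext fun q => by by_cases hq : q = l <;> simp_all)
  have hs : ‖((Real.sqrt 2 : ℝ) : ℂ)⁻¹‖ ^ 4 = 1 / 4 := by
    rw [norm_inv, Complex.norm_real, Real.norm_of_nonneg (Real.sqrt_nonneg _), inv_pow,
      show (4 : ℕ) = 2 * 2 from rfl, pow_mul, Real.sq_sqrt (by norm_num)]
    norm_num
  have pt : ∀ V : UGroup n,
      ‖amp ((Gate.had l).toU * V) f‖ ^ 2 * ‖amp ((Gate.had l).toU * V) f‖ ^ 2 +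
        ‖amp ((Gate.had l).toU * V) g‖ ^ 2 * ‖amp ((Gate.had l).toU * V) g‖ ^ 2 ≤
      (1 / 2) * (‖amp V f‖ ^ 2 * ‖amp V f‖ ^ 2) + (1 / 2) * (‖amp V g‖ ^ 2 * ‖amp V g‖ ^ 2) +
        3 * (‖amp V f‖ ^ 2 * ‖amp V g‖ ^ 2) := by
    intro V
    have e1 := key V f fun _ _ => rfl
    have e2 := key V g fun q hq => by simp [hg, hf, hq]
    rw [e1, e2]
    have := norm_add_sub_pow_four (amp V f) (amp V g)
    rw [← pow_add, ← pow_add, norm_mul, norm_mul, mul_pow, mul_pow, hs]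
    simp only [hf, hg, Function.update_self, if_true, one_mul, neg_mul, ← sub_eq_add_neg,
      Bool.false_eq_true, if_false]
    simp only [hf, hg] at this
    linarith
  have hint := integral_mono
    (f := fun V => ‖amp ((Gate.had l).toU * V) f‖ ^ 2 * ‖amp ((Gate.had l).toU * V) f‖ ^ 2 +
        ‖amp ((Gate.had l).toU * V) g‖ ^ 2 * ‖amp ((Gate.had l).toU * V) g‖ ^ 2)
    (((integrable_moment f f).comp_mul_left _).add ((integrable_moment g g).comp_mul_left _))
    ((((integrable_moment f f).const_mul _).add ((integrable_moment g g).const_mul _)).add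
      ((integrable_moment f g).const_mul _)) pt
  rw [integral_add ((integrable_moment f f).comp_mul_left _)
    ((integrable_moment g g).comp_mul_left _)] at hint
  rw [integral_mul_left_eq_self (fun V => ‖amp V f‖ ^ 2 * ‖amp V f‖ ^ 2),
    integral_mul_left_eq_self (fun V => ‖amp V g‖ ^ 2 * ‖amp V g‖ ^ 2)] at hint
  rw [integral_add' (((integrable_moment f f).const_mul _).add
      ((integrable_moment g g).const_mul _)) ((integrable_moment f g).const_mul _),
    integral_add' ((integrable_moment f f).const_mul _) ((integrable_moment g g).const_mul _),
    integral_const_mul, integral_const_mul, integral_const_mul] at hint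
  have hint' : moment f f + moment g g ≤
      (1 / 2) * moment f f + (1 / 2) * moment g g + 3 * moment f g := hint
  linarith [moment_self_eq g f]

/-- Fourth moments with an index that occurs only once vanish. -/
theorem integral_amp_eq_zero {i j k l : Bits n} (hj : i ≠ j) (hk : i ≠ k) (hl : i ≠ l) :
    ∫ V : UGroup n, amp V i * star (amp V j) * (star (amp V k) * amp V l) ∂(haarU n) = 0 := by
  have h := integral_mul_left_eq_self
    (fun V : UGroup n => amp V i * star (amp V j) * (star (amp V k) * amp V l)) (μ := haarU n)
    (signU i)
  simp only [amp_signU, if_true, if_neg hj.symm, if_neg hk.symm, if_neg hl.symm, one_mul, neg_mul,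
    integral_neg] at h
  exact self_eq_neg.mp h.symm

end Haar

end QCrypto

namespace QCrypto

/-! ### The mean purity of a reduced Haar state -/

section Purity

variable {n m : ℕ}

theorem reducedState_apply (V : UGroup (n + m)) (x y : Bits n) :
    reducedState n m V x y =
      ∑ z : Bits m, amp V (Fin.append x z) * star (amp V (Fin.append y z)) :=
  Finset.sum_congr rfl fun _ _ => mul_single_mul_apply _ _ _ _ _

theorem append_inj {x y : Bits n} {z w : Bits m} :
    Fin.append x z = Fin.append y w ↔ x = y ∧ z = w := by
  refine ⟨fun h => ⟨funext fun i => ?_, funext fun i => ?_⟩, fun h => by rw [h.1, h.2]⟩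
  · simpa using congrFun h (Fin.castAdd m i)
  · simpa using congrFun h (Fin.natAdd n i)

/-- These are the terms of `E |ρ x y|²`. Unless `x = y` or `z = w`, the index `(x, z)` occurs only
once and the integral vanishes. With one equality the integral is a mixed moment, with both a
diagonal moment, at most three mixed ones. -/
theorem re_integral_amp_le {i j : Bits (n + m)} (hij : i ≠ j) (x y : Bits n) (z w : Bits m) :
    (∫ V : UGroup (n + m), amp V (Fin.append x z) * star (amp V (Fin.append y z)) *
        (star (amp V (Fin.append x w)) * amp V (Fin.append y w)) ∂(haarU (n + m))).re ≤
      moment i j * ((if x = y then 1 else 0) + (if z = w then 1 else 0) +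
        (if x = y then if z = w then 1 else 0 else 0)) := by
  have hsq : ∀ u v : ℂ, u * star u * (star v * v) = ((‖u‖ ^ 2 * ‖v‖ ^ 2 : ℝ) : ℂ) := by
    intro u v
    have h1 : u * star u = ((‖u‖ ^ 2 : ℝ) : ℂ) := by
      rw [Complex.ofReal_pow]; exact Complex.mul_conj' u
    have h2 : star v * v = ((‖v‖ ^ 2 : ℝ) : ℂ) := by
      rw [Complex.ofReal_pow]; exact Complex.conj_mul' v
    rw [h1, h2, Complex.ofReal_mul]
  by_cases hxy : x = y
  · subst hxy
    simp_rw [hsq, integral_complex_ofReal, Complex.ofReal_re, if_true]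
    by_cases hzw : z = w
    · subst hzw
      have : moment (Fin.append x z) (Fin.append x z) ≤ 3 * moment i j := by
        rw [moment_self_eq _ i]; exact moment_self_le hij
      simp only [if_true]
      calc _ ≤ 3 * moment i j := this
        _ = _ := by ring
    · simp only [if_neg hzw, add_zero, mul_one]
      exact (moment_eq (fun h => hzw (append_inj.mp h).2) hij).le
  · by_cases hzw : z = w
    · subst hzw
      have : ∀ V : UGroup (n + m), amp V (Fin.append x z) * star (amp V (Fin.append y z)) *
          (star (amp V (Fin.append x z)) * amp V (Fin.append y z)) =
          ((‖amp V (Fin.append x z)‖ ^ 2 * ‖amp V (Fin.append y z)‖ ^ 2 : ℝ) : ℂ) := fun V => by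
        rw [← hsq]; ring
      simp_rw [this, integral_complex_ofReal, Complex.ofReal_re]
      simp only [if_neg hxy, if_true, add_zero, zero_add, mul_one]
      exact (moment_eq (fun h => hxy (append_inj.mp h).1) hij).le
    · rw [integral_amp_eq_zero (fun h => hxy (append_inj.mp h).1)
        (fun h => hzw (append_inj.mp h).2) (fun h => hxy (append_inj.mp h).1)]
      simp [hxy, hzw]

/-- The purity `tr ρ²` of a Hermitian matrix. -/
noncomputable def purity (ρ : QMat n) : ℝ := ∑ x, ∑ y, ‖ρ x y‖ ^ 2

theorem continuous_purity : Continuous (purity : QMat n → ℝ) := by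
  unfold purity
  exact continuous_finsetSum _ fun x _ => continuous_finsetSum _ fun y _ =>
    ((continuous_id.matrix_elem x y).norm.pow 2)

/-- Purity is expanded into products of four amplitudes; the bound counts the index quadruples with
`x = y`, with `z = w`, and with both. -/
theorem integral_purity_le_moment {i j : Bits (n + m)} (hij : i ≠ j) :
    ∫ V, purity (reducedState n m V) ∂(haarU (n + m)) ≤
      moment i j * ((2 : ℝ) ^ n * 2 ^ m * (2 ^ m + 2 ^ n + 1)) := by
  have hc : ∀ (x y : Bits n) (z w : Bits m), Continuous fun V : UGroup (n + m) =>
      amp V (Fin.append x z) * star (amp V (Fin.append y z)) *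
        (star (amp V (Fin.append x w)) * amp V (Fin.append y w)) := fun x y z w =>
    ((continuous_amp _).mul (continuous_amp _).star).mul
      ((continuous_amp _).star.mul (continuous_amp _))
  have h1 : ∀ V : UGroup (n + m), purity (reducedState n m V) = (∑ x, ∑ y, ∑ z, ∑ w,
      amp V (Fin.append x z) * star (amp V (Fin.append y z)) *
        (star (amp V (Fin.append x w)) * amp V (Fin.append y w))).re := by
    intro V
    unfold purity
    rw [Complex.re_sum]
    refine Finset.sum_congr rfl fun x _ => ?_
    rw [Complex.re_sum]
    refine Finset.sum_congr rfl fun y _ => ?_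
    have : ((‖reducedState n m V x y‖ ^ 2 : ℝ) : ℂ) =
        reducedState n m V x y * star (reducedState n m V x y) := by
      rw [Complex.ofReal_pow]; exact (Complex.mul_conj' _).symm
    rw [← Complex.ofReal_re (_ ^ 2), this, reducedState_apply, star_sum, Finset.sum_mul_sum]
    simp only [star_mul', star_star]
  simp_rw [h1]
  have h2 := integral_re (μ := haarU (n + m)) (𝕜 := ℂ) (integrable_haarU
    (continuous_finsetSum Finset.univ fun x _ => continuous_finsetSum Finset.univ fun y _ =>
      continuous_finsetSum Finset.univ fun z _ => continuous_finsetSum Finset.univ fun w _ =>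
        hc x y z w))
  simp only [RCLike.re_eq_complex_re] at h2
  rw [h2, integral_finsetSum _ fun x _ => integrable_haarU (by fun_prop (disch := assumption)), Complex.re_sum]
  calc _ ≤ ∑ x : Bits n, ∑ y : Bits n, ∑ z : Bits m, ∑ w : Bits m,
      moment i j * ((if x = y then 1 else 0) + (if z = w then 1 else 0) +
        (if x = y then if z = w then 1 else 0 else 0)) := by
        refine Finset.sum_le_sum fun x _ => ?_
        rw [integral_finsetSum _ fun y _ => integrable_haarU (continuous_finsetSum Finset.univ
          fun z _ => continuous_finsetSum Finset.univ fun w _ => hc x y z w), Complex.re_sum]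
        refine Finset.sum_le_sum fun y _ => ?_
        rw [integral_finsetSum _ fun z _ => integrable_haarU (
          continuous_finsetSum Finset.univ fun w _ => hc x y z w), Complex.re_sum]
        refine Finset.sum_le_sum fun z _ => ?_
        rw [integral_finsetSum _ fun w _ => integrable_haarU (hc x y z w), Complex.re_sum]
        exact Finset.sum_le_sum fun w _ => re_integral_amp_le hij x y z w
    _ = _ := by
        simp only [← Finset.mul_sum, Finset.sum_add_distrib, Finset.sum_const, Finset.card_univ,
          Finset.sum_ite_eq, Finset.mem_univ, if_true, nsmul_eq_mul, mul_ite, mul_one,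
          mul_zero, Finset.sum_ite_irrel]
        simp
        left
        ring

/-- A Haar random reduced state is almost maximally mixed on a `2 ^ m`-dimensional space. -/
theorem integral_purity_le (hn : 1 ≤ n) :
    (2 : ℝ) ^ m * ∫ V, purity (reducedState n m V) ∂(haarU (n + m)) ≤
      1 + 6 * ((2 : ℝ) ^ m / 2 ^ n) := by
  have hij : (fun _ => false : Bits (n + m)) ≠ fun _ => true := fun h => by
    simpa using congrFun h ⟨0, by omega⟩
  have h1 := integral_purity_le_moment hij
  have h2 := moment_le hij
  set a := moment (fun _ => false : Bits (n + m)) fun _ => true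
  rw [pow_add] at h2
  have hx : (1 : ℝ) ≤ 2 ^ m := one_le_pow₀ (by norm_num)
  have hy : (2 : ℝ) ≤ 2 ^ n := by simpa using pow_le_pow_right₀ (by norm_num : (1 : ℝ) ≤ 2) hn
  generalize (2 : ℝ) ^ m = x at *
  generalize (2 : ℝ) ^ n = y at *
  have hD : 0 < y * x - 1 := by nlinarith
  have h3 : a * (y * x * (x + y + 1)) ≤ (x + y + 1) / (y * x - 1) := by
    rw [le_div_iff₀ hD]
    calc _ = (y * x * (y * x - 1) * a) * (x + y + 1) := by ring
      _ ≤ 1 * (x + y + 1) := by gcongr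
      _ = _ := one_mul _
  calc _ ≤ x * ((x + y + 1) / (y * x - 1)) := by gcongr; exact h1.trans h3
    -- With `x = 2^m ≥ 1` and `y = 2^n ≥ 2`, clearing the denominator and using `6x/y ≤ 3x` leaves
    -- `5x² - 4x - 1 ≥ 0`.
    _ ≤ _ := by
      rw [← mul_div_assoc, div_le_iff₀ hD]
      have : (1 + 6 * (x / y)) * (y * x - 1) = y * x - 1 + 6 * (x * x) - 6 * (x / y) := by
        field_simp
        ring
      rw [this]
      have : x / y ≤ x / 2 := by gcongr
      nlinarith

end Purity

end QCrypto

namespace QCrypto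

/-! ### Spectra of reduced states -/

section Alignment

variable {n m : ℕ}

/-- The basis states in the support of `lowState n m`. -/
def lowSet (n m : ℕ) : Finset (Bits n) :=
  Finset.univ.filter fun x => ∀ i : Fin n, (i : ℕ) < n - m → x i = false

theorem mem_lowSet {x : Bits n} :
    x ∈ lowSet n m ↔ ∀ i : Fin n, (i : ℕ) < n - m → x i = false := by
  simp [lowSet]

theorem card_lowSet (h : m ≤ n) : (lowSet n m).card = 2 ^ m := by
  have : lowSet n m =
      Fintype.piFinset fun i : Fin n => if (i : ℕ) < n - m then {false} else Finset.univ := by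
    ext x
    simp only [mem_lowSet, Fintype.mem_piFinset]
    exact forall_congr' fun i => by split_ifs with hi <;> simp [hi]
  rw [this, Fintype.card_piFinset]
  simp only [apply_ite Finset.card, Finset.card_singleton, Finset.card_univ, Fintype.card_bool]
  rw [Finset.prod_ite, Finset.prod_const_one, one_mul, Finset.prod_const, Finset.filter_not,
    Finset.card_sdiff_of_subset (Finset.filter_subset _ _), Fin.card_filter_val_lt,
    Finset.card_univ, Fintype.card_fin]
  congr 1
  omega

/-- The uniform distribution on `lowSet n m`. -/
noncomputable def lowDist (n m : ℕ) (x : Bits n) : ℝ := if x ∈ lowSet n m then ((2 : ℝ) ^ m)⁻¹ else 0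

theorem lowDist_nonneg (x : Bits n) : 0 ≤ lowDist n m x := by
  unfold lowDist; split_ifs <;> positivity

theorem sum_lowDist (h : m ≤ n) : ∑ x, lowDist n m x = 1 := by
  simp [lowDist, Finset.sum_ite_mem, card_lowSet h]

theorem lowState_eq_diagonal :
    lowState n m = Matrix.diagonal fun x => ((lowDist n m x : ℝ) : ℂ) := by
  unfold lowState
  congr 1
  funext x
  simp only [lowDist, mem_lowSet]
  split_ifs <;> simp

theorem purity_eq_trace (ρ : QMat n) : ((purity ρ : ℝ) : ℂ) = (ρ * ρᴴ).trace := by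
  simp only [purity, Matrix.trace, Matrix.diag, Matrix.mul_apply, Matrix.conjTranspose_apply]
  push_cast
  exact Finset.sum_congr rfl fun x _ => Finset.sum_congr rfl fun y _ => (Complex.mul_conj' _).symm

theorem reducedState_eq_mul (V : UGroup (n + m)) :
    reducedState n m V = (Matrix.of fun x z => amp V (Fin.append x z) : Matrix (Bits n) (Bits m) ℂ) *
      (Matrix.of fun x z => amp V (Fin.append x z) : Matrix (Bits n) (Bits m) ℂ)ᴴ := by
  ext x y
  rw [reducedState_apply, Matrix.mul_apply]
  rfl

theorem trace_reducedState (V : UGroup (n + m)) : (reducedState n m V).trace = 1 := by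
  rw [Matrix.trace, ← Complex.ofReal_one, ← sum_norm_amp V, sum_append]
  push_cast
  refine Finset.sum_congr rfl fun x _ => ?_
  rw [Matrix.diag, reducedState_apply]
  exact Finset.sum_congr rfl fun z _ => Complex.mul_conj' _

/-- A reduced state is diagonal in some basis, with its support in `lowSet n m`. -/
theorem exists_diagonal_reducedState (hm : m ≤ n) (V : UGroup (n + m)) :
    ∃ (W : UGroup n) (p : Bits n → ℝ), (∀ x, 0 ≤ p x) ∧ ∑ x, p x = 1 ∧
      (∀ x, x ∉ lowSet n m → p x = 0) ∧ ∑ x, p x ^ 2 = purity (reducedState n m V) ∧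
      reducedState n m V =
        (W : QMat n) * Matrix.diagonal (fun x => ((p x : ℝ) : ℂ)) * (W : QMat n)ᴴ := by
  set ρ := reducedState n m V with hρ
  have hpsd : ρ.PosSemidef := by
    rw [hρ, reducedState_eq_mul]; exact Matrix.posSemidef_self_mul_conjTranspose _
  have hH := hpsd.isHermitian
  -- The state is a product through the space of `m` qubits, so its rank is at most `2^m`, the size
  -- of `lowSet n m`.
  have hrank : Fintype.card {x // hH.eigenvalues x ≠ 0} ≤ (lowSet n m).card := by
    rw [← hH.rank_eq_card_non_zero_eigs, card_lowSet hm, hρ, reducedState_eq_mul]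
    refine (Matrix.rank_mul_le_left _ _).trans ((Matrix.rank_le_card_width _).trans ?_)
    simp
  obtain ⟨f⟩ : Nonempty ({x // hH.eigenvalues x ≠ 0} ↪ lowSet n m) :=
    Function.Embedding.nonempty_of_card_le (by simpa using hrank)
  have hf : Function.Injective fun x => (f x : Bits n) := Subtype.val_injective.comp f.injective
  let e : {x // hH.eigenvalues x ≠ 0} ≃ {x // x ∈ Set.range fun x => (f x : Bits n)} :=
    Equiv.ofInjective _ hf
  -- Extends the placement of the nonzero eigenvalues inside `lowSet n m` to a permutation of the
  -- whole basis, which then relabels the eigenvectors.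
  let π : Equiv.Perm (Bits n) := e.extendSubtype
  have hπ : ∀ x, hH.eigenvalues x ≠ 0 → π x ∈ lowSet n m := fun x hx => by
    obtain ⟨y, hy⟩ := e.extendSubtype_mem x hx
    change e.extendSubtype x ∈ _
    rw [← hy]
    exact (f y).2
  have hspec : ρ = ((hH.eigenvectorUnitary * permU π.symm : UGroup n) : QMat n) *
      Matrix.diagonal (fun x => ((hH.eigenvalues (π.symm x) : ℝ) : ℂ)) *
        ((hH.eigenvectorUnitary * permU π.symm : UGroup n) : QMat n)ᴴ := by
    conv_lhs => rw [hH.spectral_theorem, Unitary.conjStarAlgAut_apply]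
    have hd : (permU π.symm : QMat n) *
        Matrix.diagonal (fun x => ((hH.eigenvalues (π.symm x) : ℝ) : ℂ)) * (permU π.symm : QMat n)ᴴ =
        Matrix.diagonal (RCLike.ofReal ∘ hH.eigenvalues) := by
      ext a b
      rw [permU_conj_apply]
      simp [Matrix.diagonal_apply]
    rw [← hd, Matrix.star_eq_conjTranspose, Submonoid.coe_mul, Matrix.conjTranspose_mul]
    simp only [Matrix.mul_assoc]
  set W : UGroup n := hH.eigenvectorUnitary * permU π.symm
  set p : Bits n → ℝ := fun x => hH.eigenvalues (π.symm x) with hp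
  refine ⟨W, p, fun x => hpsd.eigenvalues_nonneg _, ?_, fun x hx => ?_, ?_, hspec⟩
  · have h := trace_reducedState V
    rw [← hρ, hspec, Matrix.trace_mul_cycle, W.conjTranspose_mul, Matrix.one_mul,
      Matrix.trace_diagonal] at h
    exact_mod_cast h
  · by_contra hne
    have := hπ _ hne
    rw [Equiv.apply_symm_apply] at this
    exact hx this
  · have h := purity_eq_trace ρ
    rw [hH.eq] at h
    have h2 : ρ * ρ = (W : QMat n) * (Matrix.diagonal (fun x => ((p x : ℝ) : ℂ)) *
        Matrix.diagonal (fun x => ((p x : ℝ) : ℂ))) * (W : QMat n)ᴴ := by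
      conv_lhs => rw [hspec]
      simp only [Matrix.mul_assoc]
      rw [← Matrix.mul_assoc _ᴴ, W.conjTranspose_mul, Matrix.one_mul]
    rw [h2, Matrix.trace_mul_cycle, W.conjTranspose_mul, Matrix.one_mul,
      Matrix.diagonal_mul_diagonal, Matrix.trace_diagonal] at h
    simp only [sq]
    exact_mod_cast h.symm

end Alignment

/-! ### Distances between product distributions and from the flat distribution -/

section Product

variable {α : Type*} [Fintype α]

/-- Hybrid argument: one factor is exchanged at a time, and the remaining factors have total mass
`1`. -/
theorem sum_abs_prod_sub_le (t : ℕ) {p q : α → ℝ} (hp : ∀ x, 0 ≤ p x) (hq : ∀ x, 0 ≤ q x)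
    (hp1 : ∑ x, p x = 1) (hq1 : ∑ x, q x = 1) :
    ∑ x : Fin t → α, |∏ i, p (x i) - ∏ i, q (x i)| ≤ t * ∑ x, |p x - q x| := by
  induction t with
  | zero => simp
  | succ t ih =>
    rw [← (Fin.consEquiv fun _ : Fin (t + 1) => α).sum_comp, Fintype.sum_prod_type]
    have h1 : ∀ (a : α) (x : Fin t → α), |p a * ∏ i, p (x i) - q a * ∏ i, q (x i)| ≤
        p a * |∏ i, p (x i) - ∏ i, q (x i)| + |p a - q a| * ∏ i, q (x i) := by
      intro a x
      have hQ : 0 ≤ ∏ i, q (x i) := Finset.prod_nonneg fun _ _ => hq _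
      calc _ = |p a * (∏ i, p (x i) - ∏ i, q (x i)) + (p a - q a) * ∏ i, q (x i)| := by
            congr 1; ring
        _ ≤ _ := abs_add_le _ _
        _ = _ := by rw [abs_mul, abs_mul, abs_of_nonneg (hp a), abs_of_nonneg hQ]
    calc _ ≤ ∑ a, ∑ x : Fin t → α,
          (p a * |∏ i, p (x i) - ∏ i, q (x i)| + |p a - q a| * ∏ i, q (x i)) := by
          refine Finset.sum_le_sum fun a _ => Finset.sum_le_sum fun x _ => ?_
          simpa [Fin.consEquiv, Fin.prod_univ_succ] using h1 a x
      _ = ∑ x : Fin t → α, |∏ i, p (x i) - ∏ i, q (x i)| + ∑ x, |p x - q x| := by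
          simp_rw [Finset.sum_add_distrib, ← Finset.mul_sum, ← Fintype.sum_pow, hq1,
            ← Finset.sum_mul, hp1]
          simp
      _ ≤ _ := by push_cast; linarith

/-- Weighted AM-GM in place of Cauchy–Schwarz: the bound stays linear in the purity `∑ p²`, so it
can be averaged over random states before `ε` is chosen. -/
theorem sum_abs_sub_lowDist_le {n m : ℕ} (h : m ≤ n) {p : Bits n → ℝ} (hp1 : ∑ x, p x = 1)
    (hp0 : ∀ x, x ∉ lowSet n m → p x = 0) {ε : ℝ} (hε : 0 < ε) :
    ∑ x, |lowDist n m x - p x| ≤ (ε + (2 ^ m * ∑ x, p x ^ 2 - 1) / ε) / 2 := by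
  have hM : (0 : ℝ) < 2 ^ m := by positivity
  have h1 : ∀ x, |lowDist n m x - p x| ≤
      (ε * lowDist n m x + (2 ^ m * p x ^ 2 - 2 * p x + lowDist n m x) / ε) / 2 := by
    intro x
    by_cases hx : x ∈ lowSet n m
    · simp only [lowDist, if_pos hx]
      have h2 : 2 ^ m * p x ^ 2 - 2 * p x + ((2 : ℝ) ^ m)⁻¹ =
          (((2 : ℝ) ^ m)⁻¹ - p x) ^ 2 * 2 ^ m := by field_simp; ring
      rw [h2, ← sq_abs]
      generalize |((2 : ℝ) ^ m)⁻¹ - p x| = d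
      generalize (2 : ℝ) ^ m = M at hM
      have h3 : (ε * M⁻¹ + d ^ 2 * M / ε) / 2 - d = (ε - d * M) ^ 2 / (2 * ε * M) := by
        field_simp; ring
      have : 0 ≤ (ε - d * M) ^ 2 / (2 * ε * M) := by positivity
      linarith
    · simp [lowDist, hx, hp0 x hx]
  refine (Finset.sum_le_sum fun x _ => h1 x).trans_eq ?_
  rw [← Finset.sum_div, Finset.sum_add_distrib, ← Finset.sum_div, Finset.sum_add_distrib,
    Finset.sum_sub_distrib, ← Finset.mul_sum, ← Finset.mul_sum, ← Finset.mul_sum, hp1, sum_lowDist h]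
  ring

end Product

/-! ### Acceptance probabilities as functions of the input state -/

section Acceptance

variable {L n m t : ℕ}

theorem Circuit.mat_eq_gatesMat (C : Circuit L) : C.mat = gatesMat C.gates := rfl

theorem Circuit.acc_sum_smul {ι : Type*} (s : Finset ι) (C : Circuit L) (c : ι → ℝ)
    (A : ι → QMat L) :
    C.acc (∑ i ∈ s, (c i : ℂ) • A i) = ∑ i ∈ s, c i * C.acc (A i) := by
  have h : C.run (∑ i ∈ s, (c i : ℂ) • A i) = ∑ i ∈ s, (c i : ℂ) • C.run (A i) := by
    have h1 : tens (∑ i ∈ s, (c i : ℂ) • A i) (zeroState C.anc) =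
        ∑ i ∈ s, (c i : ℂ) • tens (A i) (zeroState C.anc) := by
      ext x y
      simp [tens, Matrix.sum_apply, Finset.sum_mul, mul_assoc]
    simp only [Circuit.run, h1, Matrix.mul_sum, Matrix.sum_mul, Matrix.mul_smul, Matrix.smul_mul]
  simp only [Circuit.acc, probOne, h, Finset.mul_sum]
  rw [Finset.sum_comm]
  refine Finset.sum_congr rfl fun a _ => ?_
  split_ifs
  · simp [Matrix.sum_apply]
  · simp

/-- Ancillas and gates preserve the norm, and the acceptance probability is a partial sum of the
squared amplitudes. -/
theorem Circuit.acc_proj_mem (C : Circuit L) {v : Bits L → ℂ} (hv : ∑ x, ‖v x‖ ^ 2 = 1) :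
    0 ≤ C.acc (proj v) ∧ C.acc (proj v) ≤ 1 := by
  set u : Bits (L + C.anc) → ℂ := fun x => v (fun i => x (Fin.castAdd C.anc i)) *
    (Pi.single (fun _ => false) 1 : Bits C.anc → ℂ) (fun j => x (Fin.natAdd L j)) with hu
  have h1 : tens (proj v) (zeroState C.anc) = proj u := by
    ext x y
    simp only [tens, zeroState, ket_eq_proj, proj, Matrix.vecMulVec_apply, hu, Pi.star_apply,
      star_mul']
    ring
  have hrun : C.run (proj v) = proj (C.mat *ᵥ u) := by
    rw [Circuit.run, h1, mul_proj_mul]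
  have hdot : ∀ {N : ℕ} (w : Bits N → ℂ), ((∑ a, ‖w a‖ ^ 2 : ℝ) : ℂ) = star w ⬝ᵥ w := by
    intro N w
    push_cast
    exact Finset.sum_congr rfl fun a _ => (Complex.conj_mul' _).symm
  have hu1 : ∑ a, ‖u a‖ ^ 2 = 1 := by
    rw [sum_append, ← hv]
    refine Finset.sum_congr rfl fun x _ => ?_
    rw [Fintype.sum_eq_single fun _ => false]
    · simp [hu]
    · intro y hy
      simp [hu, Pi.single_apply, hy]
  have hw1 : ∑ a, ‖(C.mat *ᵥ u) a‖ ^ 2 = 1 := by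
    have : ((∑ a, ‖(C.mat *ᵥ u) a‖ ^ 2 : ℝ) : ℂ) = ((∑ a, ‖u a‖ ^ 2 : ℝ) : ℂ) := by
      rw [hdot, hdot, Matrix.star_mulVec, ← Matrix.dotProduct_mulVec, Matrix.mulVec_mulVec,
        C.mat_eq_gatesMat, gatesMat_conjTranspose_mul, Matrix.one_mulVec]
    rw [← hu1]
    exact_mod_cast this
  have hdiag : ∀ a, (proj (C.mat *ᵥ u) a a).re = ‖(C.mat *ᵥ u) a‖ ^ 2 := by
    intro a
    rw [proj, Matrix.vecMulVec_apply, Pi.star_apply]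
    have := Complex.mul_conj' ((C.mat *ᵥ u) a)
    rw [← Complex.ofReal_pow] at this
    exact (congrArg Complex.re this).trans (Complex.ofReal_re _)
  simp only [Circuit.acc, probOne, hrun, hdiag]
  constructor
  · exact Finset.sum_nonneg fun a _ => by split_ifs <;> positivity
  · rw [← hw1]
    exact Finset.sum_le_sum fun a _ => by split_ifs <;> first | exact le_rfl | positivity

theorem continuous_acc {X : Type*} [TopologicalSpace X] (C : Circuit L) {f : X → QMat L}
    (hf : Continuous f) : Continuous fun x => C.acc (f x) := by
  have h1 : Continuous fun x => tens (f x) (zeroState C.anc) :=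
    continuous_pi fun a => continuous_pi fun b => (hf.matrix_elem _ _).mul continuous_const
  have h2 : Continuous fun x => C.run (f x) :=
    (continuous_const.matrix_mul h1).matrix_mul continuous_const
  unfold Circuit.acc probOne
  refine continuous_finsetSum _ fun a _ => ?_
  split_ifs
  · exact Complex.continuous_re.comp (h2.matrix_elem a a)
  · exact continuous_const

theorem continuous_tensPow (t : ℕ) : Continuous (tensPow t : QMat n → QMat (t * n)) :=
  continuous_pi fun _ => continuous_pi fun _ => continuous_finsetProd _ fun _ _ =>
    continuous_id.matrix_elem _ _

theorem mul_diagonal_mul_apply (W : QMat n) (d : Bits n → ℂ) (a b : Bits n) :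
    (W * Matrix.diagonal d * Wᴴ) a b = ∑ z, d z * (W a z * star (W b z)) := by
  rw [Matrix.mul_apply]
  simp only [Matrix.mul_diagonal, Matrix.conjTranspose_apply]
  exact Finset.sum_congr rfl fun z _ => by ring

/-- A product of column vectors of `W`. -/
def productVec (W : QMat n) (x : Fin t → Bits n) : Bits (t * n) → ℂ := fun b =>
  ∏ i, W (fun j => b (finProdFinEquiv (i, j))) (x i)

/-- A power of a state diagonal in the basis `W` is a mixture of product eigenvectors with product
weights, so comparing two such powers becomes a classical question about the weights. -/
theorem tensPow_diagonal (W : QMat n) (p : Bits n → ℝ) :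
    tensPow t (W * Matrix.diagonal (fun x => ((p x : ℝ) : ℂ)) * Wᴴ) =
      ∑ x : Fin t → Bits n, ((∏ i, p (x i) : ℝ) : ℂ) • proj (productVec W x) := by
  ext a b
  simp only [tensPow, mul_diagonal_mul_apply, Matrix.sum_apply, Matrix.smul_apply, proj,
    Matrix.vecMulVec_apply, productVec, Pi.star_apply, smul_eq_mul, star_prod]
  rw [Finset.prod_univ_sum, Fintype.piFinset_univ]
  refine Finset.sum_congr rfl fun x _ => ?_
  rw [Finset.prod_mul_distrib, Finset.prod_mul_distrib]
  push_cast
  rfl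

theorem sum_norm_productVec (W : UGroup n) (x : Fin t → Bits n) :
    ∑ b, ‖productVec (W : QMat n) x b‖ ^ 2 = 1 := by
  let e : Bits (t * n) ≃ (Fin t → Bits n) :=
    (finProdFinEquiv.symm.arrowCongr (Equiv.refl Bool)).trans (Equiv.curry _ _ _)
  have h1 : ∀ y : Bits n, ∑ b, ‖(W : QMat n) b y‖ ^ 2 = 1 := by
    intro y
    have h := congrFun (congrFun W.conjTranspose_mul y) y
    rw [Matrix.mul_apply, Matrix.one_apply_eq] at h
    have h2 : ((∑ b, ‖(W : QMat n) b y‖ ^ 2 : ℝ) : ℂ) = 1 := by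
      rw [← h]; push_cast
      refine Finset.sum_congr rfl fun i _ => ?_
      rw [Matrix.conjTranspose_apply]; exact (Complex.conj_mul' _).symm
    exact_mod_cast h2
  have h2 : ∀ b, ‖productVec (W : QMat n) x b‖ ^ 2 = ∏ i, ‖(W : QMat n) (e b i) (x i)‖ ^ 2 := by
    intro b
    rw [productVec, norm_prod, Finset.prod_pow]
    rfl
  simp_rw [h2]
  rw [e.sum_comp fun f => ∏ i, ‖(W : QMat n) (f i) (x i)‖ ^ 2, ← Fintype.piFinset_univ]
  refine (Finset.prod_univ_sum (fun _ => Finset.univ)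
    fun i b => ‖(W : QMat n) b (x i)‖ ^ 2).symm.trans ?_
  simp [h1]

/-- Circuits distinguish powers of two commuting states at most as well as the eigenvalues do. -/
theorem Circuit.abs_acc_tensPow_sub_le (C : Circuit (t * n)) (W : UGroup n) {p q : Bits n → ℝ}
    (hp : ∀ x, 0 ≤ p x) (hq : ∀ x, 0 ≤ q x) (hp1 : ∑ x, p x = 1) (hq1 : ∑ x, q x = 1) :
    |C.acc (tensPow t ((W : QMat n) * Matrix.diagonal (fun x => ((p x : ℝ) : ℂ)) * (W : QMat n)ᴴ)) -
      C.acc (tensPow t ((W : QMat n) * Matrix.diagonal (fun x => ((q x : ℝ) : ℂ)) * (W : QMat n)ᴴ))| ≤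
      t * ∑ x, |p x - q x| := by
  rw [tensPow_diagonal, tensPow_diagonal, C.acc_sum_smul, C.acc_sum_smul, ← Finset.sum_sub_distrib]
  refine (Finset.abs_sum_le_sum_abs _ _).trans
    (le_trans (Finset.sum_le_sum fun x _ => ?_) (sum_abs_prod_sub_le t hp hq hp1 hq1))
  obtain ⟨h0, h1⟩ := C.acc_proj_mem (sum_norm_productVec W x)
  rw [← sub_mul, abs_mul, abs_of_nonneg h0]
  exact mul_le_of_le_one_right (abs_nonneg _) h1

end Acceptance

end QCrypto

namespace QCrypto

/-! ### From Haar random rotations to the Hilbert–Schmidt ensemble -/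

section HaarBounds

variable {n m t : ℕ}

/-- The unitary `W ⊗ I`. -/
def liftU (m : ℕ) (W : UGroup n) : UGroup (n + m) :=
  ⟨lift (Fin.castAddEmb m) (W : QMat n), by
    rw [Matrix.mem_unitaryGroup_iff', Matrix.star_eq_conjTranspose, ← lift_conjTranspose,
      ← lift_mul, W.conjTranspose_mul, lift_one]⟩

theorem reducedState_liftU_mul (W : UGroup n) (V : UGroup (n + m)) :
    reducedState n m (liftU m W * V) = (W : QMat n) * reducedState n m V * (W : QMat n)ᴴ := by
  have : ((liftU m W * V : UGroup (n + m)) : QMat (n + m)) =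
      lift (Fin.castAddEmb m) (W : QMat n) * (V : QMat (n + m)) := rfl
  rw [reducedState, reducedState, traceRight_eq_marginal, traceRight_eq_marginal, ← marginal_lift,
    this, Matrix.conjTranspose_mul]
  simp only [Matrix.mul_assoc]

theorem continuous_conj (A : QMat n) :
    Continuous fun W : UGroup n => (W : QMat n) * A * (W : QMat n)ᴴ := by fun_prop

/-- Right invariance absorbs the eigenbasis `W₀` of the reduced state into `W`. Both states are then
diagonal in the same basis, and only their spectra differ. -/
theorem abs_integral_conj_sub_le (hm : m ≤ n) (C : Circuit (t * n)) (V : UGroup (n + m)) {ε : ℝ}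
    (hε : 0 < ε) :
    |∫ W : UGroup n, C.acc (tensPow t ((W : QMat n) * lowState n m * (W : QMat n)ᴴ)) ∂(haarU n) -
      ∫ W : UGroup n, C.acc (tensPow t ((W : QMat n) * reducedState n m V * (W : QMat n)ᴴ))
        ∂(haarU n)| ≤ t * ((ε + (2 ^ m * purity (reducedState n m V) - 1) / ε) / 2) := by
  obtain ⟨W₀, p, hp, hp1, hp0, hpur, hρ⟩ := exists_diagonal_reducedState hm V
  have hF : ∀ A : QMat n, Continuous fun W : UGroup n =>
      C.acc (tensPow t ((W : QMat n) * A * (W : QMat n)ᴴ)) := fun A =>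
    continuous_acc C ((continuous_tensPow t).comp (continuous_conj A))
  have h1 : ∫ W : UGroup n, C.acc (tensPow t ((W : QMat n) * reducedState n m V * (W : QMat n)ᴴ))
      ∂(haarU n) = ∫ W : UGroup n, C.acc (tensPow t ((W : QMat n) *
        Matrix.diagonal (fun x => ((p x : ℝ) : ℂ)) * (W : QMat n)ᴴ)) ∂(haarU n) := by
    rw [← integral_mul_right_eq_self (fun W : UGroup n => C.acc (tensPow t ((W : QMat n) *
        Matrix.diagonal (fun x => ((p x : ℝ) : ℂ)) * (W : QMat n)ᴴ))) W₀, hρ]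
    simp only [Submonoid.coe_mul, Matrix.conjTranspose_mul, Matrix.mul_assoc]
  rw [h1, ← integral_sub (integrable_haarU (hF _)) (integrable_haarU (hF _)), ← hpur]
  have h2 := norm_integral_le_of_norm_le_const (μ := haarU n) (f := fun W : UGroup n =>
      C.acc (tensPow t ((W : QMat n) * lowState n m * (W : QMat n)ᴴ)) -
      C.acc (tensPow t ((W : QMat n) * Matrix.diagonal (fun x => ((p x : ℝ) : ℂ)) *
        (W : QMat n)ᴴ))) (C := t * ∑ x, |lowDist n m x - p x|)
    (Filter.Eventually.of_forall fun W => by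
      rw [lowState_eq_diagonal]
      exact C.abs_acc_tensPow_sub_le W lowDist_nonneg hp (sum_lowDist hm) hp1)
  rw [probReal_univ, mul_one] at h2
  refine h2.trans ?_
  gcongr
  exact sum_abs_sub_lowDist_le hm hp1 hp0 hε

/-- Powers of a randomly rotated flat state are close to powers of a state from `η_{n,m}`. -/
theorem abs_integral_haarU_sub_ghse_le (hm : m ≤ n) (hn : 1 ≤ n) (C : Circuit (t * n)) :
    |∫ W : UGroup n, C.acc (tensPow t ((W : QMat n) * lowState n m * (W : QMat n)ᴴ)) ∂(haarU n) -
      ∫ σ : QMat n, C.acc (tensPow t σ) ∂(ghse n m)| ≤ 4 * t * √((2 : ℝ) ^ m / 2 ^ n) := by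
  set F : QMat n → ℝ := fun σ => C.acc (tensPow t σ) with hFdef
  have hF : Continuous F := continuous_acc C (continuous_tensPow t)
  set R := reducedState n m
  have hR : Continuous R := continuous_reducedState n m
  have hc : Continuous (Function.uncurry fun (V : UGroup (n + m)) (W : UGroup n) =>
      F ((W : QMat n) * R V * (W : QMat n)ᴴ)) := by
    refine hF.comp ?_
    have h2 : Continuous fun x : UGroup (n + m) × UGroup n => (x.2 : QMat n) :=
      continuous_subtype_val.comp continuous_snd
    exact (h2.matrix_mul (hR.comp continuous_fst)).matrix_mul h2.matrix_conjTranspose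
  -- The ensemble is invariant under conjugation by `W`, because `W ⊗ I` can be absorbed into `V`.
  -- Averaging over `W` as well thus changes nothing, and the integrals may be swapped.
  have h1 : ∫ σ : QMat n, F σ ∂(ghse n m) = ∫ V : UGroup (n + m), ∫ W : UGroup n,
      F ((W : QMat n) * R V * (W : QMat n)ᴴ) ∂(haarU n) ∂(haarU (n + m)) := by
    rw [integral_integral_swap_of_hasCompactSupport hc (HasCompactSupport.of_compactSpace _)]
    have : ∀ W : UGroup n, ∫ V : UGroup (n + m), F ((W : QMat n) * R V * (W : QMat n)ᴴ)
        ∂(haarU (n + m)) = ∫ σ : QMat n, F σ ∂(ghse n m) := by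
      intro W
      rw [ghse, integral_map hR.measurable.aemeasurable hF.aestronglyMeasurable,
        ← integral_mul_left_eq_self (fun V => F (R V)) (liftU m W)]
      simp only [R, reducedState_liftU_mul]
    simp_rw [this]
    simp
  -- Balances the two terms: the mean purity excess is at most `6ε²`, and `(ε + 6ε²/ε)/2 ≤ 4ε`.
  set ε : ℝ := √((2 : ℝ) ^ m / 2 ^ n) with hε
  have hε0 : 0 < ε := Real.sqrt_pos.mpr (by positivity)
  have hε2 : ε * ε = (2 : ℝ) ^ m / 2 ^ n := Real.mul_self_sqrt (by positivity)
  have hpurI : Integrable (fun V => purity (R V)) (haarU (n + m)) :=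
    integrable_haarU (continuous_purity.comp hR)
  have hGI : Integrable (fun V => ∫ W : UGroup n, F ((W : QMat n) * R V * (W : QMat n)ᴴ)
      ∂(haarU n)) (haarU (n + m)) := by
    refine integrable_haarU ?_
    have : FirstCountableTopology (UGroup (n + m)) :=
      inferInstanceAs (FirstCountableTopology {A : Bits (n + m) → Bits (n + m) → ℂ // _})
    simpa using continuous_parametric_integral_of_continuous hc isCompact_univ
  set c := ∫ W : UGroup n, F ((W : QMat n) * lowState n m * (W : QMat n)ᴴ) ∂(haarU n) with hcdef
  have hcI : c = ∫ _V : UGroup (n + m), c ∂(haarU (n + m)) := by simp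
  rw [h1, hcI, ← integral_sub (integrable_const _) hGI]
  refine (abs_integral_le_integral_abs).trans ?_
  have hbI : Integrable (fun V => t * ((ε + (2 ^ m * purity (R V) - 1) / ε) / 2))
      (haarU (n + m)) :=
    integrable_haarU (by have := continuous_purity.comp hR; simp only [Function.comp_def] at this; fun_prop)
  refine (integral_mono ((integrable_const _).sub hGI).abs hbI
    fun V => abs_integral_conj_sub_le hm C V hε0).trans ?_
  have hsI : Integrable (fun V => (2 : ℝ) ^ m * purity (R V) - 1) (haarU (n + m)) :=
    (hpurI.const_mul _).sub (integrable_const _)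
  rw [integral_const_mul, integral_div, integral_add (integrable_const _) (hsI.div_const _),
    integral_div, integral_sub (hpurI.const_mul _) (integrable_const _), integral_const_mul]
  simp only [integral_const, probReal_univ, one_smul]
  have h3 := integral_purity_le (m := m) hn
  rw [← hε2] at h3
  have h4 : ((2 : ℝ) ^ m * ∫ V, purity (R V) ∂(haarU (n + m)) - 1) / ε ≤ 6 * ε := by
    rw [div_le_iff₀ hε0]; linarith
  calc _ ≤ (t : ℝ) * ((ε + 6 * ε) / 2) := by gcongr
    _ ≤ _ := by nlinarith [mul_nonneg (Nat.cast_nonneg (α := ℝ) t) hε0.le]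

theorem integrable_conj_diag (ρ : QMat n) (w : Bits n) :
    Integrable (fun V : UGroup n => (((V : QMat n) * ρ * (V : QMat n)ᴴ) w w).re) (haarU n) :=
  integrable_haarU (Complex.continuous_re.comp ((continuous_conj ρ).matrix_elem w w))

/-- Basis permutations make the mean diagonal entries equal, and they sum to the trace. -/
theorem integral_conj_diag (ρ : QMat n) (hρ : ρ.trace = 1) (w : Bits n) :
    ∫ V : UGroup n, (((V : QMat n) * ρ * (V : QMat n)ᴴ) w w).re ∂(haarU n) = ((2 : ℝ) ^ n)⁻¹ := by
  have hsame : ∀ w', ∫ V : UGroup n, (((V : QMat n) * ρ * (V : QMat n)ᴴ) w' w').re ∂(haarU n) =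
      ∫ V : UGroup n, (((V : QMat n) * ρ * (V : QMat n)ᴴ) w w).re ∂(haarU n) := by
    intro w'
    rw [← integral_mul_left_eq_self _ (permU (Equiv.swap w w'))]
    refine integral_congr_ae (Filter.Eventually.of_forall fun V => ?_)
    have : ((permU (Equiv.swap w w') * V : UGroup n) : QMat n) * ρ *
        ((permU (Equiv.swap w w') * V : UGroup n) : QMat n)ᴴ =
        (permU (Equiv.swap w w') : QMat n) * ((V : QMat n) * ρ * (V : QMat n)ᴴ) *
          (permU (Equiv.swap w w') : QMat n)ᴴ := by
      simp only [Submonoid.coe_mul, Matrix.conjTranspose_mul, Matrix.mul_assoc]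
    simp only [this, permU_conj_apply]
    simp
  have hsum : ∑ w', ∫ V : UGroup n, (((V : QMat n) * ρ * (V : QMat n)ᴴ) w' w').re ∂(haarU n) = 1 := by
    rw [← integral_finsetSum _ fun w' _ => integrable_conj_diag ρ w']
    have : ∀ V : UGroup n, ∑ w', (((V : QMat n) * ρ * (V : QMat n)ᴴ) w' w').re = 1 := by
      intro V
      rw [← Complex.re_sum]
      have : ∑ w', ((V : QMat n) * ρ * (V : QMat n)ᴴ) w' w' = 1 := by
        change ((V : QMat n) * ρ * (V : QMat n)ᴴ).trace = 1
        rw [Matrix.trace_mul_cycle, V.conjTranspose_mul, Matrix.one_mul, hρ]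
      rw [this, Complex.one_re]
    simp [this]
  simp only [hsame, Finset.sum_const, Finset.card_univ, nsmul_eq_mul] at hsum
  rw [eq_comm, inv_eq_one_div, div_eq_iff (by positivity), ← hsum]
  simp
  ring

end HaarBounds

end QCrypto

namespace QCrypto

/-! ### Negligible functions of the key length -/

section Negligible

open Filter

/-- As `lam` tends to infinity, each key length occurs for finitely many `n`, so `μ l` can be the
supremum of `f` (truncated at `0`) over the fibre of `l`. -/
theorem exists_negligible_of_eventually_lt {lam : ℕ → ℕ} (hlam : Tendsto lam atTop atTop)
    {f : ℕ → ℝ} (h : ∀ d : ℕ, ∀ᶠ n in atTop, f n < ((lam n : ℝ) ^ d)⁻¹) :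
    ∃ μ : ℕ → ℝ, Negligible μ ∧ ∀ n, f n ≤ μ (lam n) := by
  have hfin : ∀ l, {n | lam n = l}.Finite := fun l => by
    obtain ⟨N, hN⟩ := eventually_atTop.mp (hlam.eventually_gt_atTop l)
    exact (Set.finite_lt_nat N).subset fun n hn =>
      not_le.mp fun hNn => (hN n hNn).ne' hn
  refine ⟨fun l => ((hfin l).toFinset.sup fun n => (f n).toNNReal : NNReal),
    ⟨fun l => NNReal.coe_nonneg _, fun c => ?_⟩, fun n => ?_⟩
  · obtain ⟨N, hN⟩ := eventually_atTop.mp (h c)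
    -- A key length above all values of `lam` on `n < N` is attained only for `n ≥ N`, where the
    -- bound holds.
    refine ⟨(Finset.range N).sup lam, fun l hl => ?_⟩
    have hpos : (0 : ℝ) < ((l : ℝ) ^ c)⁻¹ := by
      have : (0 : ℝ) < l := by exact_mod_cast (Nat.zero_le _).trans_lt hl
      positivity
    rw [← Real.coe_toNNReal _ hpos.le, NNReal.coe_lt_coe,
      Finset.sup_lt_iff (by simpa using hpos)]
    intro n hn
    have hn' : lam n = l := by simpa using hn
    have hNn : N ≤ n := by
      by_contra hlt
      have : lam n ≤ (Finset.range N).sup lam :=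
        Finset.le_sup (by simpa using hlt)
      omega
    rw [Real.toNNReal_lt_toNNReal_iff hpos, ← hn']
    exact hN n hNn
  · have : (f n).toNNReal ≤ (hfin (lam n)).toFinset.sup fun n => (f n).toNNReal :=
      Finset.le_sup (f := fun n => (f n).toNNReal) (by simp)
    exact (Real.le_coe_toNNReal _).trans (by exact_mod_cast this)

variable {lam m : ℕ → ℕ}

/-- After taking logarithms, `n ^ (2c) ≤ 2^n / 2^m` says that `n - m` is at least `2c log n / log
2`. -/
theorem eventually_pow_mul_sqrt_le
    (hgap : Tendsto (fun n : ℕ => ((n : ℝ) - (m n : ℝ)) / Real.log (n : ℝ)) atTop atTop) (c : ℕ) :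
    ∀ᶠ n : ℕ in atTop, (n : ℝ) ^ c * √((2 : ℝ) ^ m n / 2 ^ n) ≤ 1 := by
  have h2 : 0 < Real.log 2 := Real.log_pos (by norm_num)
  filter_upwards [hgap.eventually_ge_atTop (2 * c / Real.log 2), eventually_ge_atTop 2] with n hn hn2
  have hn0 : (0 : ℝ) < n := by positivity
  have hlog : 0 < Real.log n := Real.log_pos (by exact_mod_cast hn2)
  rw [le_div_iff₀ hlog, div_mul_eq_mul_div, div_le_iff₀ h2] at hn
  have h3 : (n : ℝ) ^ (2 * c) ≤ 2 ^ n / 2 ^ m n := by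
    rw [← Real.log_le_log_iff (by positivity) (by positivity), Real.log_pow,
      Real.log_div (by positivity) (by positivity), Real.log_pow, Real.log_pow]
    push_cast
    linarith
  have h4 : (n : ℝ) ^ c ≤ √((2 : ℝ) ^ n / 2 ^ m n) :=
    Real.le_sqrt_of_sq_le (by rwa [← pow_mul, mul_comm c])
  calc _ ≤ √((2 : ℝ) ^ n / 2 ^ m n) * √((2 : ℝ) ^ m n / 2 ^ n) := by gcongr
    _ = 1 := by
      rw [← Real.sqrt_mul (by positivity), div_mul_div_cancel₀ (by positivity), div_self (by positivity), Real.sqrt_one]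

theorem eventually_mul_sqrt_lt
    (hgap : Tendsto (fun n : ℕ => ((n : ℝ) - (m n : ℝ)) / Real.log (n : ℝ)) atTop atTop)
    {q : ℕ → ℕ} (hq : PolyBounded q) (A : ℝ) :
    ∀ᶠ n : ℕ in atTop, A * q n * √((2 : ℝ) ^ m n / 2 ^ n) < 1 := by
  obtain ⟨c, hc⟩ := hq
  -- Of the `c + 3` powers of `n`, `c + 1` absorb `q n`, one absorbs `A`, and the last makes the
  -- inequality strict.
  filter_upwards [eventually_pow_mul_sqrt_le hgap (c + 3), eventually_ge_atTop (c + 2),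
    tendsto_natCast_atTop_atTop.eventually_ge_atTop A] with n h hn hA
  have hn2 : (2 : ℝ) ≤ n := by exact_mod_cast (by omega : 2 ≤ n)
  have hn1 : (1 : ℝ) ≤ (n : ℝ) ^ c := one_le_pow₀ (by linarith)
  have hcn : (c : ℝ) + 1 ≤ n := by exact_mod_cast (by omega : c + 1 ≤ n)
  have h1 : (q n : ℝ) ≤ (n : ℝ) ^ (c + 1) := by
    have : (q n : ℝ) ≤ (n : ℝ) ^ c + c := by exact_mod_cast hc n
    rw [pow_succ]
    nlinarith [Nat.cast_nonneg (α := ℝ) c]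
  set s := √((2 : ℝ) ^ m n / 2 ^ n)
  have hs : 0 ≤ s := Real.sqrt_nonneg _
  have h2 : A * q n * s ≤ n * (n : ℝ) ^ (c + 1) * s := by gcongr
  have h3 : n * (n * (n : ℝ) ^ (c + 1) * s) ≤ 1 := by
    calc _ = (n : ℝ) ^ (c + 3) * s := by ring
      _ ≤ 1 := h
  nlinarith

/-- Each term contributes at most half of `lam ^ (-d)`. For `μ` the bound with exponent `d + 1`
leaves a factor of `lam` to absorb `2|A|`; for the other term `q * lam ^ d` is still polynomial in
`n`. -/
theorem exists_negligible_add (hlam : PolyBounded lam) (hlam_top : Tendsto lam atTop atTop)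
    (hgap : Tendsto (fun n : ℕ => ((n : ℝ) - (m n : ℝ)) / Real.log (n : ℝ)) atTop atTop)
    {μ : ℕ → ℝ} (hμ : Negligible μ) {q : ℕ → ℕ} (hq : PolyBounded q) (A : ℝ) {f : ℕ → ℝ}
    (hf : ∀ᶠ n in atTop, f n ≤ A * (μ (lam n) + q n * √((2 : ℝ) ^ m n / 2 ^ n))) :
    ∃ ν : ℕ → ℝ, Negligible ν ∧ ∀ n, f n ≤ ν (lam n) := by
  refine exists_negligible_of_eventually_lt hlam_top fun d => ?_
  have hpow : PolyBounded fun n => q n * lam n ^ d := by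
    refine hq.mul ?_
    clear hf
    induction d with
    | zero => simpa using polyBounded_const 1
    | succ d ih => simpa only [pow_succ] using ih.mul hlam
  obtain ⟨l₀, hl₀⟩ := hμ.2 (d + 1)
  filter_upwards [hf, eventually_mul_sqrt_lt hgap hpow (2 * |A|), hlam_top.eventually_gt_atTop l₀,
    hlam_top.eventually_gt_atTop 0,
    (tendsto_natCast_atTop_atTop.comp hlam_top).eventually_ge_atTop (2 * |A|)] with n h1 h2 h3 h4 h5
  have hl : (0 : ℝ) < lam n := by exact_mod_cast h4
  have hμl := hl₀ _ h3
  have hμ0 := hμ.1 (lam n)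
  set s := √((2 : ℝ) ^ m n / 2 ^ n)
  have hs : 0 ≤ s := Real.sqrt_nonneg _
  have h6 : A * (μ (lam n) + q n * s) ≤ |A| * (μ (lam n) + q n * s) :=
    mul_le_mul_of_nonneg_right (le_abs_self _) (by positivity)
  refine (h1.trans h6).trans_lt ?_
  have h7 : (lam n : ℝ) ^ d * (2 * |A| * (q n * s)) < 1 := by
    push_cast at h2
    calc _ = 2 * |A| * (q n * (lam n : ℝ) ^ d) * s := by ring
      _ < 1 := h2
  have h8 : (lam n : ℝ) ^ d * (2 * |A| * μ (lam n)) ≤ 1 := by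
    rw [← mul_one (_ ^ _)⁻¹, lt_inv_mul_iff₀ (by positivity), pow_succ] at hμl
    calc _ = 2 * |A| * ((lam n : ℝ) ^ d * μ (lam n)) := by ring
      _ ≤ lam n * ((lam n : ℝ) ^ d * μ (lam n)) := by gcongr; exact h5
      _ ≤ 1 := by linarith
  rw [← mul_one (_ ^ _)⁻¹, lt_inv_mul_iff₀ (by positivity)]
  linarith

end Negligible

end QCrypto

namespace QCrypto

/-! ### The overlap of two scrambled states -/

section Acceptance

variable {n m : ℕ}

theorem scrambled_eq (h : m ≤ n) (U : UGroup n) :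
    scrambled h U = (U : QMat n) * lowState n m * (U : QMat n)ᴴ := by
  rw [scrambled, recast_eq_lowState h]

theorem isDensity_scrambled (h : m ≤ n) (U : UGroup n) : IsDensity (scrambled h U) := by
  rw [scrambled_eq, lowState_eq_diagonal]
  constructor
  · refine Matrix.PosSemidef.mul_mul_conjTranspose_same (Matrix.PosSemidef.diagonal fun x => ?_) _
    exact Complex.zero_le_real.mpr (lowDist_nonneg x)
  · rw [Matrix.trace_mul_cycle, U.conjTranspose_mul, Matrix.one_mul, Matrix.trace_diagonal]
    exact_mod_cast sum_lowDist h

/-- The probability `tr (|0⟩⟨0|^{⊗ (n-m)} tr_m (U† σ U))`. -/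
noncomputable def lowProb (m : ℕ) (U : UGroup n) (σ : QMat n) : ℝ :=
  ∑ w : Bits n, if ∀ j : Fin n, (j : ℕ) < n - m → w j = false then
    (((U : QMat n)ᴴ * σ * (U : QMat n)) w w).re else 0

theorem lowProb_eq_sum (U : UGroup n) (σ : QMat n) :
    lowProb m U σ = ∑ w ∈ lowSet n m, (((U : QMat n)ᴴ * σ * (U : QMat n)) w w).re := by
  rw [lowProb, lowSet, Finset.sum_filter]

/-- Positivity of `σ` makes the diagonal of `U† σ U` real, so taking real parts loses nothing. -/
theorem lowProb_eq_trace (h : m ≤ n) (U : UGroup n) {σ : QMat n} (hσ : σ.PosSemidef) :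
    ((lowProb m U σ : ℝ) : ℂ) = (zeroState (n - m) *
      traceRight (recast (Nat.sub_add_cancel h).symm
        ((U : QMat n)ᴴ * σ * (U : QMat n)))).trace := by
  have hH := (hσ.conjTranspose_mul_mul_same (U : QMat n)).isHermitian
  set τ := (U : QMat n)ᴴ * σ * (U : QMat n)
  have h1 : (zeroState (n - m) * traceRight (recast (Nat.sub_add_cancel h).symm τ)).trace =
      traceRight (recast (Nat.sub_add_cancel h).symm τ) (fun _ => false) fun _ => false := by
    rw [zeroState, ket, Matrix.trace_single_mul, one_smul]
  let e : Bits (n - m + m) ≃ Bits n :=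
    (finCongr (Nat.sub_add_cancel h)).arrowCongr (Equiv.refl Bool)
  have he : ∀ (x : Bits (n - m)) (z : Bits m),
      (∀ j : Fin n, (j : ℕ) < n - m → e (Fin.append x z) j = false) ↔ x = fun _ => false := by
    intro x z
    constructor
    · intro hx
      funext i
      have h2 : Fin.append x z (Fin.castAdd m i) = false :=
        hx ⟨i, i.2.trans_le (Nat.sub_le n m)⟩ i.2
      rwa [Fin.append_left] at h2
    · rintro rfl j hj
      have : e (Fin.append (fun _ => false) z) j =
        Fin.append (fun _ : Fin (n - m) => false) z (Fin.castAdd m ⟨j, hj⟩) := rfl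
      rw [this, Fin.append_left]
  rw [h1, lowProb, ← e.sum_comp, sum_append]
  simp only [he, Finset.sum_ite_irrel, Finset.sum_const_zero, Finset.sum_ite_eq', Finset.mem_univ, if_true]
  rw [traceRight]
  push_cast
  exact Finset.sum_congr rfl fun z _ => Complex.conj_eq_iff_re.mp (hH.apply _ _)

theorem mul_lowState_mul_apply_self (B : QMat n) (w : Bits n) :
    ((B * lowState n m * Bᴴ) w w).re = ∑ z, lowDist n m z * ‖B w z‖ ^ 2 := by
  rw [lowState_eq_diagonal, mul_diagonal_mul_apply, Complex.re_sum]
  refine Finset.sum_congr rfl fun z _ => ?_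
  have := Complex.mul_conj' (B w z)
  rw [← Complex.ofReal_pow] at this
  rw [show B w z * star (B w z) = _ from this, ← Complex.ofReal_mul, Complex.ofReal_re]

/-- The projector onto the low subspace is `2^m` times the low state, so the acceptance probability
is an overlap of two states of the same form. -/
theorem lowProb_scrambled (A B : UGroup n) :
    lowProb m A ((B : QMat n) * lowState n m * (B : QMat n)ᴴ) =
      2 ^ m * ∑ w, ∑ z, lowDist n m w * lowDist n m z * ‖((A : QMat n)ᴴ * (B : QMat n)) w z‖ ^ 2 := by
  have h1 : (A : QMat n)ᴴ * ((B : QMat n) * lowState n m * (B : QMat n)ᴴ) * (A : QMat n) =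
      ((A : QMat n)ᴴ * (B : QMat n)) * lowState n m * ((A : QMat n)ᴴ * (B : QMat n))ᴴ := by
    simp only [Matrix.conjTranspose_mul, Matrix.conjTranspose_conjTranspose, Matrix.mul_assoc]
  have h2 : (2 : ℝ) ^ m ≠ 0 := by positivity
  rw [lowProb, h1, Finset.mul_sum]
  refine Finset.sum_congr rfl fun w _ => ?_
  rw [mul_lowState_mul_apply_self]
  by_cases hw : w ∈ lowSet n m
  · rw [if_pos (mem_lowSet.mp hw), Finset.mul_sum]
    refine Finset.sum_congr rfl fun z _ => ?_
    simp only [lowDist, if_pos hw]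
    field_simp
  · rw [if_neg fun h => hw (mem_lowSet.mpr h)]
    simp [lowDist, hw]

/-- The key step for soundness: it moves the random key from the verifier to the preparation, where
it enters only through oracle queries. -/
theorem lowProb_scrambled_comm (A B : UGroup n) :
    lowProb m A ((B : QMat n) * lowState n m * (B : QMat n)ᴴ) =
      lowProb m B ((A : QMat n) * lowState n m * (A : QMat n)ᴴ) := by
  rw [lowProb_scrambled, lowProb_scrambled, Finset.sum_comm]
  congr 1
  refine Finset.sum_congr rfl fun w _ => Finset.sum_congr rfl fun z _ => ?_
  rw [← norm_star (_ : ℂ), ← Matrix.conjTranspose_apply, Matrix.conjTranspose_mul,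
    Matrix.conjTranspose_conjTranspose, mul_comm (lowDist n m z)]

theorem lowProb_scrambled_self (h : m ≤ n) (U : UGroup n) :
    lowProb m U ((U : QMat n) * lowState n m * (U : QMat n)ᴴ) = 1 := by
  have h2 : (2 : ℝ) ^ m ≠ 0 := by positivity
  rw [lowProb_scrambled, U.conjTranspose_mul]
  have : ∀ w z : Bits n, lowDist n m w * lowDist n m z * ‖(1 : QMat n) w z‖ ^ 2 =
      if w = z then lowDist n m w * lowDist n m z else 0 := fun w z => by
    rw [Matrix.one_apply]; split_ifs <;> simp
  simp only [this, Finset.sum_ite_eq, Finset.mem_univ, if_true]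
  simp [lowDist, Finset.sum_ite_mem, card_lowSet h]

theorem lowProb_scrambled_nonneg (A B : UGroup n) :
    0 ≤ lowProb m A ((B : QMat n) * lowState n m * (B : QMat n)ᴴ) := by
  rw [lowProb_scrambled]
  exact mul_nonneg (by positivity) (Finset.sum_nonneg fun w _ => Finset.sum_nonneg fun z _ =>
    mul_nonneg (mul_nonneg (lowDist_nonneg _) (lowDist_nonneg _)) (by positivity))

/-- Left invariance removes `U`; each of the `2^m` low basis states then carries mean weight
`2^(-n)`. -/
theorem integral_lowProb (h : m ≤ n) (U : UGroup n) :
    ∫ V : UGroup n, lowProb m U ((V : QMat n) * lowState n m * (V : QMat n)ᴴ) ∂(haarU n) =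
      2 ^ m / 2 ^ n := by
  have htr : (lowState n m).trace = 1 := by
    rw [lowState_eq_diagonal, Matrix.trace_diagonal]
    exact_mod_cast sum_lowDist h
  rw [← integral_mul_left_eq_self _ U]
  have h1 : ∀ V : UGroup n,
      lowProb m U (((U * V : UGroup n) : QMat n) * lowState n m * ((U * V : UGroup n) : QMat n)ᴴ) =
      ∑ w ∈ lowSet n m, (((V : QMat n) * lowState n m * (V : QMat n)ᴴ) w w).re := by
    intro V
    rw [lowProb_eq_sum]
    have : (U : QMat n)ᴴ * (((U * V : UGroup n) : QMat n) * lowState n m *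
        ((U * V : UGroup n) : QMat n)ᴴ) * (U : QMat n) =
        ((U : QMat n)ᴴ * (U : QMat n)) * ((V : QMat n) * lowState n m * (V : QMat n)ᴴ) *
          ((U : QMat n)ᴴ * (U : QMat n)) := by
      simp only [Submonoid.coe_mul, Matrix.conjTranspose_mul, Matrix.mul_assoc]
    rw [this, U.conjTranspose_mul, Matrix.one_mul, Matrix.mul_one]
  simp_rw [h1]
  rw [integral_finsetSum _ fun w _ => integrable_conj_diag _ w]
  simp only [integral_conj_diag _ htr, Finset.sum_const, card_lowSet h, nsmul_eq_mul]
  push_cast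
  rw [div_eq_mul_inv]

end Acceptance

end QCrypto

namespace QCrypto

/-! ### The reductions to pseudorandomness -/

section Security

variable {lam m : ℕ → ℕ} {U : ∀ n, Bits (lam n) → UGroup n}

/-- Conditioning on `k' ≠ k` scales the mean by at most `N/(N - 1) ≤ 2` for `N ≥ 2` keys. With a
single key the average over the empty set is `0` by convention. -/
theorem expect_erase_le {α : Type*} [Fintype α] [DecidableEq α] {f : α → ℝ} (hf : ∀ x, 0 ≤ f x)
    (a : α) : (Finset.univ.erase a).expect f ≤ 2 * Finset.univ.expect f := by
  rw [Finset.expect_eq_sum_div_card, Finset.expect_eq_sum_div_card,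
    Finset.card_erase_of_mem (Finset.mem_univ _), Finset.card_univ]
  have h1 : ∑ x ∈ Finset.univ.erase a, f x ≤ ∑ x, f x :=
    Finset.sum_le_sum_of_subset_of_nonneg (Finset.erase_subset _ _) fun _ _ _ => hf _
  have h0 : 0 ≤ ∑ x, f x := Finset.sum_nonneg fun x _ => hf x
  have hc : 0 < Fintype.card α := Fintype.card_pos_iff.mpr ⟨a⟩
  obtain h2 | h2 : Fintype.card α = 1 ∨ 2 ≤ Fintype.card α := by omega
  · simp only [h2, Nat.sub_self, Nat.cast_zero, div_zero]
    positivity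
  · have h3 : (2 : ℝ) ≤ Fintype.card α := by exact_mod_cast h2
    rw [Nat.cast_sub (by omega), Nat.cast_one, ← mul_div_assoc,
      div_le_div_iff₀ (by linarith) (by linarith)]
    calc _ ≤ (∑ x, f x) * Fintype.card α := by gcongr
      _ ≤ _ := by nlinarith

/-- Two hybrids: pseudorandomness bounds the change from `U n k` to a Haar unitary, using an oracle
circuit that prepares all `t n` copies itself; the change from there to the ensemble is statistical.
-/
theorem indistFromGHSE_scrambled (hlam : PolyBounded lam)
    (hlam_top : Filter.Tendsto lam Filter.atTop Filter.atTop) (hm : ∀ n, m n ≤ n)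
    (hgap : Filter.Tendsto (fun n : ℕ => ((n : ℝ) - (m n : ℝ)) / Real.log (n : ℝ))
      Filter.atTop Filter.atTop) (hU : IsPRU lam U) :
    IndistFromGHSE lam m fun n k => scrambled (hm n) (U n k) := by
  intro t ht A hA
  let B : ∀ n, OracleCircuit n := fun n => preparedCircuit (A n) (hm n)
    finProdFinEquiv.toEmbedding finProdFinEquiv.symm fun _ => false
  have hB : ∀ n (V : QMat n), (B n).acc V =
      (A n).acc (tensPow (t n) (V * lowState n (m n) * Vᴴ)) := fun n V => by
    refine (preparedCircuit_acc (A n) (hm n) _ _ _ (fun _ => rfl) (fun h => ?_) V).trans ?_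
    · have h0 : t n * n = 0 := by omega
      have := Nat.mul_le_mul_left (t n) (hm n)
      omega
    · rw [tensPow_eq_blockState]
  have hsize : PolyBounded fun n => (B n).size := by
    refine PolyBounded.mono ((polyBounded_const 4).mul
      ((((ht.mul polyBounded_id).add hA).add (ht.mul polyBounded_id)).add ht)) fun n => ?_
    refine (preparedCircuit_size_le _ _ _ _ _).trans ?_
    have := Nat.mul_le_mul_left (t n) (hm n)
    omega
  obtain ⟨μ, hμ, hdist⟩ := hU.2 B hsize
  refine exists_negligible_add hlam hlam_top hgap hμ ht 4 ?_
  filter_upwards [Filter.eventually_ge_atTop 1] with n hn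
  have h1 := hdist n
  simp only [hB] at h1
  have h2 := abs_integral_haarU_sub_ghse_le (hm n) hn (A n)
  simp only [scrambled_eq]
  refine (abs_sub_le _ _ _).trans ((add_le_add h1 h2).trans ?_)
  have := hμ.1 (lam n)
  linarith

/-- For soundness the adversary prepares a state with its oracle and runs the verifier under a fixed
key, with acceptance probability `2^m / 2^n` in the Haar case. -/
theorem isVerifier_verifyCircuit (hlam : PolyBounded lam)
    (hlam_top : Filter.Tendsto lam Filter.atTop Filter.atTop) (hm : ∀ n, m n ≤ n)
    (hgap : Filter.Tendsto (fun n : ℕ => ((n : ℝ) - (m n : ℝ)) / Real.log (n : ℝ))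
      Filter.atTop Filter.atTop) (hU : IsPRU lam U) {G : ∀ n, Circuit (lam n + n)}
    (hG : IsQPT (fun n => lam n + n) (fun n => [n, lam n]) G)
    (hGU : ∀ (n : ℕ) (k : Bits (lam n)) (ψ : Bits n → ℂ), star ψ ⬝ᵥ ψ = 1 →
      (G n).output (tens (ket k) (proj ψ)) = proj ((U n k : QMat n) *ᵥ ψ)) :
    IsVerifier lam m (fun n k => scrambled (hm n) (U n k))
      fun n => verifyCircuit (G n) (n - m n) (Nat.sub_le n (m n)) := by
  set V : ∀ n, Circuit (lam n + n) := fun n => verifyCircuit (G n) (n - m n) (Nat.sub_le n (m n))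
  have hV : IsQPT (fun n => lam n + n) (fun n => [n, lam n, m n]) V := isQPT_verifyCircuit hG
  have hacc : ∀ n (k : Bits (lam n)) (σ : QMat n), (V n).acc (tens (ket k) σ) =
      lowProb (m n) (U n k) σ := fun n k σ => verifyCircuit_acc (G n) _ k (U n k) (hGU n k) σ
  refine ⟨hV, fun n k => ?_, ?_⟩
  · beta_reduce
    rw [hacc, scrambled_eq, lowProb_scrambled_self (hm n)]
  simp only [hacc, scrambled_eq]
  -- The worst key for each `n` is hard-wired into the non-uniform adversary, so that one negligible
  -- function serves all keys.
  choose κ hκ using fun n => Finite.exists_max fun k : Bits (lam n) =>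
    (Finset.univ.erase k).expect fun k' => lowProb (m n) (U n k')
      ((U n k : QMat n) * lowState n (m n) * (U n k : QMat n)ᴴ)
  let B : ∀ n, OracleCircuit n := fun n => preparedCircuit (V n) (hm n) (lastBlock (lam n) n)
    (Equiv.uniqueProd (Fin (m n)) (Fin 1)).symm (Fin.append (κ n) fun _ => false)
  have hB : ∀ n (W : UGroup n), (B n).acc (W : QMat n) =
      lowProb (m n) (U n (κ n)) ((W : QMat n) * lowState n (m n) * (W : QMat n)ᴴ) := fun n W => by
    refine (preparedCircuit_acc (V n) (hm n) _ _ _ (fun p => ?_) (fun h => ?_) W).trans ?_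
    · exact Fin.append_right _ _ _
    · have : (V n).anc = (G n).anc + (n + (n - m n + 2)) := rfl
      omega
    · rw [← tens_ket_eq_blockState, hacc]
  have hsize : PolyBounded fun n => (B n).size := by
    refine PolyBounded.mono ((polyBounded_const 4).mul
      ((((hlam.add polyBounded_id).add hV.1).add polyBounded_id).add (polyBounded_const 1)))
      fun n => ?_
    refine (preparedCircuit_size_le _ _ _ _ _).trans ?_
    have := hm n
    omega
  obtain ⟨μ, hμ, hdist⟩ := hU.2 B hsize
  have hneg := exists_negligible_add hlam hlam_top hgap hμ (polyBounded_const 1) 2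
    (f := fun n => (Finset.univ.erase (κ n)).expect fun k' => lowProb (m n) (U n k')
      ((U n (κ n) : QMat n) * lowState n (m n) * (U n (κ n) : QMat n)ᴴ))
    (Filter.Eventually.of_forall fun n => by
      have h1 := hdist n
      simp only [hB, integral_lowProb (hm n)] at h1
      have h2 := expect_erase_le (fun k' => lowProb_scrambled_nonneg (m := m n) (U n k') (U n (κ n)))
        (κ n)
      refine h2.trans ?_
      simp only [lowProb_scrambled_comm (U n _) (U n (κ n))]
      have h3 : (2 : ℝ) ^ m n / 2 ^ n ≤ √((2 : ℝ) ^ m n / 2 ^ n) := by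
        refine Real.le_sqrt_of_sq_le (pow_le_of_le_one (by positivity) ?_ two_ne_zero)
        rw [div_le_one (by positivity)]
        exact pow_le_pow_right₀ (by norm_num) (hm n)
      have h4 := (abs_le.mp h1).2
      push_cast
      linarith)
  obtain ⟨ν, hν, hle⟩ := hneg
  exact ⟨ν, hν, fun n k => (hκ n k).trans (hle n)⟩

end Security

end QCrypto

theorem mainTheorem4 (lam m : ℕ → ℕ)
    (hlam : PolyBounded lam)
    (hlam_top : Filter.Tendsto lam Filter.atTop Filter.atTop)
    (hm : ∀ n, m n ≤ n)
    (hgap : Filter.Tendsto (fun n : ℕ => ((n : ℝ) - (m n : ℝ)) / Real.log (n : ℝ))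
      Filter.atTop Filter.atTop)
    (U : ∀ n, Bits (lam n) → UGroup n) (hU : IsPRU lam U) :
    IsVPRDM lam m (fun n k => scrambled (hm n) (U n k)) ∧
    ∃ V : ∀ n, Circuit (lam n + n),
      IsVerifier lam m (fun n k => scrambled (hm n) (U n k)) V ∧
      ∀ (n : ℕ) (k : Bits (lam n)) (σ : QMat n), IsDensity σ →
        (((V n).acc (tens (ket k) σ) : ℝ) : ℂ) =
          (zeroState (n - m n) *
            traceRight (recast (Nat.sub_add_cancel (hm n)).symm
              ((U n k : QMat n)ᴴ * σ * (U n k : QMat n)))).trace := by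
  obtain ⟨G, hG, hGU⟩ := hU.1
  have hV := isVerifier_verifyCircuit hlam hlam_top hm hgap hU hG hGU
  refine ⟨⟨fun n k => isDensity_scrambled (hm n) (U n k),
    ⟨fun n => prepCircuit (G n) (hm n), isQPT_prepCircuit hm hG, fun n k => ?_⟩,
    indistFromGHSE_scrambled hlam hlam_top hm hgap hU, _, hV⟩, _, hV, fun n k σ hσ => ?_⟩
  · beta_reduce
    rw [prepCircuit_output, (G n).output_eq_of_proj k _ (hGU n k), scrambled_eq]
  · rw [verifyCircuit_acc (G n) _ k (U n k) (hGU n k) σ]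
    exact lowProb_eq_trace (hm n) (U n k) hσ.1
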